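/- **Setup.** For each $G\ge 1$ we observe $2G$ clusters. Cluster $g$ has a size $N_g\in\{1,2,\dots\}$, covariates $X_g\in\mathbf R^k$, a random set $S_g\subseteq\{1,\dots,N_g\}$ of sampled units, potential outcomes $Y_{i,g}(d)$ for $1\le i\le N_g$, $d\in\{0,1\}$, and a treatment $D_g\in\{0,1\}$; the observed outcomes are $Y_{i,g}=Y_{i,g}(1)D_g+Y_{i,g}(0)(1-D_g)$, $i\in S_g$. Write $W_g=(N_g,X_g)$, $X^{(G)}=(X_g)_{g\le 2G}$ (similarly $W^{(G)}$, $D^{(G)}$), $\bar Y_g(d)=\frac1{|S_g|}\sum_{i\in S_g}Y_{i,g}(d)$, $\bar Y_g=\frac1{|S_g|}\sum_{i\in S_g}Y_{i,g}$; $|\cdot|$ is the Euclidean norm, and $\xrightarrow{P}$ is convergence in probability as $G\to\infty$. Let $\pi$ be a permutation of $\{1,\dots,2G\}$, depending measurably on the matching variables; the pairs are $\{\pi(2j-1),\pi(2j)\}$, $1\le j\le G$. **Sampling assumption (Q).** The distribution of a cluster does not depend on $g$ or $G$, and: (a) the $(S_g,X_g,N_g)$, $1\le g\le 2G$, are i.i.d.;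 (b) conditionally on $(S_g,X_g,N_g)_{g\le 2G}$ the vectors $(Y_{i,g}(1),Y_{i,g}(0):1\le i\le N_g)$, $g\le 2G$, have joint law $\prod_g R(S_g,X_g,N_g)$ for some family of distributions $R(s,x,n)$; (c) $P\{|S_g|\ge1\}=1$ and $E[N_g^2]<\infty$; (d) for some $K<\infty$ and both $d$, almost surely $E[Y_{i,g}^2(d)\mid N_g,X_g]\le K$ for all $1\le i\le N_g$; (e) $S_g$ is independent of $(Y_{i,g}(1),Y_{i,g}(0):1\le i\le N_g)$ conditionally on $(X_g,N_g)$; (f) $E[\bar Y_g(d)\mid N_g]=E[\frac1{N_g}\sum_{i\le N_g}Y_{i,g}(d)\mid N_g]$ a.s. for both $d$. **Estimator.** Let $$\hat Y_g=\frac{N_g}{\frac1{2G}\sum_{j\le 2G}N_j}\left(\bar Y_g-\frac{\frac1G\sum_{j\le 2G}\bar Y_jI\{D_j=D_g\}N_j}{\frac1G\sum_{j\le 2G}I\{D_j=D_g\}N_j}\right),\qquad \hat\tau_G^2=\frac1G\sum_{j\le G}\left(\hat Y_{\pi(2j)}-\hat Y_{\pi(2j-1)}\right)^2,$$ $$\hat\lambda_G^2=\frac2G\sum_{j\le\lfloor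 G/2\rfloor}(\hat Y_{\pi(4j-3)}-\hat Y_{\pi(4j-2)})(\hat Y_{\pi(4j-1)}-\hat Y_{\pi(4j)})(D_{\pi(4j-3)}-D_{\pi(4j-2)})(D_{\pi(4j-1)}-D_{\pi(4j)}),$$ and $\hat v_G^2=\hat\tau_G^2-\frac12\hat\lambda_G^2$. Let $\tilde Y_g(d)=\frac{N_g}{E[N_g]}\left(\bar Y_g(d)-\frac{E[\bar Y_g(d)N_g]}{E[N_g]}\right)$ and $$\omega^2=E[\tilde Y_g^2(1)]+E[\tilde Y_g^2(0)]-\tfrac12E\big[(E[\tilde Y_g(1)+\tilde Y_g(0)\mid X_g])^2\big],$$ $$\nu^2=E[\tilde Y_g^2(1)]+E[\tilde Y_g^2(0)]-\tfrac12E\big[(E[\tilde Y_g(1)+\tilde Y_g(0)\mid X_g,N_g])^2\big].$$ **Theorem.** Suppose (Q) holds. (1) *Not matching on size.* Let $\pi=\pi_G(X^{(G)})$ and suppose that - $((Y_{i,g}(1),Y_{i,g}(0):1\le i\le N_g),N_g,S_g)_{g\le 2G}$ and $D^{(G)}$ are independent conditionally on $X^{(G)}$, and conditionally on $X^{(G)}$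 the $(D_{\pi(2j-1)},D_{\pi(2j)})$, $j\le G$, are i.i.d. uniform on $\{(0,1),(1,0)\}$; - $\frac1G\sum_{j\le G}|X_{\pi(2j)}-X_{\pi(2j-1)}|^r\xrightarrow{P}0$ for $r\in\{1,2\}$; - $x\mapsto E[\bar Y_g^r(d)N_g^\ell\mid X_g=x]$ is Lipschitz for $d\in\{0,1\}$, $r,\ell\in\{0,1,2\}$, and $E[N_g\mid X_g]\le K$ a.s. for some $K<\infty$; - $\frac1G\sum_{j\le\lfloor G/2\rfloor}|X_{\pi(4j-a)}-X_{\pi(4j-b)}|^2\xrightarrow{P}0$ for $a\in\{2,3\}$, $b\in\{0,1\}$. Then $\hat v_G^2\xrightarrow{P}\omega^2$. (2) *Matching on size.* Let $\pi=\pi_G(W^{(G)})$ and suppose that - $((Y_{i,g}(1),Y_{i,g}(0):1\le i\le N_g),S_g)_{g\le 2G}$ and $D^{(G)}$ are independent conditionally on $W^{(G)}$, and conditionally on $W^{(G)}$ the $(D_{\pi(2j-1)},D_{\pi(2j)})$, $j\le G$, are i.i.d. uniform on $\{(0,1),(1,0)\}$; - $\frac1G\sum_{j\le G}N_{\pi(2j)}^\ell|W_{\pi(2j)}-W_{\pi(2j-1)}|^r\xrightarrow{P}0$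 for $\ell\in\{0,1,2\}$, $r\in\{1,2\}$; - $w\mapsto E[\bar Y_g^r(d)\mid W_g=w]$ is Lipschitz for $d\in\{0,1\}$, $r\in\{1,2\}$; - $\frac1G\sum_{j\le\lfloor G/2\rfloor}N_{\pi(4j-a)}^2|W_{\pi(4j-a)}-W_{\pi(4j-b)}|^2\xrightarrow{P}0$ for $a\in\{2,3\}$, $b\in\{0,1\}$. Then $\hat v_G^2\xrightarrow{P}\nu^2$. -/

import Mathlib

open MeasureTheory ProbabilityTheory Filter Topology

namespace ClusterTrial

noncomputable section

/-! ### General probability -/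

/-- Convergence in probability to a constant of random variables `T G`, where `T G` is defined on
its own probability space `(Ω G, P G)`. -/
def TendstoInProb {Ω : ℕ → Type*} [∀ G, MeasurableSpace (Ω G)] (P : ∀ G, Measure (Ω G))
    (T : ∀ G, Ω G → ℝ) (c : ℝ) : Prop :=
  ∀ ε : ℝ, 0 < ε → Tendsto (fun G => P G {ω | ε ≤ |T G ω - c|}) atTop (𝓝 0)

/-- The σ-algebra generated by a random variable `V`. -/
abbrev sigma {Ω E : Type*} [MeasurableSpace E] (V : Ω → E) : MeasurableSpace Ω :=
  MeasurableSpace.comap V inferInstance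

/-- `f` and `h` are conditionally independent given `V`. This is the usual definition through
conditional probabilities; Mathlib has the same notion `CondIndepFun`, but only for standard Borel
probability spaces. -/
def CondIndepGiven {Ω E α β : Type*} [MeasurableSpace Ω] [MeasurableSpace E] [MeasurableSpace α]
    [MeasurableSpace β] (P : Measure Ω) (V : Ω → E) (f : Ω → α) (h : Ω → β) : Prop :=
  ∀ (s : Set α) (t : Set β), MeasurableSet s → MeasurableSet t →
    P⟦f ⁻¹' s ∩ h ⁻¹' t | sigma V⟧ =ᵐ[P] P⟦f ⁻¹' s | sigma V⟧ * P⟦h ⁻¹' t | sigma V⟧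

/-- `E[Z | V = v]` is a Lipschitz function of `v`, i.e. it has a Lipschitz version. -/
def HasLipschitzCondExp {Ω E : Type*} [MeasurableSpace Ω] [PseudoEMetricSpace E]
    [MeasurableSpace E] (P : Measure Ω) (Z : Ω → ℝ) (V : Ω → E) : Prop :=
  ∃ (f : E → ℝ) (K : NNReal), LipschitzWith K f ∧
    P[Z | sigma V] =ᵐ[P] fun ω => f (V ω)

/-! ### Clusters -/

/-- Covariates `X_g ∈ ℝ^k`, with the Euclidean norm. -/
abbrev Cov (k : ℕ) := EuclideanSpace ℝ (Fin k)

/-- Values of `W_g = (N_g, X_g) ∈ ℝ^(1 + k)`, with the Euclidean norm. -/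
abbrev CovSize (k : ℕ) := WithLp 2 (ℝ × Cov k)

/-- A random cluster on `Ω`: its size `N`, covariates `X`, set `S ⊆ {1, …, N}` of sampled units,
and potential outcomes `Y ω i d` of the units `1 ≤ i ≤ N` under treatment `d` (`true` is `1`,
`false` is `0`). The vector `(Y_i(1), Y_i(0) : 1 ≤ i ≤ N)` of random length is encoded as the
sequence that is `0` at all other indices. -/
structure Cluster (k : ℕ) (Ω : Type*) [MeasurableSpace Ω] where
  N : Ω → ℕ
  X : Ω → Cov k
  S : Ω → Finset ℕ
  Y : Ω → ℕ → Bool → ℝ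
  measurable_N : Measurable N
  measurable_X : Measurable X
  measurable_S : Measurable S
  measurable_Y : Measurable Y
  S_subset : ∀ ω, S ω ⊆ Finset.Icc 1 (N ω)
  Y_eq_zero : ∀ ω i d, i ∉ Finset.Icc 1 (N ω) → Y ω i d = 0

namespace Cluster

variable {k : ℕ} {Ω : Type*} [MeasurableSpace Ω]

/-- `(S_g, X_g, N_g)`. -/
def char (c : Cluster k Ω) (ω : Ω) : Finset ℕ × Cov k × ℕ := (c.S ω, c.X ω, c.N ω)

/-- `W_g = (N_g, X_g)`. -/
def W (c : Cluster k Ω) (ω : Ω) : CovSize k := WithLp.toLp 2 ((c.N ω : ℝ), c.X ω)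

/-- The mean `Ȳ_g(d)` of the potential outcomes of the sampled units. -/
def Ybar (c : Cluster k Ω) (d : Bool) (ω : Ω) : ℝ :=
  (1 / ((c.S ω).card : ℝ)) * ∑ i ∈ c.S ω, c.Y ω i d

/-- The mean of the potential outcomes of all units of the cluster. -/
def Yfull (c : Cluster k Ω) (d : Bool) (ω : Ω) : ℝ :=
  (1 / (c.N ω : ℝ)) * ∑ i ∈ Finset.Icc 1 (c.N ω), c.Y ω i d

/-- `E[N_g]`. -/
def meanN (c : Cluster k Ω) (P : Measure Ω) : ℝ := ∫ ω, (c.N ω : ℝ) ∂P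

/-- `Ỹ_g(d) = (N_g / E[N_g]) (Ȳ_g(d) - E[Ȳ_g(d) N_g] / E[N_g])`. -/
def Ytilde (c : Cluster k Ω) (P : Measure Ω) (d : Bool) (ω : Ω) : ℝ :=
  (c.N ω : ℝ) / c.meanN P *
    (c.Ybar d ω - (∫ ω', c.Ybar d ω' * (c.N ω' : ℝ) ∂P) / c.meanN P)

/-- `E[Ỹ²(1)] + E[Ỹ²(0)] - ½ E[(E[Ỹ(1) + Ỹ(0) | V])²]`. -/
def asympVar {E : Type*} [MeasurableSpace E] (c : Cluster k Ω) (P : Measure Ω) (V : Ω → E) : ℝ :=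
  (∫ ω, c.Ytilde P true ω ^ 2 ∂P) + (∫ ω, c.Ytilde P false ω ^ 2 ∂P)
    - 1 / 2 * ∫ ω, (P[fun ω' => c.Ytilde P true ω' + c.Ytilde P false ω' | sigma V]) ω ^ 2 ∂P

/-- `ω²`: conditioning on `X_g`. -/
def omegaSq (c : Cluster k Ω) (P : Measure Ω) : ℝ :=
  c.asympVar P c.X

/-- `ν²`: conditioning on `W_g = (N_g, X_g)`. -/
def nuSq (c : Cluster k Ω) (P : Measure Ω) : ℝ :=
  c.asympVar P c.W

end Cluster

/-! ### Assumptions on the distribution of the clusters -/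

instance standardBorelSpace_outcomes (n : ℕ) : StandardBorelSpace (Fin n → ℕ → Bool → ℝ) :=
  StandardBorelSpace.pi_countable

section Population

variable {k : ℕ} {Ω₀ : Type*} [MeasurableSpace Ω₀]

/-- The maintained assumptions on the distribution `Q_G` of `2G` clusters, `G = 0, 1, 2, …`. The
sample of size `2G` lives on `(Ω G, P G)`; the cluster `c` on `(Ω₀, P₀)` is a generic draw from the
common distribution of a cluster, so that conditions on each single cluster are stated for `c`.
The family `R(s, x, n)` is the conditional law of the outcomes of `c` given `(S, X, N)`. -/
structure SamplingAssumption {Ω : ℕ → Type*} [∀ G, MeasurableSpace (Ω G)]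
    (P₀ : Measure Ω₀) [IsProbabilityMeasure P₀] (c : Cluster k Ω₀)
    (P : ∀ G, Measure (Ω G)) [∀ G, IsProbabilityMeasure (P G)]
    (C : ∀ G, Fin (2 * G) → Cluster k (Ω G)) : Prop where
  /-- (a) The `(S_g, X_g, N_g)` are independent, with the same distribution. -/
  indep_char : ∀ G, iIndepFun (fun g => (C G g).char) (P G)
  ident_char : ∀ G g, IdentDistrib (C G g).char c.char (P G) P₀
  /-- (b) Given all `(S_g, X_g, N_g)`, the outcomes have law `∏ R(S_g, X_g, N_g)`. -/
  cond_law : ∀ G, ∀ᵐ v ∂((P G).map fun ω g => (C G g).char ω),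
    condDistrib (fun ω g => (C G g).Y ω) (fun ω g => (C G g).char ω) (P G) v =
      Measure.pi fun g => condDistrib c.Y c.char P₀ (v g)
  /-- (c) At least one unit is sampled, and `E[N²] < ∞`. -/
  one_le_card : ∀ᵐ ω ∂P₀, 1 ≤ (c.S ω).card
  integrable_sq : Integrable (fun ω => (c.N ω : ℝ) ^ 2) P₀
  /-- (d) `E[Y_i²(d) | N, X] ≤ K` for all `1 ≤ i ≤ N`, almost surely. -/
  integrable_outcome : ∀ i d, Integrable (fun ω => c.Y ω i d ^ 2) P₀
  bounded_moment : ∃ K : ℝ, ∀ d, ∀ᵐ ω ∂P₀, ∀ i ∈ Finset.Icc 1 (c.N ω),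
    (P₀[fun ω' => c.Y ω' i d ^ 2 | sigma c.W]) ω ≤ K
  /-- (e) `S` and the potential outcomes are conditionally independent given `(X, N)`. -/
  cond_indep : CondIndepGiven P₀ c.W c.S c.Y
  /-- (f) `E[Ȳ(d) | N] = E[(1/N) ∑_{i ≤ N} Y_i(d) | N]` almost surely. -/
  cond_mean : ∀ d, P₀[c.Ybar d | sigma c.N]
    =ᵐ[P₀] P₀[c.Yfull d | sigma c.N]

/-- Smoothness when size is not matched on: `E[Ȳ^r(d) N^l | X = x]` is Lipschitz for
`r, l ∈ {0, 1, 2}`, and `E[N | X]` is bounded. -/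
structure SmoothX (P₀ : Measure Ω₀) (c : Cluster k Ω₀) : Prop where
  lipschitz : ∀ d, ∀ r ≤ 2, ∀ l ≤ 2,
    HasLipschitzCondExp P₀ (fun ω => c.Ybar d ω ^ r * (c.N ω : ℝ) ^ l) c.X
  bounded : ∃ K : ℝ, ∀ᵐ ω ∂P₀,
    (P₀[fun ω' => (c.N ω' : ℝ) | sigma c.X]) ω ≤ K

/-- Smoothness when size is matched on: `E[Ȳ^r(d) | W = w]` is Lipschitz for `r ∈ {1, 2}`. -/
def SmoothW (P₀ : Measure Ω₀) (c : Cluster k Ω₀) : Prop :=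
  ∀ d, ∀ r ∈ ({1, 2} : Finset ℕ), HasLipschitzCondExp P₀ (fun ω => c.Ybar d ω ^ r) c.W

end Population

/-! ### Pairs

A permutation `σ` of the `2G` clusters gives the pairs `{σ(2j-1), σ(2j)}`, `j = 1, …, G`, and the
pairs of pairs `{σ(4j-3), σ(4j-2)}, {σ(4j-1), σ(4j)}`, `j = 1, …, ⌊G/2⌋`. In the code all indices
start at `0`. -/

/-- The position `2j-1` (counted from `1`) of the first member of a pair. -/
def fstPos {G : ℕ} (j : Fin G) : Fin (2 * G) := ⟨2 * j, by omega⟩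

/-- The position `2j` (counted from `1`) of the second member of a pair. -/
def sndPos {G : ℕ} (j : Fin G) : Fin (2 * G) := ⟨2 * j + 1, by omega⟩

/-- The positions `4j-3, 4j-2, 4j-1, 4j` (counted from `1`), for `r = 0, 1, 2, 3`. -/
def quadPos {G : ℕ} (j : Fin (G / 2)) (r : Fin 4) : Fin (2 * G) := ⟨4 * j + r, by omega⟩

/-! ### The estimator -/

section Estimator

variable {k G : ℕ} {Ω : Type*} [MeasurableSpace Ω]
  (C : Fin (2 * G) → Cluster k Ω) (D : Fin (2 * G) → Ω → Bool)

/-- The treatment status `D_g ∈ {0, 1}` as a real number. -/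
def treat (g : Fin (2 * G)) (ω : Ω) : ℝ := if D g ω then 1 else 0

/-- The observed outcomes `Y_{i,g} = Y_{i,g}(1) D_g + Y_{i,g}(0) (1 - D_g)`. -/
def Yobs (g : Fin (2 * G)) (i : ℕ) (ω : Ω) : ℝ :=
  (C g).Y ω i true * treat D g ω + (C g).Y ω i false * (1 - treat D g ω)

/-- The observed mean `Ȳ_g` over the sampled units. -/
def YbarObs (g : Fin (2 * G)) (ω : Ω) : ℝ :=
  (1 / (((C g).S ω).card : ℝ)) * ∑ i ∈ (C g).S ω, Yobs C D g i ω

/-- The feasible transformed outcome `Ŷ_g`. -/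
def Yhat (g : Fin (2 * G)) (ω : Ω) : ℝ :=
  ((C g).N ω : ℝ) / ((1 / (2 * (G : ℝ))) * ∑ j, ((C j).N ω : ℝ)) *
    (YbarObs C D g ω -
      ((1 / (G : ℝ)) * ∑ j, YbarObs C D j ω * (if D j ω = D g ω then 1 else 0) * ((C j).N ω : ℝ)) /
      ((1 / (G : ℝ)) * ∑ j, (if D j ω = D g ω then 1 else 0) * ((C j).N ω : ℝ)))

variable (σ : Ω → Equiv.Perm (Fin (2 * G)))

/-- `τ̂²_G`, for the (random) pairing `σ`. -/
def tauSqHat (ω : Ω) : ℝ :=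
  (1 / (G : ℝ)) * ∑ j : Fin G,
    (Yhat C D (σ ω (sndPos j)) ω - Yhat C D (σ ω (fstPos j)) ω) ^ 2

/-- `λ̂²_G`, for the (random) pairing `σ`. -/
def lambdaSqHat (ω : Ω) : ℝ :=
  (2 / (G : ℝ)) * ∑ j : Fin (G / 2),
    (Yhat C D (σ ω (quadPos j 0)) ω - Yhat C D (σ ω (quadPos j 1)) ω) *
    (Yhat C D (σ ω (quadPos j 2)) ω - Yhat C D (σ ω (quadPos j 3)) ω) *
    (treat D (σ ω (quadPos j 0)) ω - treat D (σ ω (quadPos j 1)) ω) *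
    (treat D (σ ω (quadPos j 2)) ω - treat D (σ ω (quadPos j 3)) ω)

/-- `v̂²_G = τ̂²_G - ½ λ̂²_G`. -/
def vSqHat (ω : Ω) : ℝ := tauSqHat C D σ ω - 1 / 2 * lambdaSqHat C D σ ω

/-- Conditionally on `V`, the `(D_{σ(2j-1)}, D_{σ(2j)})`, `j = 1, …, G`, are i.i.d. and uniformly
distributed on `{(0,1), (1,0)}`. -/
def UniformWithinPairs {E : Type*} [MeasurableSpace E] (P : Measure Ω) (V : Ω → E) : Prop :=
  ∀ e : Fin G → Bool × Bool,
    P⟦{ω | ∀ j, (D (σ ω (fstPos j)) ω, D (σ ω (sndPos j)) ω) = e j} | sigma V⟧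
      =ᵐ[P] fun _ => ∏ j, if e j = (false, true) ∨ e j = (true, false) then (1 / 2 : ℝ) else 0

end Estimator

/-! ### Assumptions on the treatment assignment and the pairs -/

section Design

variable {k : ℕ} {Ω : ℕ → Type*} [∀ G, MeasurableSpace (Ω G)]

/-- A matching rule, which for each `G` maps the values (in `V`) of the matching variables of the
`2G` clusters to a permutation of the clusters. -/
structure MatchingRule (V : Type*) [MeasurableSpace V] where
  perm : ∀ G : ℕ, (Fin (2 * G) → V) → Equiv.Perm (Fin (2 * G))
  measurable_perm : ∀ G σ, MeasurableSet (perm G ⁻¹' {σ})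

/-- The random permutation `π_G(X^(G))`. -/
def MatchingRule.onX (π : MatchingRule (Cov k)) (C : ∀ G, Fin (2 * G) → Cluster k (Ω G))
    (G : ℕ) (ω : Ω G) : Equiv.Perm (Fin (2 * G)) := π.perm G fun g => (C G g).X ω

/-- The random permutation `π_G(W^(G))`. -/
def MatchingRule.onW (π : MatchingRule (CovSize k)) (C : ∀ G, Fin (2 * G) → Cluster k (Ω G))
    (G : ℕ) (ω : Ω G) : Equiv.Perm (Fin (2 * G)) := π.perm G fun g => (C G g).W ω

variable (P : ∀ G, Measure (Ω G)) (C : ∀ G, Fin (2 * G) → Cluster k (Ω G))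
  (D : ∀ G, Fin (2 * G) → Ω G → Bool) (σ : ∀ G, Ω G → Equiv.Perm (Fin (2 * G)))

/-- Treatment assignment when size is not matched on. -/
structure AssignmentX : Prop where
  cond_indep : ∀ G, CondIndepGiven (P G)
    (fun ω g => (C G g).X ω)
    (fun ω g => ((C G g).Y ω, (C G g).N ω, (C G g).S ω)) (fun ω g => D G g ω)
  uniform : ∀ G, UniformWithinPairs (D G) (σ G) (P G)
    (fun ω g => (C G g).X ω)

/-- Treatment assignment when size is matched on. -/
structure AssignmentW : Prop where
  cond_indep : ∀ G, CondIndepGiven (P G)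
    (fun ω g => (C G g).W ω)
    (fun ω g => ((C G g).Y ω, (C G g).S ω)) (fun ω g => D G g ω)
  uniform : ∀ G, UniformWithinPairs (D G) (σ G) (P G)
    (fun ω g => (C G g).W ω)

/-- `(1/G) ∑_j |X_{π(2j)} - X_{π(2j-1)}|^r → 0` in probability for `r ∈ {1, 2}`. -/
def ClosePairsX : Prop :=
  ∀ r ∈ ({1, 2} : Finset ℕ), TendstoInProb P (fun G ω => (1 / (G : ℝ)) * ∑ j : Fin G,
    ‖(C G (σ G ω (sndPos j))).X ω - (C G (σ G ω (fstPos j))).X ω‖ ^ r) 0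

/-- `(1/G) ∑_j N_{π(2j)}^l |W_{π(2j)} - W_{π(2j-1)}|^r → 0` in probability for `l ∈ {0, 1, 2}` and
`r ∈ {1, 2}`. -/
def ClosePairsW : Prop :=
  ∀ l ∈ ({0, 1, 2} : Finset ℕ), ∀ r ∈ ({1, 2} : Finset ℕ),
    TendstoInProb P (fun G ω => (1 / (G : ℝ)) * ∑ j : Fin G,
      ((C G (σ G ω (sndPos j))).N ω : ℝ) ^ l *
        ‖(C G (σ G ω (sndPos j))).W ω - (C G (σ G ω (fstPos j))).W ω‖ ^ r) 0

/-- `(1/G) ∑_{j ≤ ⌊G/2⌋} |X_{π(4j-a)} - X_{π(4j-b)}|² → 0` in probability for `a ∈ {2, 3}` and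
`b ∈ {0, 1}`; `4j-3, 4j-2` are the positions `0, 1` and `4j-1, 4j` the positions `2, 3` of a pair
of pairs. -/
def ClosePairsOfPairsX : Prop :=
  ∀ a ∈ ({0, 1} : Finset (Fin 4)), ∀ b ∈ ({2, 3} : Finset (Fin 4)),
    TendstoInProb P (fun G ω => (1 / (G : ℝ)) * ∑ j : Fin (G / 2),
      ‖(C G (σ G ω (quadPos j a))).X ω - (C G (σ G ω (quadPos j b))).X ω‖ ^ 2) 0

/-- `(1/G) ∑_{j ≤ ⌊G/2⌋} N_{π(4j-a)}² |W_{π(4j-a)} - W_{π(4j-b)}|² → 0` in probability for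
`a ∈ {2, 3}` and `b ∈ {0, 1}`. -/
def ClosePairsOfPairsW : Prop :=
  ∀ a ∈ ({0, 1} : Finset (Fin 4)), ∀ b ∈ ({2, 3} : Finset (Fin 4)),
    TendstoInProb P (fun G ω => (1 / (G : ℝ)) * ∑ j : Fin (G / 2),
      ((C G (σ G ω (quadPos j a))).N ω : ℝ) ^ 2 *
        ‖(C G (σ G ω (quadPos j a))).W ω - (C G (σ G ω (quadPos j b))).W ω‖ ^ 2) 0

end Design

end

end ClusterTrial

open ClusterTrial

open MeasureTheory ProbabilityTheory Filter Topology

/-! Exactly one cluster of each pair is treated, so the estimator sees the outcomes only through the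
treated-minus-control contrasts `δ j`. The signs in `λ̂²` turn its summands into products of
contrasts of neighbouring pairs, and `v̂²` becomes `pairVar δ` (`vSqHat_eq_pairVar`).

The assumptions amount to a simple model: the full data of the clusters are i.i.d., and independent
fair coins decide which member of each pair is treated (`map_condDistrib_pi`, `map_prod_coin`,
`IsPairedSample`). The random pairing is a function of the data, hence independent of the coins.

Suppose the outcomes `y` were bounded. Given the matching variables `V` the pairs are independent,
so `pairVar` concentrates at its conditional mean, which is explicit in the conditional first and
second moments `m`, `q` of the outcomes. If `m` were constant within pairs and within pairs of
pairs, then, per cluster, the squares would contribute `q(1) + q(0) - 2 m(1) m(0)` and the products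
`½ (m(1) - m(0))²`; the difference is `q(1) + q(0) - ½ (m(1) + m(0))²`. A law of large numbers gives
the limit `E y(1)² + E y(0)² - ½ E (E[y(1) + y(0) | V])²`. Closeness of the matched clusters makes
the error negligible (`abs_meanPairVar_sub_le`).

The outcomes only have second moments, so they are truncated. `pairVar` is continuous in mean square
(`abs_pairVar_sub_le`), and the truncation error is small in mean uniformly in `G`. The same
continuity allows the feasible `Ŷ` to replace `Ỹ`: they differ only through sample averages of sizes
and of outcomes in each arm, which converge (`tendstoInProb_feasibleOutcome`). Everything is
combined in `tendstoInProb_pairVar`.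

What remains is regularity of the conditional mean of `Ỹ(d)`. Given `X` it is a combination of
Lipschitz functions. Given `W` it is `N` times a bounded Lipschitz function up to constants, so its
increments are bounded by a multiple of `N |W - W'|`, which is what the size-weighted closeness
conditions control. -/

namespace ClusterTrial

/-! ### Convergence in probability: algebra, approximation, Markov and Chebyshev bounds -/

section ConvergenceInProbability

variable {Ω : ℕ → Type*} [∀ G, MeasurableSpace (Ω G)] {P : ∀ G, Measure (Ω G)}

theorem TendstoInProb.map₂ {T S : ∀ G, Ω G → ℝ} {a b : ℝ} (hT : TendstoInProb P T a)
    (hS : TendstoInProb P S b) {f : ℝ × ℝ → ℝ} (hf : ContinuousAt f (a, b)) :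
    TendstoInProb P (fun G ω => f (T G ω, S G ω)) (f (a, b)) := by
  intro ε hε
  obtain ⟨δ, hδ, h⟩ := Metric.continuousAt_iff.1 hf ε hε
  have h2 : Tendsto (fun G => P G {ω | δ ≤ |T G ω - a|} + P G {ω | δ ≤ |S G ω - b|}) atTop (𝓝 0) := by
    simpa using (hT δ hδ).add (hS δ hδ)
  refine tendsto_of_tendsto_of_tendsto_of_le_of_le tendsto_const_nhds h2 (fun _ => zero_le)
    fun G => (measure_mono ?_).trans (measure_union_le _ _)
  intro ω hω
  by_contra hc
  simp only [Set.mem_union, Set.mem_ofPred_eq, not_or, not_le] at hc hω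
  have := @h (T G ω, S G ω) (by rw [Prod.dist_eq]; exact max_lt hc.1 hc.2)
  rw [Real.dist_eq] at this
  linarith

theorem TendstoInProb.squeeze {T X : ∀ G, Ω G → ℝ} {c : ℝ} (hX : TendstoInProb P X 0)
    (h : ∀ᶠ G in atTop, ∀ᵐ ω ∂P G, |T G ω - c| ≤ |X G ω|) : TendstoInProb P T c := by
  intro ε hε
  refine tendsto_of_tendsto_of_tendsto_of_le_of_le' tendsto_const_nhds (hX ε hε)
    (Eventually.of_forall fun _ => zero_le) (h.mono fun G hG => measure_mono_ae ?_)
  filter_upwards [hG] with ω hω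
  intro (h1 : ε ≤ _)
  show ε ≤ |_ - 0|
  rw [sub_zero]
  exact h1.trans hω

theorem TendstoInProb.const_mul {X : ∀ G, Ω G → ℝ} (hX : TendstoInProb P X 0) (a : ℝ) :
    TendstoInProb P (fun G ω => a * X G ω) 0 := by
  simpa using hX.map₂ hX (f := fun p => a * p.1) (by fun_prop)

theorem TendstoInProb.add {X Y : ∀ G, Ω G → ℝ} (hX : TendstoInProb P X 0)
    (hY : TendstoInProb P Y 0) : TendstoInProb P (fun G ω => X G ω + Y G ω) 0 := by
  simpa using hX.map₂ hY (f := fun p => p.1 + p.2) (by fun_prop)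

theorem tendstoInProb_const_div (a : ℝ) : TendstoInProb P (fun G _ => a / (G : ℝ)) 0 := by
  intro ε hε
  refine (tendsto_congr' ?_).2 tendsto_const_nhds
  have h := (tendsto_const_div_atTop_nhds_zero_nat a).abs
  rw [abs_zero] at h
  filter_upwards [h.eventually (gt_mem_nhds hε)] with G hG
  simp [not_le.2 hG]

theorem measure_le_ofReal_div {Ω : Type*} [MeasurableSpace Ω] {P : Measure Ω} {R : Ω → ℝ}
    {η ε : ℝ} (hR : Integrable R P) (h0 : 0 ≤ᵐ[P] R) (hη : ∫ ω, R ω ∂P ≤ η) (hε : 0 < ε) :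
    P {ω | ε ≤ R ω} ≤ ENNReal.ofReal (η / ε) := by
  have h1 : P {ω | ε ≤ R ω} ≤ P {ω | ENNReal.ofReal ε ≤ ENNReal.ofReal (R ω)} :=
    measure_mono fun ω (h : ε ≤ R ω) => ENNReal.ofReal_le_ofReal h
  refine h1.trans ((meas_ge_le_lintegral_div hR.1.aemeasurable.ennreal_ofReal
    (by simpa using hε) (by simp)).trans ?_)
  rw [← ofReal_integral_eq_lintegral_ofReal hR h0, ENNReal.ofReal_div_of_pos hε]
  gcongr

/-- The error splits into a part that vanishes in probability, a part `R` that is merely small in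
mean, to which Markov's inequality applies, and a deterministic part. `X` and `R` may depend on `η`,
which leaves room for a truncation level that varies with `η` but not with `G`. -/
theorem tendstoInProb_of_approx {T : ∀ G, Ω G → ℝ} {c : ℝ}
    (h : ∀ η : ℝ, 0 < η → ∃ X R : ∀ G, Ω G → ℝ, TendstoInProb P X 0 ∧
      ∀ᶠ G in atTop, Integrable (R G) (P G) ∧ 0 ≤ᵐ[P G] R G ∧ ∫ ω, R G ω ∂P G ≤ η ∧
        ∀ᵐ ω ∂P G, |T G ω - c| ≤ |X G ω| + R G ω + η) :
    TendstoInProb P T c := by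
  intro ε hε
  rw [ENNReal.tendsto_nhds_zero]
  intro δ hδ
  obtain ⟨d, hd0, hd⟩ := ENNReal.lt_iff_exists_nnreal_btwn.1 hδ
  have hd0' : (0 : ℝ) < d := by exact_mod_cast hd0
  -- The bound `ε / 4` leaves room beside two terms below `ε / 3`; the bound `d * ε / 6` makes
  -- Markov's inequality at level `ε / 3` give `d / 2`.
  obtain ⟨X, R, hX, hR⟩ := h (min (ε / 4) (d * ε / 6)) (by positivity)
  have h3 : 0 < ε / 3 := by positivity
  have hd2 : (0 : ENNReal) < ENNReal.ofReal (d / 2) := by simp; exact_mod_cast hd0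
  filter_upwards [hR, (ENNReal.tendsto_nhds_zero.1 (hX _ h3)) _ hd2] with G ⟨hi, h0, hη, hG⟩ hXG
  have h4 := measure_le_ofReal_div hi h0 (hη.trans (min_le_right _ _)) h3
  have h5 : (d * ε / 6) / (ε / 3) = d / 2 := by field_simp; norm_num
  rw [h5] at h4
  calc P G {ω | ε ≤ |T G ω - c|}
      ≤ P G ({ω | ε / 3 ≤ |X G ω - 0|} ∪ {ω | ε / 3 ≤ R G ω}) := by
        refine measure_mono_ae ?_
        filter_upwards [hG] with ω hω
        intro (h6 : ε ≤ _)
        by_contra hc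
        have hc' : ¬ ((ε / 3 ≤ |X G ω - 0|) ∨ (ε / 3 ≤ R G ω)) := hc
        rw [sub_zero, not_or, not_le, not_le] at hc'
        have := min_le_left (ε / 4) (d * ε / 6)
        linarith [hc'.1, hc'.2]
    _ ≤ ENNReal.ofReal (d / 2) + ENNReal.ofReal (d / 2) :=
        (measure_union_le _ _).trans (add_le_add hXG h4)
    _ ≤ δ := by
        rw [← ENNReal.ofReal_add (by positivity) (by positivity), add_halves,
          ENNReal.ofReal_coe_nnreal]
        exact hd.le

/-- Mean-square convergence at rate `1 / G`. -/
theorem tendstoInProb_of_sq {T : ∀ G, Ω G → ℝ} {c C : ℝ} (hT : ∀ G, AEMeasurable (T G) (P G))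
    (h : ∀ᶠ G : ℕ in atTop, ∫⁻ ω, ENNReal.ofReal ((T G ω - c) ^ 2) ∂P G ≤ ENNReal.ofReal (C / G)) :
    TendstoInProb P T c := by
  intro ε hε
  have hl : Tendsto (fun G : ℕ => ENNReal.ofReal (C / G) / ENNReal.ofReal (ε ^ 2)) atTop (𝓝 0) := by
    have h1 : Tendsto (fun G : ℕ => ENNReal.ofReal (C / G)) atTop (𝓝 0) := by
      simpa using ENNReal.tendsto_ofReal (tendsto_const_div_atTop_nhds_zero_nat C)
    have h2 := ENNReal.Tendsto.div_const h1 (b := ENNReal.ofReal (ε ^ 2)) (Or.inr (by simp; positivity))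
    simpa using h2
  refine tendsto_of_tendsto_of_tendsto_of_le_of_le' tendsto_const_nhds hl
    (Eventually.of_forall fun _ => zero_le) (h.mono fun G hG => ?_)
  have h1 : P G {ω | ε ≤ |T G ω - c|} ≤
      P G {ω | ENNReal.ofReal (ε ^ 2) ≤ ENNReal.ofReal ((T G ω - c) ^ 2)} := by
    refine measure_mono fun ω (h : ε ≤ _) => ENNReal.ofReal_le_ofReal ?_
    rw [← sq_abs (T G ω - c)]
    gcongr
  refine h1.trans ((meas_ge_le_lintegral_div
    (((hT G).sub_const c).pow_const 2).ennreal_ofReal ?_ (by simp)).trans ?_)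
  · simp; positivity
  · gcongr

/-- A family bounded in mean is bounded in probability, and such a factor does not destroy
convergence to zero. -/
theorem TendstoInProb.mul_of_integral_le {X S : ∀ G, Ω G → ℝ} {K : ℝ} (hX : TendstoInProb P X 0)
    (hS : ∀ᶠ G in atTop, Integrable (S G) (P G) ∧ 0 ≤ᵐ[P G] S G ∧ ∫ ω, S G ω ∂P G ≤ K) :
    TendstoInProb P (fun G ω => X G ω * S G ω) 0 := by
  intro ε hε
  rw [ENNReal.tendsto_nhds_zero]
  intro δ hδ
  obtain ⟨d, hd0, hd⟩ := ENNReal.lt_iff_exists_nnreal_btwn.1 hδ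
  have hd0' : (0 : ℝ) < d := by exact_mod_cast hd0
  have hd2 : (0 : ENNReal) < ENNReal.ofReal (d / 2) := by simp; exact_mod_cast hd0
  -- Level above which `S` lies with probability at most `d / 2`; the form `|K| + 1` keeps it
  -- positive for every `K`.
  set L : ℝ := 2 * (|K| + 1) / d with hL
  have hL0 : 0 < L := by positivity
  filter_upwards [hS, (ENNReal.tendsto_nhds_zero.1 (hX (ε / L) (by positivity))) _ hd2]
    with G ⟨hi, h0, hK⟩ hXG
  have h4 := measure_le_ofReal_div hi h0 hK hL0
  have h5 : K / L ≤ d / 2 := by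
    rw [hL, div_div_eq_mul_div, div_le_div_iff₀ (by positivity) (by positivity)]
    nlinarith [le_abs_self K]
  calc P G {ω | ε ≤ |X G ω * S G ω - 0|}
      ≤ P G ({ω | ε / L ≤ |X G ω - 0|} ∪ {ω | L ≤ S G ω}) := by
        refine measure_mono_ae ?_
        filter_upwards [h0] with ω hω
        intro (h6 : ε ≤ _)
        by_contra hc
        have hc' : ¬ ((ε / L ≤ |X G ω - 0|) ∨ (L ≤ S G ω)) := hc
        rw [sub_zero, not_or, not_le, not_le, lt_div_iff₀ hL0] at hc'
        have hω' : 0 ≤ S G ω := hω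
        rw [sub_zero, abs_mul, abs_of_nonneg hω'] at h6
        nlinarith [abs_nonneg (X G ω)]
    _ ≤ ENNReal.ofReal (d / 2) + ENNReal.ofReal (d / 2) :=
        (measure_union_le _ _).trans (add_le_add hXG (h4.trans (ENNReal.ofReal_le_ofReal h5)))
    _ ≤ δ := by
        rw [← ENNReal.ofReal_add (by positivity) (by positivity), add_halves,
          ENNReal.ofReal_coe_nnreal]
        exact hd.le

end ConvergenceInProbability

/-! ### Second moments of sums of pairwise independent variables -/

section Variance

variable {Ω ι : Type*} [MeasurableSpace Ω] {P : Measure Ω} [IsProbabilityMeasure P]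

theorem integral_sq_sum_sub_le [Fintype ι] {X : ι → Ω → ℝ} (hX : ∀ i, MemLp (X i) 2 P)
    (hind : Pairwise fun i j => X i ⟂ᵢ[P] X j) :
    ∫ ω, (∑ i, X i ω - ∑ i, ∫ ω', X i ω' ∂P) ^ 2 ∂P ≤ ∑ i, ∫ ω, X i ω ^ 2 ∂P := by
  have h := IndepFun.variance_sum (s := Finset.univ) (fun i _ => hX i) (hind.set_pairwise _)
  have hm : MemLp (∑ i, X i) 2 P := memLp_finsetSum' _ fun i _ => hX i
  rw [variance_eq_integral hm.1.aemeasurable] at h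
  have h2 : ∫ ω, (∑ i, X i) ω ∂P = ∑ i, ∫ ω, X i ω ∂P := by
    simp only [Finset.sum_apply]
    exact integral_finsetSum _ fun i _ => (hX i).integrable one_le_two
  rw [h2] at h
  simp only [Finset.sum_apply] at h
  rw [h]
  refine Finset.sum_le_sum fun i _ => ?_
  have := variance_le_expectation_sq (hX i).1
  simpa using this

theorem lintegral_sq_sum_sub_le [Fintype ι] {X : ι → Ω → ℝ} (hX : ∀ i, MemLp (X i) 2 P)
    (hind : Pairwise fun i j => X i ⟂ᵢ[P] X j) :
    ∫⁻ ω, ENNReal.ofReal ((∑ i, X i ω - ∑ i, ∫ ω', X i ω' ∂P) ^ 2) ∂P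
      ≤ ENNReal.ofReal (∑ i, ∫ ω, X i ω ^ 2 ∂P) := by
  rw [← ofReal_integral_eq_lintegral_ofReal _ (Eventually.of_forall fun _ => sq_nonneg _)]
  · exact ENNReal.ofReal_le_ofReal (integral_sq_sum_sub_le hX hind)
  · exact ((memLp_finsetSum _ fun i _ => hX i).sub (memLp_const _)).integrable_sq

end Variance

/-! ### Deterministic estimates for the variance estimator as a function of contrasts -/

section PairVariance

variable {G : ℕ}

/-- The first pair of a pair of pairs. -/
def fstPair (i : Fin (G / 2)) : Fin G := ⟨2 * i, by omega⟩

/-- The second pair of a pair of pairs. -/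
def sndPair (i : Fin (G / 2)) : Fin G := ⟨2 * i + 1, by omega⟩

/-- The difference between the outcome of the treated and of the control cluster of a pair, where
`s j` says whether the second cluster of the pair `j` is the treated one. -/
def pairContrast (y : Fin (2 * G) → Bool → ℝ) (σ : Equiv.Perm (Fin (2 * G))) (s : Fin G → Bool)
    (j : Fin G) : ℝ :=
  if s j then y (σ (sndPos j)) true - y (σ (fstPos j)) false
  else y (σ (fstPos j)) true - y (σ (sndPos j)) false

/-- The variance estimator as a function of the within-pair contrasts. -/
noncomputable def pairVar (δ : Fin G → ℝ) : ℝ :=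
  (1 / (G : ℝ)) * ∑ j, δ j ^ 2 - (1 / (G : ℝ)) * ∑ i : Fin (G / 2), δ (fstPair i) * δ (sndPair i)

/-- The positions as the disjoint union of first and second positions. -/
noncomputable def posEquiv (G : ℕ) : Fin G ⊕ Fin G ≃ Fin (2 * G) :=
  Equiv.ofBijective (Sum.elim fstPos sndPos) <| by
    constructor
    · rintro (a | a) (b | b) h <;> simp [fstPos, sndPos, Fin.ext_iff] at h ⊢ <;> omega
    · intro g
      rcases Nat.even_or_odd' g with ⟨m, hm | hm⟩
      · exact ⟨Sum.inl ⟨m, by omega⟩, by simp [fstPos, Fin.ext_iff, hm]⟩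
      · exact ⟨Sum.inr ⟨m, by omega⟩, by simp [sndPos, Fin.ext_iff, hm]⟩

theorem sum_pos_eq_sum (f : Fin (2 * G) → ℝ) (σ : Equiv.Perm (Fin (2 * G))) :
    ∑ j : Fin G, (f (σ (fstPos j)) + f (σ (sndPos j))) = ∑ g, f g := by
  rw [← Equiv.sum_comp σ f, ← Equiv.sum_comp (posEquiv G) (fun i => f (σ i)), Fintype.sum_sum_type,
    Finset.sum_add_distrib]
  rfl

/-- The pairs of pairs use every pair except the last one when `G` is odd, so at most one term,
bounded by `B`, is lost. -/
theorem sum_pairs_add_leftover (f : Fin G → ℝ) {B : ℝ} (hf : ∀ j, 0 ≤ f j) (hB : ∀ j, f j ≤ B)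
    (hB0 : 0 ≤ B) :
    ∑ i : Fin (G / 2), (f (fstPair i) + f (sndPair i)) ≤ ∑ j, f j ∧
      ∑ j, f j ≤ ∑ i : Fin (G / 2), (f (fstPair i) + f (sndPair i)) + B := by
  have hinj : Function.Injective (Sum.elim fstPair sndPair : Fin (G / 2) ⊕ Fin (G / 2) → Fin G) := by
    rintro (a | a) (b | b) h <;> simp [fstPair, sndPair, Fin.ext_iff] at h ⊢ <;> omega
  have h1 : ∑ i : Fin (G / 2), (f (fstPair i) + f (sndPair i)) =
      ∑ j ∈ Finset.univ.map ⟨_, hinj⟩, f j := by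
    rw [Finset.sum_map, Fintype.sum_sum_type, Finset.sum_add_distrib]
    rfl
  rw [h1]
  refine ⟨Finset.sum_le_sum_of_subset_of_nonneg (Finset.subset_univ _) fun j _ _ => hf j, ?_⟩
  rw [← Finset.sum_add_sum_compl (Finset.univ.map ⟨_, hinj⟩) f]
  have hc : (Finset.univ.map ⟨_, hinj⟩)ᶜ.card ≤ 1 := by
    rw [Finset.card_compl, Finset.card_map]
    simp
    omega
  have h2 : ∑ j ∈ (Finset.univ.map ⟨_, hinj⟩)ᶜ, f j ≤ (Finset.univ.map ⟨_, hinj⟩)ᶜ.card • B :=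
    Finset.sum_le_card_nsmul _ _ _ fun j _ => hB j
  have h3 : ((Finset.univ.map ⟨_, hinj⟩)ᶜ.card : ℝ) ≤ 1 := by exact_mod_cast hc
  rw [nsmul_eq_mul] at h2
  nlinarith

theorem sum_pairs_le (f : Fin G → ℝ) (hf : ∀ j, 0 ≤ f j) :
    ∑ i : Fin (G / 2), (f (fstPair i) + f (sndPair i)) ≤ ∑ j, f j :=
  (sum_pairs_add_leftover f hf (B := ∑ j, f j)
    (fun j => Finset.single_le_sum (fun j _ => hf j) (Finset.mem_univ j))
    (Finset.sum_nonneg fun j _ => hf j)).1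

/-- Young's inequality with weight `η` on the cross terms `(y - y') x'` and `(x - x') y'`: the
second moments of the reference values enter with an arbitrarily small factor, at the price of `1 /
η` on the squared errors. -/
theorem abs_mul_sub_mul_le {x y x' y' η : ℝ} (hη : 0 < η) :
    |x * y - x' * y'| ≤ (1 / 2 + 1 / η) * ((x - x') ^ 2 + (y - y') ^ 2)
      + η * (x' ^ 2 + y' ^ 2) := by
  have key : ∀ a b : ℝ, |a * b| ≤ 1 / η * a ^ 2 + η * b ^ 2 := by
    intro a b
    have h : 1 / η * a ^ 2 + η * b ^ 2 = (a ^ 2 + (η * b) ^ 2) / η := by field_simp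
    rw [h, le_div_iff₀ hη, abs_mul, ← sq_abs a, ← sq_abs (η * b), abs_mul η b, abs_of_pos hη]
    nlinarith [sq_nonneg (|a| - η * |b|), sq_nonneg (|a|), sq_nonneg (η * |b|)]
  have h1 : x * y - x' * y' = (x - x') * (y - y') + ((y - y') * x' + (x - x') * y') := by ring
  have h2 := abs_add_le ((x - x') * (y - y')) ((y - y') * x' + (x - x') * y')
  have h3 := abs_add_le ((y - y') * x') ((x - x') * y')
  have h4 : |(x - x') * (y - y')| ≤ 1 / 2 * ((x - x') ^ 2 + (y - y') ^ 2) := by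
    rw [abs_le]; constructor <;> nlinarith [sq_nonneg (x - x' + (y - y')), sq_nonneg (x - x' - (y - y'))]
  rw [h1]
  linarith [key (y - y') x', key (x - x') y']

/-- Mean-square continuity of `pairVar`. Each contrast enters the squares, which costs two copies of
the Young bound, and at most one product, which costs one more; hence the factor 3. -/
theorem abs_pairVar_sub_le (δ δ' : Fin G → ℝ) {η : ℝ} (hη : 0 < η) :
    |pairVar δ - pairVar δ'| ≤ (1 / (G : ℝ)) * ∑ j, ((3 / 2 + 3 / η) * (δ j - δ' j) ^ 2
      + 3 * η * δ' j ^ 2) := by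
  set f : Fin G → ℝ := fun j => (1 / 2 + 1 / η) * (δ j - δ' j) ^ 2 + η * δ' j ^ 2 with hf
  have hf0 : ∀ j, 0 ≤ f j := fun j => by positivity
  have h1 : |∑ j, δ j ^ 2 - ∑ j, δ' j ^ 2| ≤ 2 * ∑ j, f j := by
    rw [← Finset.sum_sub_distrib, Finset.mul_sum]
    refine (Finset.abs_sum_le_sum_abs _ _).trans (Finset.sum_le_sum fun j _ => ?_)
    have := abs_mul_sub_mul_le (x := δ j) (y := δ j) (x' := δ' j) (y' := δ' j) hη
    rw [sq, sq]
    simp only [hf]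
    linarith
  have h2 : |∑ i : Fin (G / 2), δ (fstPair i) * δ (sndPair i)
      - ∑ i : Fin (G / 2), δ' (fstPair i) * δ' (sndPair i)| ≤ ∑ j, f j := by
    refine le_trans ?_ (sum_pairs_le f hf0)
    rw [← Finset.sum_sub_distrib]
    refine (Finset.abs_sum_le_sum_abs _ _).trans (Finset.sum_le_sum fun i _ => ?_)
    refine (abs_mul_sub_mul_le hη).trans (le_of_eq ?_)
    simp only [hf]
    ring
  have h3 : ∑ j, ((3 / 2 + 3 / η) * (δ j - δ' j) ^ 2 + 3 * η * δ' j ^ 2) = 3 * ∑ j, f j := by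
    rw [Finset.mul_sum]
    refine Finset.sum_congr rfl fun j _ => ?_
    simp only [hf]
    ring
  rw [h3, pairVar, pairVar]
  have h4 : ∀ a b a' b' : ℝ, (1 / (G : ℝ)) * a - 1 / (G : ℝ) * b - (1 / (G : ℝ) * a' - 1 / (G : ℝ) * b')
      = 1 / (G : ℝ) * ((a - a') - (b - b')) := fun a b a' b' => by ring
  rw [h4, abs_mul, abs_of_nonneg (by positivity : (0 : ℝ) ≤ 1 / (G : ℝ))]
  gcongr
  refine (abs_sub _ _).trans ?_
  linarith

theorem sum_pairContrast_sub_sq_le (y y' : Fin (2 * G) → Bool → ℝ) (σ : Equiv.Perm (Fin (2 * G)))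
    (s : Fin G → Bool) :
    ∑ j, (pairContrast y σ s j - pairContrast y' σ s j) ^ 2
      ≤ 2 * ∑ g, ∑ d, (y g d - y' g d) ^ 2 := by
  rw [← sum_pos_eq_sum (fun g => ∑ d, (y g d - y' g d) ^ 2) σ, Finset.mul_sum]
  refine Finset.sum_le_sum fun j _ => ?_
  simp only [pairContrast, Fintype.sum_bool]
  split_ifs
  · nlinarith [sq_nonneg ((y (σ (sndPos j)) true - y' (σ (sndPos j)) true) +
      (y (σ (fstPos j)) false - y' (σ (fstPos j)) false)),
      sq_nonneg (y (σ (sndPos j)) false - y' (σ (sndPos j)) false),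
      sq_nonneg (y (σ (fstPos j)) true - y' (σ (fstPos j)) true)]
  · nlinarith [sq_nonneg ((y (σ (fstPos j)) true - y' (σ (fstPos j)) true) +
      (y (σ (sndPos j)) false - y' (σ (sndPos j)) false)),
      sq_nonneg (y (σ (fstPos j)) false - y' (σ (fstPos j)) false),
      sq_nonneg (y (σ (sndPos j)) true - y' (σ (sndPos j)) true)]

theorem sum_pairContrast_sq_le (y : Fin (2 * G) → Bool → ℝ) (σ : Equiv.Perm (Fin (2 * G)))
    (s : Fin G → Bool) :
    ∑ j, pairContrast y σ s j ^ 2 ≤ 2 * ∑ g, ∑ d, y g d ^ 2 := by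
  simpa [pairContrast] using sum_pairContrast_sub_sq_le y (fun _ _ => 0) σ s

/-- The mean of a contrast over the two assignments within the pair. -/
noncomputable def meanContrast (m : Fin (2 * G) → Bool → ℝ) (σ : Equiv.Perm (Fin (2 * G))) (j : Fin G) : ℝ :=
  1 / 2 * ((m (σ (sndPos j)) true - m (σ (fstPos j)) false)
    + (m (σ (fstPos j)) true - m (σ (sndPos j)) false))

/-- The mean of a squared contrast over the two assignments within the pair, when the outcomes of
the two clusters are independent with first moments `m` and second moments `q`. -/
noncomputable def meanSqContrast (m q : Fin (2 * G) → Bool → ℝ) (σ : Equiv.Perm (Fin (2 * G))) (j : Fin G) : ℝ :=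
  1 / 2 * ((q (σ (sndPos j)) true + q (σ (fstPos j)) false
      - 2 * m (σ (sndPos j)) true * m (σ (fstPos j)) false)
    + (q (σ (fstPos j)) true + q (σ (sndPos j)) false
      - 2 * m (σ (fstPos j)) true * m (σ (sndPos j)) false))

/-- The mean of `pairVar` when the pairs are independent. -/
noncomputable def meanPairVar (m q : Fin (2 * G) → Bool → ℝ) (σ : Equiv.Perm (Fin (2 * G))) : ℝ :=
  (1 / (G : ℝ)) * ∑ j, meanSqContrast m q σ j
    - (1 / (G : ℝ)) * ∑ i : Fin (G / 2), meanContrast m σ (fstPair i) * meanContrast m σ (sndPair i)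

/-- The sum over pairs of the squared differences of `m` within the pair. -/
def pairGap (m : Fin (2 * G) → Bool → ℝ) (σ : Equiv.Perm (Fin (2 * G))) : ℝ :=
  ∑ j : Fin G, ∑ d, (m (σ (sndPos j)) d - m (σ (fstPos j)) d) ^ 2

/-- The sum over pairs of pairs of the squared differences of `m` between the two pairs. -/
def quadGap (m : Fin (2 * G) → Bool → ℝ) (σ : Equiv.Perm (Fin (2 * G))) : ℝ :=
  ∑ i : Fin (G / 2), ∑ d,
    ((m (σ (fstPos (fstPair i))) d - m (σ (fstPos (sndPair i))) d) ^ 2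
      + (m (σ (sndPos (fstPair i))) d - m (σ (sndPos (sndPair i))) d) ^ 2)

theorem sq_sub_le_three (a b a' b' : ℝ) :
    (a - b) ^ 2 ≤ 3 * (a' - b') ^ 2 + 3 * ((a - a') ^ 2 + (b - b') ^ 2) := by
  nlinarith [sq_nonneg ((a - a') - (a' - b')), sq_nonneg ((a - a') + (b - b')),
    sq_nonneg ((a' - b') + (b - b'))]

/-- The matching conditions control the gaps of the true conditional means `μ`, while the
concentration argument involves the conditional means `m` of truncated outcomes, which are only
close to `μ` in mean square. -/
theorem pairGap_le (m μ : Fin (2 * G) → Bool → ℝ) (σ : Equiv.Perm (Fin (2 * G))) :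
    pairGap m σ ≤ 3 * pairGap μ σ + 3 * ∑ g, ∑ d, (m g d - μ g d) ^ 2 := by
  rw [← sum_pos_eq_sum (fun g => ∑ d, (m g d - μ g d) ^ 2) σ, pairGap, pairGap, Finset.mul_sum,
    Finset.mul_sum, ← Finset.sum_add_distrib]
  refine Finset.sum_le_sum fun j _ => ?_
  simp only [Fintype.sum_bool]
  have h := fun d => sq_sub_le_three (m (σ (sndPos j)) d) (m (σ (fstPos j)) d)
    (μ (σ (sndPos j)) d) (μ (σ (fstPos j)) d)
  linarith [h true, h false]

theorem quadGap_le (m μ : Fin (2 * G) → Bool → ℝ) (σ : Equiv.Perm (Fin (2 * G))) :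
    quadGap m σ ≤ 3 * quadGap μ σ + 3 * ∑ g, ∑ d, (m g d - μ g d) ^ 2 := by
  rw [← sum_pos_eq_sum (fun g => ∑ d, (m g d - μ g d) ^ 2) σ]
  have h1 := sum_pairs_le (fun j => ∑ d, (m (σ (fstPos j)) d - μ (σ (fstPos j)) d) ^ 2 +
    ∑ d, (m (σ (sndPos j)) d - μ (σ (sndPos j)) d) ^ 2) (fun j => by positivity)
  refine le_trans ?_ (add_le_add le_rfl (mul_le_mul_of_nonneg_left h1 (by norm_num)))
  rw [quadGap, quadGap, Finset.mul_sum, Finset.mul_sum, ← Finset.sum_add_distrib]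
  refine Finset.sum_le_sum fun i _ => ?_
  simp only [Fintype.sum_bool]
  have h := fun d => sq_sub_le_three (m (σ (fstPos (fstPair i))) d) (m (σ (fstPos (sndPair i))) d)
    (μ (σ (fstPos (fstPair i))) d) (μ (σ (fstPos (sndPair i))) d)
  have h' := fun d => sq_sub_le_three (m (σ (sndPos (fstPair i))) d) (m (σ (sndPos (sndPair i))) d)
    (μ (σ (sndPos (fstPair i))) d) (μ (σ (sndPos (sndPair i))) d)
  linarith [h true, h false, h' true, h' false]

/-- With `h = m(1) - m(0)`, the mean contrast of a pair is the average of `h` over its two members.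
The product of two such averages equals a quarter of the sum of the four `h²` when `h` is constant
on the pair of pairs; the deviation is quadratic in the differences of `h`. -/
theorem abs_sum_meanContrast_sub_le (m : Fin (2 * G) → Bool → ℝ) (σ : Equiv.Perm (Fin (2 * G)))
    {M : ℝ} (hM : ∀ g d, |m g d| ≤ M) :
    |∑ i : Fin (G / 2), meanContrast m σ (fstPair i) * meanContrast m σ (sndPair i)
      - 1 / 4 * ∑ g, (m g true - m g false) ^ 2| ≤ pairGap m σ + quadGap m σ + 2 * M ^ 2 := by
  set h : Fin (2 * G) → ℝ := fun g => m g true - m g false with hh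
  have hhM : ∀ g, h g ^ 2 ≤ 4 * M ^ 2 := fun g => by
    have h1 := abs_le.1 (hM g true)
    have h2 := abs_le.1 (hM g false)
    simp only [hh]
    nlinarith
  -- Since `h² ≤ 4 M²`, a leftover pair contributes at most `8 M²`; the factor `1 / 4` turns this
  -- into the `2 M²` of the conclusion.
  have hlo := sum_pairs_add_leftover
    (fun j => h (σ (fstPos j)) ^ 2 + h (σ (sndPos j)) ^ 2) (B := 8 * M ^ 2)
    (fun j => by positivity) (fun j => by linarith [hhM (σ (fstPos j)), hhM (σ (sndPos j))])
    (by positivity)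
  rw [sum_pos_eq_sum (fun g => h g ^ 2) σ] at hlo
  set p : Fin G → ℝ := fun j => (h (σ (sndPos j)) - h (σ (fstPos j))) ^ 2 with hp
  have hpg : ∑ i : Fin (G / 2), (p (fstPair i) + p (sndPair i)) ≤ 2 * pairGap m σ := by
    refine (sum_pairs_le p fun j => sq_nonneg _).trans ?_
    rw [pairGap, Finset.mul_sum]
    refine Finset.sum_le_sum fun j _ => ?_
    simp only [hp, hh, Fintype.sum_bool]
    nlinarith [sq_nonneg ((m (σ (sndPos j)) true - m (σ (fstPos j)) true) +
      (m (σ (sndPos j)) false - m (σ (fstPos j)) false))]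
  set r : Fin (G / 2) → ℝ := fun i =>
    (h (σ (fstPos (fstPair i))) - h (σ (fstPos (sndPair i)))) ^ 2
      + (h (σ (sndPos (fstPair i))) - h (σ (sndPos (sndPair i)))) ^ 2 with hr
  have hrg : ∑ i, r i ≤ 2 * quadGap m σ := by
    rw [quadGap, Finset.mul_sum]
    refine Finset.sum_le_sum fun i _ => ?_
    simp only [hr, hh, Fintype.sum_bool]
    nlinarith [sq_nonneg ((m (σ (fstPos (fstPair i))) true - m (σ (fstPos (sndPair i))) true) +
      (m (σ (fstPos (fstPair i))) false - m (σ (fstPos (sndPair i))) false)),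
      sq_nonneg ((m (σ (sndPos (fstPair i))) true - m (σ (sndPos (sndPair i))) true) +
      (m (σ (sndPos (fstPair i))) false - m (σ (sndPos (sndPair i))) false))]
  have hmain : |∑ i : Fin (G / 2), meanContrast m σ (fstPair i) * meanContrast m σ (sndPair i)
      - 1 / 4 * ∑ i : Fin (G / 2), ((h (σ (fstPos (fstPair i))) ^ 2 + h (σ (sndPos (fstPair i))) ^ 2)
        + (h (σ (fstPos (sndPair i))) ^ 2 + h (σ (sndPos (sndPair i))) ^ 2))|
      ≤ 1 / 4 * ∑ i : Fin (G / 2), (p (fstPair i) + p (sndPair i)) + 1 / 4 * ∑ i, r i := by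
    rw [Finset.mul_sum, Finset.mul_sum, Finset.mul_sum, ← Finset.sum_sub_distrib,
      ← Finset.sum_add_distrib]
    refine (Finset.abs_sum_le_sum_abs _ _).trans (Finset.sum_le_sum fun i _ => ?_)
    have e : ∀ j, meanContrast m σ j = 1 / 2 * (h (σ (fstPos j)) + h (σ (sndPos j))) := fun j => by
      simp only [meanContrast, hh]; ring
    rw [e, e]
    simp only [hp, hr]
    generalize h (σ (fstPos (fstPair i))) = a
    generalize h (σ (sndPos (fstPair i))) = b
    generalize h (σ (fstPos (sndPair i))) = a'
    generalize h (σ (sndPos (sndPair i))) = b'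
    rw [abs_le]
    constructor <;>
    nlinarith [sq_nonneg (a - b), sq_nonneg (a' - b'), sq_nonneg (a - a'), sq_nonneg (b - b'),
      sq_nonneg (a - a' + (b - b')), sq_nonneg (a - a' - (b - b'))]
  rw [abs_le] at hmain ⊢
  have hpos1 : 0 ≤ pairGap m σ := by unfold pairGap; positivity
  have hpos2 : 0 ≤ quadGap m σ := by unfold quadGap; positivity
  constructor <;> linarith [hlo.1, hlo.2, hmain.1, hmain.2]

/-- Squares give `q(1) + q(0) - 2 m(1) m(0)` per cluster and products give `½ (m(1) - m(0))²`;
subtracting completes the square to `q(1) + q(0) - ½ (m(1) + m(0))²`. The errors are two copies of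
`pairGap m` and one of `quadGap m`, then passed to `μ` at a factor 3, which yields 6, 3 and `9 / G =
18 / (2 G)`. -/
theorem abs_meanPairVar_sub_le (m q μ : Fin (2 * G) → Bool → ℝ) (σ : Equiv.Perm (Fin (2 * G)))
    {M : ℝ} (hM : ∀ g d, |m g d| ≤ M) :
    |meanPairVar m q σ - 1 / (2 * (G : ℝ)) *
        ∑ g, (q g true + q g false - 1 / 2 * (m g true + m g false) ^ 2)|
      ≤ 6 * ((1 / (G : ℝ)) * pairGap μ σ) + 3 * ((1 / (G : ℝ)) * quadGap μ σ)
        + 18 * (1 / (2 * (G : ℝ)) * ∑ g, ∑ d, (m g d - μ g d) ^ 2) + 2 * M ^ 2 / G := by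
  have h1 : |∑ j, meanSqContrast m q σ j
      - 1 / 2 * ∑ g, (q g true + q g false - 2 * m g true * m g false)| ≤ pairGap m σ := by
    rw [← sum_pos_eq_sum (fun g => q g true + q g false - 2 * m g true * m g false) σ, pairGap,
      Finset.mul_sum, ← Finset.sum_sub_distrib]
    refine (Finset.abs_sum_le_sum_abs _ _).trans (Finset.sum_le_sum fun j _ => ?_)
    simp only [meanSqContrast, Fintype.sum_bool]
    generalize m (σ (sndPos j)) true = a
    generalize m (σ (sndPos j)) false = b
    generalize m (σ (fstPos j)) true = a'
    generalize m (σ (fstPos j)) false = b'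
    rw [abs_le]
    constructor <;> nlinarith [sq_nonneg (a - a' + (b - b')), sq_nonneg (a - a' - (b - b')),
      sq_nonneg (a - a'), sq_nonneg (b - b')]
  have h2 := abs_sum_meanContrast_sub_le m σ hM
  have h3 : 1 / 2 * ∑ g, (q g true + q g false - 1 / 2 * (m g true + m g false) ^ 2)
      = 1 / 2 * ∑ g, (q g true + q g false - 2 * m g true * m g false)
        - 1 / 4 * ∑ g, (m g true - m g false) ^ 2 := by
    simp only [Finset.mul_sum, ← Finset.sum_sub_distrib]
    exact Finset.sum_congr rfl fun g _ => by ring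
  have h4 : meanPairVar m q σ - 1 / (2 * (G : ℝ)) *
        ∑ g, (q g true + q g false - 1 / 2 * (m g true + m g false) ^ 2)
      = 1 / (G : ℝ) * ((∑ j, meanSqContrast m q σ j
          - 1 / 2 * ∑ g, (q g true + q g false - 2 * m g true * m g false))
        - (∑ i : Fin (G / 2), meanContrast m σ (fstPair i) * meanContrast m σ (sndPair i)
          - 1 / 4 * ∑ g, (m g true - m g false) ^ 2)) := by
    have : 1 / (2 * (G : ℝ)) * ∑ g, (q g true + q g false - 1 / 2 * (m g true + m g false) ^ 2)
      = 1 / (G : ℝ) * (1 / 2 * ∑ g, (q g true + q g false - 1 / 2 * (m g true + m g false) ^ 2)) := by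
      rw [← mul_assoc]
      congr 1
      rw [one_div_mul_one_div_rev]
    rw [this, h3, meanPairVar]
    ring
  have h5 : 6 * ((1 / (G : ℝ)) * pairGap μ σ) + 3 * ((1 / (G : ℝ)) * quadGap μ σ)
        + 18 * (1 / (2 * (G : ℝ)) * ∑ g, ∑ d, (m g d - μ g d) ^ 2) + 2 * M ^ 2 / G
      = 1 / (G : ℝ) * (6 * pairGap μ σ + 3 * quadGap μ σ + 9 * ∑ g, ∑ d, (m g d - μ g d) ^ 2
        + 2 * M ^ 2) := by
    have : 1 / (2 * (G : ℝ)) = 1 / (G : ℝ) * (1 / 2) := by rw [one_div_mul_one_div_rev]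
    rw [this]
    ring
  rw [h4, h5, abs_mul, abs_of_nonneg (by positivity : (0 : ℝ) ≤ 1 / (G : ℝ))]
  gcongr
  refine (abs_sub _ _).trans ?_
  linarith [pairGap_le m μ σ, quadGap_le m μ σ]

end PairVariance

/-! ### Pairs as independent blocks: concentration for fixed matching variables -/

section Blocks

/-- The law of a fair coin. -/
noncomputable abbrev coin : Measure Bool := (PMF.uniformOfFintype Bool).toMeasure

theorem integral_coin (f : Bool → ℝ) : ∫ b, f b ∂coin = 1 / 2 * (f true + f false) := by
  rw [PMF.integral_eq_sum]
  simp
  ring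

variable {G : ℕ} {α β : Type*} [MeasurableSpace α] [MeasurableSpace β]

/-- For a fixed permutation, `2G` i.i.d. marks and `G` coins regroup into `G` i.i.d. blocks of two
marks and one coin, because a product of equal factors is invariant under permutations of the
coordinates. -/
theorem measurePreserving_blocks (σ : Equiv.Perm (Fin (2 * G))) (l : Measure α)
    [IsProbabilityMeasure l] (κ : Measure β) [IsProbabilityMeasure κ] :
    MeasurePreserving (fun (p : (Fin (2 * G) → α) × (Fin G → β)) (j : Fin G) =>
        ((p.1 (σ (fstPos j)), p.1 (σ (sndPos j))), p.2 j))
      ((Measure.pi fun _ => l).prod (Measure.pi fun _ => κ))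
      (Measure.pi fun _ => (l.prod l).prod κ) := by
  have h1 := (measurePreserving_piCongrLeft (fun _ : Fin (2 * G) => l) ((posEquiv G).trans σ)).symm
  have h2 := measurePreserving_sumPiEquivProdPi (fun _ : Fin G ⊕ Fin G => l)
  have h3 := (measurePreserving_arrowProdEquivProdArrow α α (Fin G) (fun _ => l) (fun _ => l)).symm
  have h4 := ((h3.comp (h2.comp h1)).prod (MeasurePreserving.id (Measure.pi fun _ : Fin G => κ)))
  exact (measurePreserving_arrowProdEquivProdArrow (α × α) β (Fin G)
    (fun _ => l.prod l) (fun _ => κ)).symm.comp h4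

variable {M : ℝ}

theorem memLp_two_of_abs_le {μ : Measure α} [IsFiniteMeasure μ] {f : α → ℝ}
    (hf : Measurable f) (h : ∀ x, |f x| ≤ M) : MemLp f 2 μ :=
  MemLp.of_bound hf.aestronglyMeasurable M (Eventually.of_forall h)

theorem integral_le_of_le {μ : Measure α} [IsProbabilityMeasure μ] {f : α → ℝ} {B : ℝ}
    (h0 : ∀ x, 0 ≤ f x) (h : ∀ x, f x ≤ B) : ∫ x, f x ∂μ ≤ B := by
  have hB : 0 ≤ B := by
    obtain ⟨x⟩ := μ.nonempty_of_neZero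
    exact (h0 x).trans (h x)
  have := norm_integral_le_of_norm_le_const (μ := μ) (f := f) (C := B)
    (Eventually.of_forall fun x => by rw [Real.norm_eq_abs, abs_of_nonneg (h0 x)]; exact h x)
  simp only [probReal_univ, mul_one] at this
  exact (le_abs_self _).trans this

/-- `pairVar` of independent bounded contrasts concentrates at its mean. -/
theorem integral_sq_pairVar_sub_le {ρ : Measure β} [IsProbabilityMeasure ρ] {F : Fin G → β → ℝ}
    (hG : 0 < G) (hF : ∀ j, Measurable (F j)) (hM : ∀ j b, |F j b| ≤ M) (hM0 : 0 ≤ M) :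
    ∫ b, (pairVar (fun j => F j (b j)) - ((1 / (G : ℝ)) * ∑ j, ∫ x, F j x ^ 2 ∂ρ
      - (1 / (G : ℝ)) * ∑ i : Fin (G / 2), (∫ x, F (fstPair i) x ∂ρ) * ∫ x, F (sndPair i) x ∂ρ)) ^ 2
      ∂(Measure.pi fun _ : Fin G => ρ) ≤ 4 * M ^ 4 / G := by
  have hG' : (0 : ℝ) < G := by exact_mod_cast hG
  set μ := Measure.pi fun _ : Fin G => ρ
  have hco : iIndepFun (fun (j : Fin G) (b : Fin G → β) => b j) μ :=
    iIndepFun_pi (X := fun _ x => x) fun _ => aemeasurable_id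
  have hmc : ∀ j : Fin G, Measurable fun b : Fin G → β => b j := fun j => measurable_pi_apply j
  have hsq : ∀ j b, |F j b ^ 2| ≤ M ^ 2 := fun j b => by
    rw [abs_pow]; exact pow_le_pow_left₀ (abs_nonneg _) (hM j b) 2
  set X : Fin G → (Fin G → β) → ℝ := fun j b => F j (b j) ^ 2 with hX
  have hXm : ∀ j, Measurable (X j) := fun j => ((hF j).comp (hmc j)).pow_const 2
  have hXL : ∀ j, MemLp (X j) 2 μ := fun j => memLp_two_of_abs_le (hXm j) fun b => hsq j (b j)
  have hXi : Pairwise fun i j => X i ⟂ᵢ[μ] X j := fun i j hij =>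
    (hco.indepFun hij).comp ((hF i).pow_const 2) ((hF j).pow_const 2)
  set Y : Fin (G / 2) → (Fin G → β) → ℝ :=
    fun i b => F (fstPair i) (b (fstPair i)) * F (sndPair i) (b (sndPair i)) with hY
  have hYm : ∀ i, Measurable (Y i) := fun i =>
    ((hF _).comp (hmc _)).mul ((hF _).comp (hmc _))
  have hYb : ∀ i b, |Y i b| ≤ M ^ 2 := fun i b => by
    rw [hY, abs_mul, sq]
    exact mul_le_mul (hM _ _) (hM _ _) (abs_nonneg _) hM0
  have hYL : ∀ i, MemLp (Y i) 2 μ := fun i => memLp_two_of_abs_le (hYm i) (hYb i)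
  -- Distinct pairs of pairs use disjoint coordinates, so the products are independent even though
  -- the two factors of each come from different pairs.
  have hYi : Pairwise fun i j => Y i ⟂ᵢ[μ] Y j := fun i j hij => by
    have hij' : (i : ℕ) ≠ j := fun h => hij (Fin.ext h)
    have := hco.indepFun_prodMk_prodMk hmc (fstPair i) (sndPair i) (fstPair j) (sndPair j)
      (by simp [fstPair, Fin.ext_iff]; omega) (by simp [fstPair, sndPair, Fin.ext_iff]; omega)
      (by simp [fstPair, sndPair, Fin.ext_iff]; omega) (by simp [sndPair, Fin.ext_iff]; omega)
    exact this.comp (φ := fun p : β × β => F (fstPair i) p.1 * F (sndPair i) p.2)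
      (ψ := fun p : β × β => F (fstPair j) p.1 * F (sndPair j) p.2)
      (((hF _).comp measurable_fst).mul ((hF _).comp measurable_snd))
      (((hF _).comp measurable_fst).mul ((hF _).comp measurable_snd))
  have hEX : ∀ j, ∫ b, X j b ∂μ = ∫ x, F j x ^ 2 ∂ρ := fun j =>
    integral_comp_eval (μ := fun _ => ρ) (f := fun x => F j x ^ 2)
      ((hF j).pow_const 2).aestronglyMeasurable
  have hEY : ∀ i, ∫ b, Y i b ∂μ = (∫ x, F (fstPair i) x ∂ρ) * ∫ x, F (sndPair i) x ∂ρ := fun i => by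
    have hne : fstPair i ≠ sndPair i := by simp [fstPair, sndPair, Fin.ext_iff]
    have h := (((hco.indepFun hne).comp (hF (fstPair i)) (hF (sndPair i)))).integral_fun_mul_eq_mul_integral
      ((hF _).comp (hmc _)).aestronglyMeasurable ((hF _).comp (hmc _)).aestronglyMeasurable
    refine h.trans ?_
    congr 1
    · exact integral_comp_eval (μ := fun _ => ρ) (f := F (fstPair i)) (hF _).aestronglyMeasurable
    · exact integral_comp_eval (μ := fun _ => ρ) (f := F (sndPair i)) (hF _).aestronglyMeasurable
  have hvX := integral_sq_sum_sub_le hXL hXi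
  have hvY := integral_sq_sum_sub_le hYL hYi
  have hbX : ∑ j, ∫ b, X j b ^ 2 ∂μ ≤ G * M ^ 4 := by
    refine (Finset.sum_le_card_nsmul _ _ (M ^ 4) fun j _ => ?_).trans (by simp)
    refine integral_le_of_le (fun b => sq_nonneg _) fun b => ?_
    have := sq_le_sq' (by linarith [neg_abs_le (X j b), hsq j (b j)]) ((le_abs_self _).trans (hsq j (b j)))
    calc X j b ^ 2 ≤ (M ^ 2) ^ 2 := this
      _ = M ^ 4 := by ring
  have hbY : ∑ j, ∫ b, Y j b ^ 2 ∂μ ≤ G * M ^ 4 := by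
    refine (Finset.sum_le_card_nsmul _ _ (M ^ 4) fun j _ => ?_).trans ?_
    · refine integral_le_of_le (fun b => sq_nonneg _) fun b => ?_
      have := sq_le_sq' (by linarith [neg_abs_le (Y j b), hYb j b]) ((le_abs_self _).trans (hYb j b))
      calc Y j b ^ 2 ≤ (M ^ 2) ^ 2 := this
        _ = M ^ 4 := by ring
    · simp only [Finset.card_univ, Fintype.card_fin, nsmul_eq_mul]
      have : ((G / 2 : ℕ) : ℝ) ≤ G := by exact_mod_cast Nat.div_le_self _ _
      gcongr
  simp only [hEX] at hvX
  simp only [hEY] at hvY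
  set cX := ∑ j, ∫ x, F j x ^ 2 ∂ρ
  set cY := ∑ i : Fin (G / 2), (∫ x, F (fstPair i) x ∂ρ) * ∫ x, F (sndPair i) x ∂ρ
  have hiX : Integrable (fun b => (∑ j, X j b - cX) ^ 2) μ :=
    ((memLp_finsetSum _ fun i _ => hXL i).sub (memLp_const _)).integrable_sq
  have hiY : Integrable (fun b => (∑ j, Y j b - cY) ^ 2) μ :=
    ((memLp_finsetSum _ fun i _ => hYL i).sub (memLp_const _)).integrable_sq
  calc _ ≤ ∫ b, 2 / (G : ℝ) ^ 2 * ((∑ j, X j b - cX) ^ 2 + (∑ j, Y j b - cY) ^ 2) ∂μ := by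
        refine integral_mono_of_nonneg (Eventually.of_forall fun _ => sq_nonneg _)
          ((hiX.add hiY).const_mul _) (Eventually.of_forall fun b => ?_)
        have : pairVar (fun j => F j (b j)) - (1 / (G : ℝ) * cX - 1 / (G : ℝ) * cY)
            = 1 / (G : ℝ) * ((∑ j, X j b - cX) - (∑ j, Y j b - cY)) := by
          simp only [pairVar, hX, hY]; ring
        simp only [this, mul_pow]
        have h2 : 2 / (G : ℝ) ^ 2 = (1 / (G : ℝ)) ^ 2 * 2 := by ring
        rw [h2, mul_assoc]
        gcongr
        nlinarith [sq_nonneg ((∑ j, X j b - cX) + (∑ j, Y j b - cY))]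
    _ ≤ 2 / (G : ℝ) ^ 2 * (G * M ^ 4 + G * M ^ 4) := by
        rw [integral_const_mul, integral_add hiX hiY]
        gcongr
        · exact hvX.trans hbX
        · exact hvY.trans hbY
    _ = 4 * M ^ 4 / G := by field_simp; ring

/-- The contrast of a pair as a function of the randomness of this pair. -/
noncomputable def blockContrast (z : Fin (2 * G) → α → Bool → ℝ) (σ : Equiv.Perm (Fin (2 * G)))
    (j : Fin G) (b : (α × α) × Bool) : ℝ :=
  if b.2 then z (σ (sndPos j)) b.1.2 true - z (σ (fstPos j)) b.1.1 false
  else z (σ (fstPos j)) b.1.1 true - z (σ (sndPos j)) b.1.2 false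

theorem integral_pair_sub_sq {l : Measure α} [IsProbabilityMeasure l] {f g : α → ℝ}
    (hf : MemLp f 2 l) (hg : MemLp g 2 l) :
    ∫ p : α × α, (f p.1 - g p.2) ^ 2 ∂l.prod l
      = ∫ u, f u ^ 2 ∂l + ∫ u, g u ^ 2 ∂l - 2 * (∫ u, f u ∂l) * ∫ u, g u ∂l := by
  have h1 : Integrable (fun p : α × α => f p.1 ^ 2) (l.prod l) := hf.integrable_sq.comp_fst l
  have h2 : Integrable (fun p : α × α => g p.2 ^ 2) (l.prod l) := hg.integrable_sq.comp_snd l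
  have h3 : Integrable (fun p : α × α => f p.1 * g p.2) (l.prod l) :=
    (hf.integrable one_le_two).mul_prod (hg.integrable one_le_two)
  have h4 : ∀ p : α × α, (f p.1 - g p.2) ^ 2 = f p.1 ^ 2 + g p.2 ^ 2 - 2 * (f p.1 * g p.2) :=
    fun p => by ring
  simp only [h4]
  have h5 : Integrable (fun p : α × α => f p.1 ^ 2 + g p.2 ^ 2) (l.prod l) := h1.add h2
  rw [integral_sub h5 (h3.const_mul 2), integral_add h1 h2, integral_const_mul,
    integral_prod_mul, integral_fun_fst (fun u => f u ^ 2), integral_fun_snd (fun u => g u ^ 2)]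
  simp
  ring

theorem integral_pair_sub {l : Measure α} [IsProbabilityMeasure l] {f g : α → ℝ}
    (hf : Integrable f l) (hg : Integrable g l) :
    ∫ p : α × α, (f p.1 - g p.2) ∂l.prod l = ∫ u, f u ∂l - ∫ u, g u ∂l := by
  rw [integral_sub (hf.comp_fst l) (hg.comp_snd l), integral_fun_fst f, integral_fun_snd g]
  simp

theorem integral_pair_swap {l : Measure α} [IsProbabilityMeasure l] (f : α × α → ℝ) :
    ∫ p : α × α, f p.swap ∂l.prod l = ∫ p, f p ∂l.prod l :=
  integral_prod_swap f

/-- For fixed matching variables, `pairVar` concentrates at its mean. -/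
theorem lintegral_sq_pairVar_contrast_sub_le (hG : 0 < G) (σ : Equiv.Perm (Fin (2 * G)))
    (l : Measure α) [IsProbabilityMeasure l] {z : Fin (2 * G) → α → Bool → ℝ}
    (hz : ∀ g d, Measurable fun u => z g u d) (hM : ∀ g u d, |z g u d| ≤ M) (hM0 : 0 ≤ M) :
    ∫⁻ p, ENNReal.ofReal ((pairVar (pairContrast (fun g d => z g (p.1 g) d) σ p.2)
      - meanPairVar (fun g d => ∫ u, z g u d ∂l) (fun g d => ∫ u, z g u d ^ 2 ∂l) σ) ^ 2)
      ∂((Measure.pi fun _ : Fin (2 * G) => l).prod (Measure.pi fun _ : Fin G => coin))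
      ≤ ENNReal.ofReal (64 * M ^ 4 / G) := by
  have hzL : ∀ g d, MemLp (fun u => z g u d) 2 l := fun g d =>
    memLp_two_of_abs_le (hz g d) fun u => hM g u d
  have hzI : ∀ g d, Integrable (fun u => z g u d) l := fun g d => (hzL g d).integrable one_le_two
  set F := blockContrast z σ with hFdef
  have hFm : ∀ j, Measurable (F j) := fun j => by
    refine Measurable.ite (measurable_snd (measurableSet_singleton true)) ?_ ?_
    · exact ((hz _ _).comp (measurable_snd.comp measurable_fst)).sub
        ((hz _ _).comp (measurable_fst.comp measurable_fst))
    · exact ((hz _ _).comp (measurable_fst.comp measurable_fst)).sub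
        ((hz _ _).comp (measurable_snd.comp measurable_fst))
  have hFM : ∀ j b, |F j b| ≤ 2 * M := fun j b => by
    simp only [hFdef, blockContrast]
    split_ifs
    · exact (abs_sub _ _).trans (by linarith [hM (σ (sndPos j)) b.1.2 true, hM (σ (fstPos j)) b.1.1 false])
    · exact (abs_sub _ _).trans (by linarith [hM (σ (sndPos j)) b.1.2 false, hM (σ (fstPos j)) b.1.1 true])
  have hFL : ∀ j, MemLp (F j) 2 ((l.prod l).prod coin) := fun j => memLp_two_of_abs_le (hFm j) (hFM j)
  have hF1 : ∀ j, ∫ x, F j x ∂((l.prod l).prod coin) = meanContrast (fun g d => ∫ u, z g u d ∂l) σ j :=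
    fun j => by
      rw [integral_prod _ ((hFL j).integrable one_le_two)]
      simp only [integral_coin, integral_const_mul, hFdef, blockContrast, if_true, Bool.false_eq_true,
        if_false, meanContrast]
      rw [integral_add, integral_pair_sub (hzI _ _) (hzI _ _)]
      · congr 2
        -- When the second cluster is treated its mark is the minuend; swapping the marks restores
        -- the form `f p.1 - g p.2`.
        rw [← integral_pair_swap]
        exact integral_pair_sub (hzI _ _) (hzI _ _)
      · exact ((hzI _ _).comp_snd l).sub ((hzI _ _).comp_fst l)
      · exact ((hzI _ _).comp_fst l).sub ((hzI _ _).comp_snd l)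
  have hF2 : ∀ j, ∫ x, F j x ^ 2 ∂((l.prod l).prod coin) = meanSqContrast (fun g d => ∫ u, z g u d ∂l)
      (fun g d => ∫ u, z g u d ^ 2 ∂l) σ j := fun j => by
      rw [integral_prod _ (hFL j).integrable_sq]
      simp only [integral_coin, integral_const_mul, hFdef, blockContrast, if_true, Bool.false_eq_true,
        if_false, meanSqContrast]
      rw [integral_add, integral_pair_sub_sq (hzL _ _) (hzL _ _)]
      · congr 2
        rw [← integral_pair_swap]
        exact integral_pair_sub_sq (hzL _ _) (hzL _ _)
      · exact (((hzL _ _).comp_snd l).sub ((hzL _ _).comp_fst l)).integrable_sq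
      · exact (((hzL _ _).comp_fst l).sub ((hzL _ _).comp_snd l)).integrable_sq
  -- The contrasts are bounded by `2 * M`, and `4 (2M)⁴ = 64 M⁴`.
  have hb := integral_sq_pairVar_sub_le (ρ := (l.prod l).prod coin) hG hFm hFM (by positivity)
  simp only [hF1, hF2] at hb
  set c := meanPairVar (fun g d => ∫ u, z g u d ∂l) (fun g d => ∫ u, z g u d ^ 2 ∂l) σ with hc
  have hmeas : Measurable fun b : Fin G → (α × α) × Bool => pairVar (fun j => F j (b j)) := by
    unfold pairVar
    have := fun j => (hFm j).comp (measurable_pi_apply (X := fun _ : Fin G => (α × α) × Bool) j)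
    exact (((Finset.measurable_fun_sum _ fun j _ => (this j).pow_const 2)).const_mul _).sub
      ((Finset.measurable_fun_sum _ fun i _ => (this _).mul (this _)).const_mul _)
  have hmp := (measurePreserving_blocks σ l coin).lintegral_comp
    (f := fun b => ENNReal.ofReal ((pairVar (fun j => F j (b j)) - c) ^ 2))
    ((hmeas.sub_const c).pow_const 2).ennreal_ofReal
  -- A crude bound, needed only for integrability of the squared deviation.
  have hbd : ∀ b : Fin G → (α × α) × Bool, |pairVar (fun j => F j (b j))| ≤
      (1 / (G : ℝ)) * (G * (2 * M) ^ 2) + (1 / (G : ℝ)) * (G * (2 * M) ^ 2) := fun b => by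
    have hs : ∀ j, |F j (b j) ^ 2| ≤ (2 * M) ^ 2 := fun j => by
      rw [abs_pow]; exact pow_le_pow_left₀ (abs_nonneg _) (hFM _ _) 2
    unfold pairVar
    refine (abs_sub _ _).trans (add_le_add ?_ ?_)
    · rw [abs_mul, abs_of_nonneg (by positivity : (0 : ℝ) ≤ 1 / (G : ℝ))]
      gcongr
      refine (Finset.abs_sum_le_sum_abs _ _).trans ?_
      exact (Finset.sum_le_card_nsmul _ _ _ fun j _ => hs j).trans (by simp)
    · rw [abs_mul, abs_of_nonneg (by positivity : (0 : ℝ) ≤ 1 / (G : ℝ))]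
      gcongr
      refine (Finset.abs_sum_le_sum_abs _ _).trans ?_
      refine (Finset.sum_le_card_nsmul _ _ ((2 * M) ^ 2) fun j _ => ?_).trans ?_
      · rw [abs_mul, sq]
        exact mul_le_mul (hFM _ _) (hFM _ _) (abs_nonneg _) (by positivity)
      · simp only [Finset.card_univ, Fintype.card_fin, nsmul_eq_mul]
        have : ((G / 2 : ℕ) : ℝ) ≤ G := by exact_mod_cast Nat.div_le_self _ _
        gcongr
  refine (le_of_eq hmp).trans ?_
  have hint : Integrable (fun b : Fin G → (α × α) × Bool => (pairVar (fun j => F j (b j)) - c) ^ 2)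
      (Measure.pi fun _ : Fin G => (l.prod l).prod coin) :=
    ((memLp_two_of_abs_le hmeas hbd).sub (memLp_const c)).integrable_sq
  rw [← ofReal_integral_eq_lintegral_ofReal hint (Eventually.of_forall fun _ => sq_nonneg _)]
  refine ENNReal.ofReal_le_ofReal (hb.trans (le_of_eq ?_))
  ring

end Blocks

/-! ### Paired samples: i.i.d. clusters with independent coins -/

section PairedSample

variable {G : ℕ}

/-- A random permutation takes finitely many values, so measurability can be checked with the
permutation held fixed. -/
theorem measurable_of_perm {β γ : Type*} [MeasurableSpace β] [MeasurableSpace γ] {n : ℕ}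
    {f : Equiv.Perm (Fin n) → β → γ}
    (hf : ∀ σ, Measurable (f σ)) {τ : β → Equiv.Perm (Fin n)}
    (hτ : ∀ σ, MeasurableSet (τ ⁻¹' {σ})) : Measurable fun b => f (τ b) b := by
  let : MeasurableSpace (Equiv.Perm (Fin n)) := ⊤
  have : MeasurableSingletonClass (Equiv.Perm (Fin n)) := ⟨fun _ => trivial⟩
  have h1 : Measurable τ := measurable_to_countable' hτ
  have h2 : Measurable fun p : Equiv.Perm (Fin n) × β => f p.1 p.2 :=
    measurable_from_prod_countable_right hf
  exact h2.comp (h1.prodMk measurable_id)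

theorem measurable_pairVar {β : Type*} [MeasurableSpace β] {δ : β → Fin G → ℝ}
    (h : ∀ j, Measurable fun b => δ b j) : Measurable fun b => pairVar (δ b) :=
  ((Finset.measurable_fun_sum _ fun j _ => (h j).pow_const 2).const_mul _).sub
    ((Finset.measurable_fun_sum _ fun _ _ => (h _).mul (h _)).const_mul _)

theorem measurable_pairContrast {β : Type*} [MeasurableSpace β] {y : β → Fin (2 * G) → Bool → ℝ}
    {s : β → Fin G → Bool} (hy : ∀ g d, Measurable fun b => y b g d) (hs : Measurable s)
    (σ : Equiv.Perm (Fin (2 * G))) (j : Fin G) :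
    Measurable fun b => pairContrast (y b) σ (s b) j :=
  Measurable.ite (((measurable_pi_apply j).comp hs) (measurableSet_singleton true))
    ((hy _ _).sub (hy _ _)) ((hy _ _).sub (hy _ _))

theorem measurable_meanPairVar {β : Type*} [MeasurableSpace β] {m q : β → Fin (2 * G) → Bool → ℝ}
    (hm : ∀ g d, Measurable fun b => m b g d) (hq : ∀ g d, Measurable fun b => q b g d)
    (σ : Equiv.Perm (Fin (2 * G))) : Measurable fun b => meanPairVar (m b) (q b) σ := by
  unfold meanPairVar meanSqContrast meanContrast
  refine ((Finset.measurable_fun_sum _ fun j _ => ?_).const_mul _).sub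
    ((Finset.measurable_fun_sum _ fun j _ => ?_).const_mul _)
  · exact ((((hq _ _).add (hq _ _)).sub (((hm _ _).const_mul 2).mul (hm _ _))).add
      (((hq _ _).add (hq _ _)).sub (((hm _ _).const_mul 2).mul (hm _ _)))).const_mul _
  · exact ((((hm _ _).sub (hm _ _)).add ((hm _ _).sub (hm _ _))).const_mul _).mul
      ((((hm _ _).sub (hm _ _)).add ((hm _ _).sub (hm _ _))).const_mul _)

variable {Ω 𝓧 E : Type*} [MeasurableSpace Ω] [MeasurableSpace 𝓧] [MeasurableSpace E]

/-- The clusters `x ω g` are i.i.d. with law `Q`, and independently of them fair coins `s ω j`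
determine which cluster of a pair is treated. -/
structure IsPairedSample (P : Measure Ω) (Q : Measure 𝓧) (x : Ω → Fin (2 * G) → 𝓧)
    (s : Ω → Fin G → Bool) : Prop where
  measurable_x : Measurable x
  measurable_s : Measurable s
  map_eq : P.map (fun ω => (x ω, s ω)) =
    (Measure.pi fun _ : Fin (2 * G) => Q).prod (Measure.pi fun _ : Fin G => coin)

/-- Truncation at level `M`. -/
noncomputable def clip (M y : ℝ) : ℝ := max (-M) (min M y)

theorem measurable_clip (M : ℝ) : Measurable (clip M) := by
  unfold clip
  fun_prop

theorem abs_clip_le {M : ℝ} (hM : 0 ≤ M) (y : ℝ) : |clip M y| ≤ M := by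
  unfold clip
  rw [abs_le]
  exact ⟨le_max_left _ _, max_le (by linarith) (min_le_left _ _)⟩

theorem sq_sub_clip_le {M : ℝ} (hM : 0 ≤ M) (y : ℝ) : (y - clip M y) ^ 2 ≤ y ^ 2 := by
  unfold clip
  rcases max_cases (-M) (min M y) with h | h <;> rcases min_cases M y with h' | h' <;>
    rw [h.1] <;> nlinarith

theorem sq_clip_le {M : ℝ} (hM : 0 ≤ M) (y : ℝ) : clip M y ^ 2 ≤ y ^ 2 := by
  unfold clip
  rcases max_cases (-M) (min M y) with h | h <;> rcases min_cases M y with h' | h' <;>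
    rw [h.1] <;> nlinarith

theorem clip_eq_self {M y : ℝ} (h : |y| ≤ M) : clip M y = y := by
  unfold clip
  rw [abs_le] at h
  rw [min_eq_right h.2, max_eq_right h.1]

namespace IsPairedSample

variable {P : Measure Ω} {Q : Measure 𝓧} {x : Ω → Fin (2 * G) → 𝓧} {s : Ω → Fin G → Bool}

theorem measurePreserving (h : IsPairedSample P Q x s) : MeasurePreserving (fun ω => (x ω, s ω)) P
    ((Measure.pi fun _ : Fin (2 * G) => Q).prod (Measure.pi fun _ : Fin G => coin)) :=
  ⟨h.measurable_x.prodMk h.measurable_s, h.map_eq⟩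

variable [IsProbabilityMeasure Q] (h : IsPairedSample P Q x s)

include h

theorem measurePreserving_x : MeasurePreserving x P (Measure.pi fun _ : Fin (2 * G) => Q) :=
  measurePreserving_fst.comp h.measurePreserving

theorem measurePreserving_apply (g : Fin (2 * G)) : MeasurePreserving (fun ω => x ω g) P Q :=
  (measurePreserving_eval (fun _ : Fin (2 * G) => Q) g).comp h.measurePreserving_x

theorem isProbabilityMeasure : IsProbabilityMeasure P :=
  ⟨by simpa using h.measurePreserving.measure_preimage MeasurableSet.univ.nullMeasurableSet⟩

theorem indepFun {f f' : 𝓧 → ℝ} (hf : AEStronglyMeasurable f Q) (hf' : AEStronglyMeasurable f' Q)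
    {g g' : Fin (2 * G)} (hg : g ≠ g') :
    (fun ω => f (x ω g)) ⟂ᵢ[P] fun ω => f' (x ω g') := by
  have := h.isProbabilityMeasure
  have hi : iIndepFun (fun g ω => x ω g) P := by
    rw [iIndepFun_iff_map_fun_eq_pi_map fun g => (h.measurePreserving_apply g).measurable.aemeasurable]
    simp only [(h.measurePreserving_apply _).map_eq]
    exact h.measurePreserving_x.map_eq
  refine (hi.indepFun hg).comp₀ (h.measurePreserving_apply g).measurable.aemeasurable
    (h.measurePreserving_apply g').measurable.aemeasurable ?_ ?_
  · rw [(h.measurePreserving_apply g).map_eq]; exact hf.aemeasurable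
  · rw [(h.measurePreserving_apply g').map_eq]; exact hf'.aemeasurable

theorem integral_apply {f : 𝓧 → ℝ} (hf : AEStronglyMeasurable f Q) (g : Fin (2 * G)) :
    ∫ ω, f (x ω g) ∂P = ∫ t, f t ∂Q := by
  rw [← (h.measurePreserving_apply g).map_eq, integral_map
    (h.measurePreserving_apply g).measurable.aemeasurable]
  rw [(h.measurePreserving_apply g).map_eq]
  exact hf

theorem integrable_apply {f : 𝓧 → ℝ} (hf : Integrable f Q) (g : Fin (2 * G)) :
    Integrable (fun ω => f (x ω g)) P :=
  (h.measurePreserving_apply g).integrable_comp_of_integrable hf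

theorem integrable_average {f : 𝓧 → ℝ} (hf : Integrable f Q) :
    Integrable (fun ω => 1 / (2 * (G : ℝ)) * ∑ g, f (x ω g)) P :=
  (integrable_finsetSum _ fun g _ => h.integrable_apply hf g).const_mul _

theorem integral_average (hG : 0 < G) {f : 𝓧 → ℝ} (hf : Integrable f Q) :
    ∫ ω, 1 / (2 * (G : ℝ)) * ∑ g, f (x ω g) ∂P = ∫ t, f t ∂Q := by
  have hG' : (0 : ℝ) < G := by exact_mod_cast hG
  rw [integral_const_mul, integral_finsetSum _ fun g _ => h.integrable_apply hf g]
  simp only [h.integral_apply hf.1]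
  simp
  field_simp

theorem lintegral_sq_average_sub_le (hG : 0 < G) {f : 𝓧 → ℝ} (hf : MemLp f 2 Q) :
    ∫⁻ ω, ENNReal.ofReal ((1 / (2 * (G : ℝ)) * ∑ g, f (x ω g) - ∫ t, f t ∂Q) ^ 2) ∂P
      ≤ ENNReal.ofReal ((∫ t, f t ^ 2 ∂Q) / G) := by
  have hG' : (0 : ℝ) < G := by exact_mod_cast hG
  have := h.isProbabilityMeasure
  have hL : ∀ g, MemLp (fun ω => f (x ω g)) 2 P := fun g =>
    hf.comp_measurePreserving (h.measurePreserving_apply g)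
  have h1 := lintegral_sq_sum_sub_le hL fun g g' hg => h.indepFun hf.1 hf.1 hg
  simp only [h.integral_apply hf.1, h.integral_apply (f := fun t => f t ^ 2) (hf.1.pow 2)] at h1
  simp only [Finset.sum_const, Finset.card_univ, Fintype.card_fin, nsmul_eq_mul] at h1
  have h2 : ∀ ω, (1 / (2 * (G : ℝ)) * ∑ g, f (x ω g) - ∫ t, f t ∂Q) ^ 2 = (1 / (2 * (G : ℝ))) ^ 2 *
      (∑ g, f (x ω g) - ((2 * G : ℕ) : ℝ) * ∫ t, f t ∂Q) ^ 2 := fun ω => by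
    rw [← mul_pow]
    congr 1
    push_cast
    field_simp
  simp only [h2, ENNReal.ofReal_mul (sq_nonneg (1 / (2 * (G : ℝ))))]
  rw [lintegral_const_mul' _ _ ENNReal.ofReal_ne_top]
  refine (mul_le_mul_right h1 _).trans ?_
  rw [← ENNReal.ofReal_mul (sq_nonneg _)]
  refine ENNReal.ofReal_le_ofReal ?_
  have h3 : 0 ≤ ∫ t, f t ^ 2 ∂Q := integral_nonneg fun _ => sq_nonneg _
  push_cast
  rw [div_pow, mul_pow, div_mul_eq_mul_div, div_le_div_iff₀ (by positivity) (by positivity)]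
  nlinarith [mul_nonneg h3 (sq_nonneg (G : ℝ))]

end IsPairedSample

/-- The sign of a treatment assignment within a pair. -/
def sgn (b : Bool) : ℝ := if b then 1 else -1

/-- Independent fair signs are centered and orthogonal, so only the diagonal terms survive in the
second moment. -/
theorem lintegral_sq_sum_sgn_le (c : Fin G → ℝ) :
    ∫⁻ s, ENNReal.ofReal ((∑ j, sgn (s j) * c j) ^ 2) ∂(Measure.pi fun _ : Fin G => coin)
      ≤ ENNReal.ofReal (∑ j, c j ^ 2) := by
  have hsg : ∀ b, |sgn b| ≤ 1 := fun b => by cases b <;> simp [sgn]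
  have hm : ∀ j, Measurable fun b => sgn b * c j := fun j => measurable_from_top
  have hL : ∀ j, MemLp (fun b => sgn b * c j) 2 coin := fun j =>
    memLp_two_of_abs_le (M := |c j|) (hm j) fun b => by
      rw [abs_mul]; exact mul_le_of_le_one_left (abs_nonneg _) (hsg b)
  have hi := iIndepFun_pi (μ := fun _ : Fin G => coin) (X := fun j b => sgn b * c j)
    fun j => (hm j).aemeasurable
  have h1 := lintegral_sq_sum_sub_le
    (fun j => (hL j).comp_measurePreserving (measurePreserving_eval (fun _ : Fin G => coin) j))
    fun i j hij => hi.indepFun hij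
  have h2 : ∀ (f : Bool → ℝ) (j : Fin G),
      ∫ s, f (s j) ∂(Measure.pi fun _ : Fin G => coin) = 1 / 2 * (f true + f false) := fun f j => by
    rw [← integral_coin]
    exact integral_comp_eval (μ := fun _ : Fin G => coin) (f := f)
      measurable_from_top.aestronglyMeasurable
  simp only [Function.comp_apply, Function.eval] at h1
  have h3 : ∀ j : Fin G, ∫ s, sgn (s j) * c j ∂(Measure.pi fun _ : Fin G => coin) = 0 := fun j => by
    rw [h2 (fun b => sgn b * c j)]; simp [sgn]
  have h4 : ∀ j : Fin G, ∫ s, (sgn (s j) * c j) ^ 2 ∂(Measure.pi fun _ : Fin G => coin) = c j ^ 2 :=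
    fun j => by rw [h2 (fun b => (sgn b * c j) ^ 2)]; simp [sgn]; ring
  simpa only [h3, h4, Finset.sum_const_zero, sub_zero] using h1

variable {P : Measure Ω} {Q : Measure 𝓧} [IsProbabilityMeasure Q]
  {x : Ω → Fin (2 * G) → 𝓧} {s : Ω → Fin G → Bool}

theorem measurableSet_perm_comp {V : 𝓧 → E} (hV : Measurable V)
    {p : (Fin (2 * G) → E) → Equiv.Perm (Fin (2 * G))} (hp : ∀ σ, MeasurableSet (p ⁻¹' {σ}))
    (σ : Equiv.Perm (Fin (2 * G))) :
    MeasurableSet ((fun w : Fin (2 * G) → 𝓧 => p fun g => V (w g)) ⁻¹' {σ}) := by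
  have : Measurable fun (w : Fin (2 * G) → 𝓧) g => V (w g) :=
    measurable_pi_lambda _ fun g => hV.comp (measurable_pi_apply g)
  exact this (hp σ)

/-- The pairing depends on the clusters only, and the coins are independent of the clusters. By
Fubini the clusters, and with them the pairing, can be frozen while the signs are averaged out. This
controls the imbalance between the treatment arms for any pairing rule, without any closeness of the
matched clusters. -/
theorem IsPairedSample.lintegral_sq_sgn_average_le (h : IsPairedSample P Q x s) (hG : 0 < G)
    {V : 𝓧 → E} (hV : Measurable V) {p : (Fin (2 * G) → E) → Equiv.Perm (Fin (2 * G))}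
    (hp : ∀ σ, MeasurableSet (p ⁻¹' {σ})) {f : 𝓧 → ℝ} (hfm : Measurable f) (hf : MemLp f 2 Q) :
    (Measurable fun ω => 1 / (2 * (G : ℝ)) * ∑ j, sgn (s ω j) *
      (f (x ω (p (fun g => V (x ω g)) (sndPos j))) - f (x ω (p (fun g => V (x ω g)) (fstPos j))))) ∧
    ∫⁻ ω, ENNReal.ofReal ((1 / (2 * (G : ℝ)) * ∑ j, sgn (s ω j) *
        (f (x ω (p (fun g => V (x ω g)) (sndPos j))) - f (x ω (p (fun g => V (x ω g)) (fstPos j))))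
        - 0) ^ 2) ∂P
      ≤ ENNReal.ofReal ((∫ t, f t ^ 2 ∂Q) / G) := by
  have hG' : (0 : ℝ) < G := by exact_mod_cast hG
  set τ : (Fin (2 * G) → 𝓧) → Equiv.Perm (Fin (2 * G)) := fun w => p fun g => V (w g) with hτ
  have hτm := measurableSet_perm_comp hV hp
  set Φ : (Fin (2 * G) → 𝓧) × (Fin G → Bool) → ENNReal := fun r =>
    ENNReal.ofReal ((1 / (2 * (G : ℝ)) * ∑ j, sgn (r.2 j) *
        (f (r.1 (τ r.1 (sndPos j))) - f (r.1 (τ r.1 (fstPos j)))) - 0) ^ 2) with hΦ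
  have hm : Measurable fun r : (Fin (2 * G) → 𝓧) × (Fin G → Bool) => 1 / (2 * (G : ℝ)) *
      ∑ j, sgn (r.2 j) * (f (r.1 (τ r.1 (sndPos j))) - f (r.1 (τ r.1 (fstPos j)))) := by
    refine Measurable.const_mul (Finset.measurable_fun_sum _ fun j _ => ?_) _
    refine Measurable.mul ?_ ?_
    · exact (measurable_from_top (f := sgn)).comp ((measurable_pi_apply j).comp measurable_snd)
    · have : ∀ i, Measurable fun w : Fin (2 * G) → 𝓧 => f (w (τ w i)) := fun i =>
        measurable_of_perm (f := fun σ (w : Fin (2 * G) → 𝓧) => f (w (σ i)))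
          (fun σ => hfm.comp (measurable_pi_apply _)) hτm
      exact ((this _).comp measurable_fst).sub ((this _).comp measurable_fst)
  have hΦm : Measurable Φ := ((hm.sub_const _).pow_const 2).ennreal_ofReal
  refine ⟨hm.comp h.measurePreserving.measurable, ?_⟩
  have h1 := h.measurePreserving.lintegral_comp hΦm
  refine (le_of_eq h1).trans ?_
  rw [lintegral_prod _ hΦm.aemeasurable]
  have h2 : ∀ w : Fin (2 * G) → 𝓧, ∫⁻ r, Φ (w, r) ∂(Measure.pi fun _ : Fin G => coin)
      ≤ ENNReal.ofReal (1 / (G : ℝ) * (1 / (2 * (G : ℝ)) * ∑ g, f (w g) ^ 2)) := fun w => by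
    have h3 := lintegral_sq_sum_sgn_le
      (fun j => f (w (τ w (sndPos j))) - f (w (τ w (fstPos j))))
    simp only [hΦ, sub_zero, mul_pow, ENNReal.ofReal_mul (sq_nonneg (1 / (2 * (G : ℝ))))]
    rw [lintegral_const_mul' _ _ ENNReal.ofReal_ne_top]
    refine (mul_le_mul_right h3 _).trans ?_
    rw [← ENNReal.ofReal_mul (sq_nonneg _)]
    refine ENNReal.ofReal_le_ofReal ?_
    have h4 : ∑ j, (f (w (τ w (sndPos j))) - f (w (τ w (fstPos j)))) ^ 2 ≤ 2 * ∑ g, f (w g) ^ 2 := by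
      rw [← sum_pos_eq_sum (fun g => f (w g) ^ 2) (τ w), Finset.mul_sum]
      refine Finset.sum_le_sum fun j _ => ?_
      nlinarith [sq_nonneg (f (w (τ w (sndPos j))) + f (w (τ w (fstPos j))))]
    calc (1 / (2 * (G : ℝ))) ^ 2 * ∑ j, (f (w (τ w (sndPos j))) - f (w (τ w (fstPos j)))) ^ 2
        ≤ (1 / (2 * (G : ℝ))) ^ 2 * (2 * ∑ g, f (w g) ^ 2) := by gcongr
      _ = 1 / (G : ℝ) * (1 / (2 * (G : ℝ)) * ∑ g, f (w g) ^ 2) := by field_simp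
  refine (lintegral_mono h2).trans ?_
  have hi : Integrable (fun w : Fin (2 * G) → 𝓧 => 1 / (G : ℝ) *
      (1 / (2 * (G : ℝ)) * ∑ g, f (w g) ^ 2)) (Measure.pi fun _ : Fin (2 * G) => Q) :=
    ((integrable_finsetSum _ fun g _ =>
      integrable_comp_eval (μ := fun _ : Fin (2 * G) => Q) hf.integrable_sq).const_mul _).const_mul _
  rw [← ofReal_integral_eq_lintegral_ofReal hi (Eventually.of_forall fun w => by positivity)]
  refine ENNReal.ofReal_le_ofReal (le_of_eq ?_)
  rw [integral_const_mul, integral_const_mul, integral_finsetSum _ fun g _ =>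
    integrable_comp_eval (μ := fun _ : Fin (2 * G) => Q) hf.integrable_sq]
  have h5 : ∀ g : Fin (2 * G), ∫ w, f (w g) ^ 2 ∂(Measure.pi fun _ : Fin (2 * G) => Q)
      = ∫ t, f t ^ 2 ∂Q := fun g =>
    integral_comp_eval (μ := fun _ : Fin (2 * G) => Q) (f := fun t => f t ^ 2)
      (hfm.pow_const 2).aestronglyMeasurable
  simp only [h5]
  simp
  field_simp

/-- The conditional mean, given the matching variable, of a function of the outcomes. -/
noncomputable def condMeanAt (κ : Kernel E (Bool → ℝ)) (f : ℝ → ℝ) (v : E) (d : Bool) : ℝ :=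
  ∫ y, f (y d) ∂κ v

theorem measurable_condMeanAt (κ : Kernel E (Bool → ℝ)) [IsMarkovKernel κ] {f : ℝ → ℝ}
    (hf : Measurable f) (d : Bool) : Measurable fun v => condMeanAt κ f v d :=
  (StronglyMeasurable.integral_kernel (κ := κ)
    (hf.comp (measurable_pi_apply d)).stronglyMeasurable).measurable

/-- `pairVar` of truncated outcomes, centered at its conditional mean given the matching variables,
when `κ` is the conditional law of the outcomes. -/
noncomputable def centeredPairVar (κ : Kernel E (Bool → ℝ)) (M : ℝ)
    (p : (Fin (2 * G) → E) → Equiv.Perm (Fin (2 * G)))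
    (r : (Fin (2 * G) → E × (Bool → ℝ)) × (Fin G → Bool)) : ℝ :=
  pairVar (pairContrast (fun g d => clip M ((r.1 g).2 d)) (p fun g => (r.1 g).1) r.2)
    - meanPairVar (fun g d => condMeanAt κ (clip M) (r.1 g).1 d)
      (fun g d => condMeanAt κ (fun t => clip M t ^ 2) (r.1 g).1 d) (p fun g => (r.1 g).1)

theorem measurable_centeredPairVar (κ : Kernel E (Bool → ℝ)) [IsMarkovKernel κ] (M : ℝ)
    {p : (Fin (2 * G) → E) → Equiv.Perm (Fin (2 * G))} (hp : ∀ σ, MeasurableSet (p ⁻¹' {σ})) :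
    Measurable (centeredPairVar κ M p) := by
  have hco : ∀ g, Measurable fun r : (Fin (2 * G) → E × (Bool → ℝ)) × (Fin G → Bool) => r.1 g :=
    fun g => (measurable_pi_apply g).comp measurable_fst
  have hpm : ∀ σ, MeasurableSet ((fun r : (Fin (2 * G) → E × (Bool → ℝ)) × (Fin G → Bool) =>
      p fun g => (r.1 g).1) ⁻¹' {σ}) := fun σ =>
    measurable_fst (measurableSet_perm_comp (𝓧 := E × (Bool → ℝ)) measurable_fst hp σ)
  refine Measurable.sub ?_ ?_
  · refine measurable_of_perm (f := fun σ (r : (Fin (2 * G) → E × (Bool → ℝ)) × (Fin G → Bool)) =>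
      pairVar (pairContrast (fun g d => clip M ((r.1 g).2 d)) σ r.2)) (fun σ => ?_) hpm
    refine measurable_pairVar fun j => measurable_pairContrast (fun g d => ?_) measurable_snd σ j
    exact (measurable_clip M).comp ((measurable_pi_apply d).comp (measurable_snd.comp (hco g)))
  · refine measurable_of_perm (f := fun σ (r : (Fin (2 * G) → E × (Bool → ℝ)) × (Fin G → Bool)) =>
      meanPairVar (fun g d => condMeanAt κ (clip M) (r.1 g).1 d)
      (fun g d => condMeanAt κ (fun t => clip M t ^ 2) (r.1 g).1 d) σ) (fun σ => ?_) hpm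
    refine measurable_meanPairVar (fun g d => ?_) (fun g d => ?_) σ
    · exact (measurable_condMeanAt κ (measurable_clip M) d).comp (measurable_fst.comp (hco g))
    · exact (measurable_condMeanAt κ ((measurable_clip M).pow_const 2) d).comp
        (measurable_fst.comp (hco g))

/-- Conditionally on the matching variables, `pairVar` of truncated outcomes concentrates at its
mean. -/
theorem IsPairedSample.lintegral_sq_centeredPairVar_le (h : IsPairedSample P Q x s) (hG : 0 < G)
    {V : 𝓧 → E} (hV : Measurable V) {p : (Fin (2 * G) → E) → Equiv.Perm (Fin (2 * G))}
    (hp : ∀ σ, MeasurableSet (p ⁻¹' {σ})) {y : 𝓧 → Bool → ℝ} (hy : Measurable y) {M : ℝ}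
    (hM : 0 ≤ M) :
    ∫⁻ ω, ENNReal.ofReal (centeredPairVar (condDistrib y V Q) M p
      (fun g => (V (x ω g), y (x ω g)), s ω) ^ 2) ∂P ≤ ENNReal.ofReal (64 * M ^ 4 / G) := by
  set κ := condDistrib y V Q with hκ
  -- The conditional law of the outcomes is realized as `φ v u` with `u` uniform and independent of
  -- the matching variable `v`. Conditioning on all matching variables thereby becomes Fubini on a
  -- product space.
  obtain ⟨φ, hφm, hφ⟩ := Kernel.exists_measurable_map_eq_unitInterval κ
  have hφv : ∀ v, Measurable (φ v) := fun v => hφm.comp measurable_prodMk_left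
  set Φ : (Fin (2 * G) → E × (Bool → ℝ)) × (Fin G → Bool) → ℝ := centeredPairVar κ M p with hΦ
  have hΦm : Measurable Φ := measurable_centeredPairVar κ M hp
  have hΦm' : Measurable fun r => ENNReal.ofReal (Φ r ^ 2) := (hΦm.pow_const 2).ennreal_ofReal
  have : IsProbabilityMeasure (Q.map V) := Measure.isProbabilityMeasure_map hV.aemeasurable
  have : IsProbabilityMeasure (Q.map fun t => (V t, y t)) :=
    Measure.isProbabilityMeasure_map (hV.prodMk hy).aemeasurable
  have h1 : MeasurePreserving (fun ω => ((fun g => (V (x ω g), y (x ω g))), s ω)) P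
      ((Measure.pi fun _ : Fin (2 * G) => Q.map fun t => (V t, y t)).prod
        (Measure.pi fun _ : Fin G => coin)) := by
    have h2 : MeasurePreserving (fun (w : Fin (2 * G) → 𝓧) g => (V (w g), y (w g)))
        (Measure.pi fun _ : Fin (2 * G) => Q)
        (Measure.pi fun _ : Fin (2 * G) => Q.map fun t => (V t, y t)) :=
      measurePreserving_pi _ _ fun _ => ⟨hV.prodMk hy, rfl⟩
    exact (h2.prod (MeasurePreserving.id _)).comp h.measurePreserving
  have h3 : MeasurePreserving (fun r : E × unitInterval => (r.1, φ r.1 r.2))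
      ((Q.map V).prod volume) (Q.map fun t => (V t, y t)) := by
    have hm : Measurable fun r : E × unitInterval => (r.1, φ r.1 r.2) := measurable_fst.prodMk hφm
    refine ⟨hm, ?_⟩
    rw [← compProd_map_condDistrib hy.aemeasurable]
    ext A hA
    rw [Measure.map_apply hm hA, Measure.prod_apply (hm hA), Measure.compProd_apply hA]
    refine lintegral_congr fun v => ?_
    rw [← hκ, ← hφ v, Measure.map_apply (hφv v)
      (measurable_prodMk_left hA)]
    rfl
  have h4 : MeasurePreserving (fun r : ((Fin (2 * G) → E) × (Fin (2 * G) → unitInterval)) ×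
        (Fin G → Bool) => ((fun g => (r.1.1 g, φ (r.1.1 g) (r.1.2 g))), r.2))
      (((Measure.pi fun _ : Fin (2 * G) => Q.map V).prod
        (Measure.pi fun _ : Fin (2 * G) => (volume : Measure unitInterval))).prod
        (Measure.pi fun _ : Fin G => coin))
      ((Measure.pi fun _ : Fin (2 * G) => Q.map fun t => (V t, y t)).prod
        (Measure.pi fun _ : Fin G => coin)) := by
    have h5 := (measurePreserving_arrowProdEquivProdArrow E unitInterval (Fin (2 * G))
      (fun _ => Q.map V) (fun _ => volume)).symm
    have h6 := measurePreserving_pi (fun _ : Fin (2 * G) => (Q.map V).prod volume)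
      (fun _ : Fin (2 * G) => Q.map fun t => (V t, y t)) fun _ => h3
    exact (h6.comp h5).prod (MeasurePreserving.id _)
  have h7 := h1.lintegral_comp hΦm'
  have h8 := h4.lintegral_comp hΦm'
  refine ((le_of_eq h7).trans (le_of_eq h8.symm)).trans ?_
  -- Reassociation puts the matching variables in the outer integral, leaving uniforms and coins
  -- inside.
  have h9 := (measurePreserving_prodAssoc (Measure.pi fun _ : Fin (2 * G) => Q.map V)
    (Measure.pi fun _ : Fin (2 * G) => (volume : Measure unitInterval))
    (Measure.pi fun _ : Fin G => coin)).symm.lintegral_comp (hΦm'.comp h4.measurable)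
  refine (le_of_eq h9.symm).trans ?_
  have hm9 := (hΦm'.comp h4.measurable).comp
    (MeasurableEquiv.prodAssoc (α := Fin (2 * G) → E) (β := Fin (2 * G) → unitInterval)
      (γ := Fin G → Bool)).symm.measurable
  refine (le_of_eq (lintegral_prod _ hm9.aemeasurable)).trans ?_
  have hone : ENNReal.ofReal (64 * M ^ 4 / G) = ∫⁻ _, ENNReal.ofReal (64 * M ^ 4 / G)
    ∂(Measure.pi fun _ : Fin (2 * G) => Q.map V) := by simp
  rw [hone]
  refine lintegral_mono fun v => ?_
  -- With `v` frozen the permutation `p v` is fixed, and the outcome of cluster `g` is a bounded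
  -- function of its own uniform variable.
  have h10 := lintegral_sq_pairVar_contrast_sub_le hG (p v) (volume : Measure unitInterval)
    (z := fun g u d => clip M (φ (v g) u d)) (M := M)
    (fun g d => (measurable_clip M).comp ((measurable_pi_apply d).comp
      (hφv _)))
    (fun g u d => abs_clip_le hM _) hM
  have h11 : ∀ (f : ℝ → ℝ), Measurable f → ∀ v d,
      condMeanAt κ f v d = ∫ u, f (φ v u d) := fun f hf v d => by
    rw [condMeanAt, ← hφ v]
    exact integral_map (hφv v).aemeasurable (hf.comp (measurable_pi_apply d)).aestronglyMeasurable
  refine le_trans (le_of_eq ?_) h10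
  refine lintegral_congr fun r => ?_
  simp only [hΦ, centeredPairVar, Function.comp_apply, h11 _ (measurable_clip M),
    h11 _ ((measurable_clip M).pow_const 2)]
  rfl

end PairedSample

/-! ### Conditional Jensen inequality for squares -/

section CondExp

variable {Ω : Type*} {m₀ : MeasurableSpace Ω} {P : Measure Ω} [IsProbabilityMeasure P]
  {X : Ω → ℝ} {m : MeasurableSpace Ω}

theorem sq_condExp_ae_le (hm : m ≤ m₀) (hX : MemLp X 2 P) :
    P[X | m] ^ 2 ≤ᵐ[P] P[X ^ 2 | m] := by
  have h0 : (0 : Ω → ℝ) ≤ᵐ[P] Var[X; P | m] :=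
    condExp_nonneg (Eventually.of_forall fun ω => sq_nonneg _)
  filter_upwards [condVar_ae_eq_condExp_sq_sub_sq_condExp hm hX, h0] with ω h1 h2
  rw [h1] at h2
  simp only [Pi.zero_apply, Pi.sub_apply, Pi.pow_apply] at h2 ⊢
  linarith

theorem integral_sq_condExp_le (hm : m ≤ m₀) (hX : MemLp X 2 P) :
    ∫ ω, (P[X | m]) ω ^ 2 ∂P ≤ ∫ ω, X ω ^ 2 ∂P := by
  have h1 : ∫ ω, (P[X | m]) ω ^ 2 ∂P ≤ ∫ ω, (P[X ^ 2 | m]) ω ∂P :=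
    integral_mono_ae (hX.condExp one_le_two).integrable_sq integrable_condExp
      (sq_condExp_ae_le hm hX)
  rw [integral_condExp hm] at h1
  exact h1

end CondExp

/-! ### Removing the truncation in the limit -/

section PairVarLimit

theorem tendsto_integral_sq_sub_clip {𝓧 : Type*} [MeasurableSpace 𝓧] {Q : Measure 𝓧}
    {f : 𝓧 → ℝ} (hf : MemLp f 2 Q) :
    Tendsto (fun n : ℕ => ∫ t, (f t - clip n (f t)) ^ 2 ∂Q) atTop (𝓝 0) := by
  have h := tendsto_integral_of_dominated_convergence (μ := Q)
    (F := fun (n : ℕ) t => (f t - clip n (f t)) ^ 2) (f := fun _ => 0) (fun t => f t ^ 2)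
    (fun n => (hf.1.sub (((measurable_clip n).comp_aemeasurable hf.1.aemeasurable).aestronglyMeasurable)).pow 2)
    hf.integrable_sq
    (fun n => Eventually.of_forall fun t => by
      rw [Real.norm_eq_abs, abs_of_nonneg (sq_nonneg _)]
      exact sq_sub_clip_le n.cast_nonneg _)
    (Eventually.of_forall fun t => by
      refine tendsto_const_nhds.congr' ?_
      filter_upwards [eventually_ge_atTop ⌈|f t|⌉₊] with n hn
      rw [clip_eq_self ((Nat.le_ceil _).trans (by exact_mod_cast hn))]
      simp)
  simpa using h

theorem memLp_clip {𝓧 : Type*} [MeasurableSpace 𝓧] {Q : Measure 𝓧} [IsFiniteMeasure Q]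
    {f : 𝓧 → ℝ} (hf : Measurable f) {M : ℝ} (hM : 0 ≤ M) : MemLp (fun t => clip M (f t)) 2 Q :=
  memLp_two_of_abs_le ((measurable_clip M).comp hf) fun t => abs_clip_le hM (f t)

section Clipped

variable {𝓧 E : Type*} [MeasurableSpace 𝓧] [MeasurableSpace E] {Q : Measure 𝓧}
  [IsProbabilityMeasure Q] {V : 𝓧 → E} {y : 𝓧 → Bool → ℝ}

theorem condMeanAt_ae_eq (hV : Measurable V) (hy : Measurable y) {f : ℝ → ℝ} (hf : Measurable f)
    (d : Bool) (hi : Integrable (fun t => f (y t d)) Q) :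
    Q[fun t => f (y t d) | sigma V] =ᵐ[Q] fun t => condMeanAt (condDistrib y V Q) f (V t) d :=
  condExp_ae_eq_integral_condDistrib (f := fun u : Bool → ℝ => f (u d)) hV hy.aemeasurable
    (hf.comp (measurable_pi_apply d)).stronglyMeasurable hi

theorem abs_condMeanAt_le (κ : Kernel E (Bool → ℝ)) [IsMarkovKernel κ] {f : ℝ → ℝ} {B : ℝ}
    (hB : ∀ t, |f t| ≤ B) (v : E) (d : Bool) : |condMeanAt κ f v d| ≤ B := by
  have := norm_integral_le_of_norm_le_const (μ := κ v) (f := fun y : Bool → ℝ => f (y d)) (C := B)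
    (Eventually.of_forall fun y => hB (y d))
  rw [probReal_univ, mul_one] at this
  exact this

/-- The squared error of the conditional mean of the truncated outcome. -/
theorem integral_sq_condMeanAt_sub_le (hV : Measurable V) (hy : Measurable y) {d : Bool}
    (hyL : MemLp (fun t => y t d) 2 Q) {μ : E → Bool → ℝ}
    (hμ : Q[fun t => y t d | sigma V] =ᵐ[Q] fun t => μ (V t) d) {M : ℝ} (hM : 0 ≤ M) :
    MemLp (fun t => condMeanAt (condDistrib y V Q) (clip M) (V t) d - μ (V t) d) 2 Q ∧
    ∫ t, (condMeanAt (condDistrib y V Q) (clip M) (V t) d - μ (V t) d) ^ 2 ∂Q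
      ≤ ∫ t, (y t d - clip M (y t d)) ^ 2 ∂Q := by
  -- The difference is the conditional expectation of the truncation error, and conditional
  -- expectation contracts the second moment.
  have hZ : MemLp (fun t => clip M (y t d)) 2 Q := memLp_clip ((measurable_pi_apply d).comp hy) hM
  have h1 := condMeanAt_ae_eq hV hy (measurable_clip M) d (hZ.integrable one_le_two)
  have h2 := condExp_sub (hZ.integrable one_le_two) (hyL.integrable one_le_two) (sigma V)
  have h3 : Q[(fun t => clip M (y t d)) - (fun t => y t d) | sigma V] =ᵐ[Q]
      fun t => condMeanAt (condDistrib y V Q) (clip M) (V t) d - μ (V t) d := by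
    filter_upwards [h1, h2, hμ] with t e1 e2 e3
    rw [e2, Pi.sub_apply, e1, e3]
  refine ⟨((hZ.sub hyL).condExp one_le_two).ae_eq h3, ?_⟩
  have h4 := integral_sq_condExp_le hV.comap_le (hZ.sub hyL)
  have h5 : ∫ t, (condMeanAt (condDistrib y V Q) (clip M) (V t) d - μ (V t) d) ^ 2 ∂Q
      = ∫ t, (Q[(fun t => clip M (y t d)) - (fun t => y t d) | sigma V]) t ^ 2 ∂Q :=
    integral_congr_ae (h3.mono fun t e => by simp only [e])
  refine (h5.le.trans h4).trans (le_of_eq (integral_congr_ae (Eventually.of_forall fun t => ?_)))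
  simp only [Pi.sub_apply]
  ring

theorem abs_integral_sq_sub_le {Q : Measure 𝓧} {f g : 𝓧 → ℝ} (hf : MemLp f 2 Q) (hg : MemLp g 2 Q) {β : ℝ}
    (hβ : 0 < β) : |∫ t, f t ^ 2 ∂Q - ∫ t, g t ^ 2 ∂Q|
      ≤ (1 + 2 / β) * ∫ t, (f t - g t) ^ 2 ∂Q + 2 * β * ∫ t, g t ^ 2 ∂Q := by
  have h0 : Integrable (fun t => (f t - g t) ^ 2) Q := (hf.sub hg).integrable_sq
  have h1 : Integrable (fun t => (1 + 2 / β) * (f t - g t) ^ 2) Q := h0.const_mul _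
  have h2 : Integrable (fun t => 2 * β * g t ^ 2) Q := hg.integrable_sq.const_mul _
  have h3 : Integrable (fun t => (1 + 2 / β) * (f t - g t) ^ 2 + 2 * β * g t ^ 2) Q := h1.add h2
  rw [← integral_sub hf.integrable_sq hg.integrable_sq, ← integral_const_mul,
    ← integral_const_mul, ← integral_add h1 h2]
  rw [← Real.norm_eq_abs]
  refine norm_integral_le_of_norm_le h3 (Eventually.of_forall fun t => ?_)
  have := abs_mul_sub_mul_le (x := f t) (y := f t) (x' := g t) (y' := g t) hβ
  rw [Real.norm_eq_abs, sq, sq]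
  refine this.trans (le_of_eq ?_)
  ring

/-- The limit of `pairVar` for truncated outcomes is close to that for the outcomes themselves. -/
theorem abs_integral_clip_sub_le (hV : Measurable V) (hy : Measurable y)
    (hyL : ∀ d, MemLp (fun t => y t d) 2 Q) {μ : E → Bool → ℝ}
    (hμ : ∀ d, Q[fun t => y t d | sigma V] =ᵐ[Q] fun t => μ (V t) d) {M : ℝ} (hM : 0 ≤ M)
    {β : ℝ} (hβ : 0 < β) :
    |∫ t, (condMeanAt (condDistrib y V Q) (fun u => clip M u ^ 2) (V t) true
        + condMeanAt (condDistrib y V Q) (fun u => clip M u ^ 2) (V t) false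
        - 1 / 2 * (condMeanAt (condDistrib y V Q) (clip M) (V t) true
          + condMeanAt (condDistrib y V Q) (clip M) (V t) false) ^ 2) ∂Q
      - ((∫ t, y t true ^ 2 ∂Q) + (∫ t, y t false ^ 2 ∂Q)
        - 1 / 2 * ∫ t, (μ (V t) true + μ (V t) false) ^ 2 ∂Q)|
      ≤ (3 + 6 / β) * ∑ d, ∫ t, (y t d - clip M (y t d)) ^ 2 ∂Q
        + β * (2 * (∑ d, ∫ t, y t d ^ 2 ∂Q) + ∫ t, (μ (V t) true + μ (V t) false) ^ 2 ∂Q) := by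
  set κ := condDistrib y V Q
  have hyd : ∀ d, Measurable fun t => y t d := fun d => (measurable_pi_apply d).comp hy
  have hZ : ∀ d, MemLp (fun t => clip M (y t d)) 2 Q := fun d => memLp_clip (hyd d) hM
  have hμL : ∀ d, MemLp (fun t => μ (V t) d) 2 Q := fun d =>
    ((hyL d).condExp one_le_two).ae_eq (hμ d)
  have hm := fun d => integral_sq_condMeanAt_sub_le hV hy (hyL d) (hμ d) hM
  have hmL : ∀ d, MemLp (fun t => condMeanAt κ (clip M) (V t) d) 2 Q := fun d => by
    refine ((hm d).1.add (hμL d)).ae_eq (Eventually.of_forall fun t => ?_)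
    simp only [Pi.add_apply]
    ring
  have hqe : ∀ d, Q[fun t => clip M (y t d) ^ 2 | sigma V] =ᵐ[Q]
      fun t => condMeanAt κ (fun u => clip M u ^ 2) (V t) d := fun d =>
    condMeanAt_ae_eq (f := fun u => clip M u ^ 2) hV hy ((measurable_clip M).pow_const 2) d
      (hZ d).integrable_sq
  have hqi : ∀ d, Integrable (fun t => condMeanAt κ (fun u => clip M u ^ 2) (V t) d) Q := fun d =>
    integrable_condExp.congr (hqe d)
  have hq : ∀ d, ∫ t, condMeanAt κ (fun u => clip M u ^ 2) (V t) d ∂Q = ∫ t, clip M (y t d) ^ 2 ∂Q :=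
    fun d => by rw [← integral_congr_ae (hqe d), integral_condExp hV.comap_le]
  have hms : MemLp (fun t => condMeanAt κ (clip M) (V t) true + condMeanAt κ (clip M) (V t) false) 2 Q :=
    (hmL true).add (hmL false)
  have hμs : MemLp (fun t => μ (V t) true + μ (V t) false) 2 Q := (hμL true).add (hμL false)
  have hA : ∀ d, |∫ t, clip M (y t d) ^ 2 ∂Q - ∫ t, y t d ^ 2 ∂Q|
      ≤ (1 + 2 / β) * ∫ t, (y t d - clip M (y t d)) ^ 2 ∂Q + 2 * β * ∫ t, y t d ^ 2 ∂Q := fun d => by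
    simpa only [sub_sq_comm (y _ d)] using abs_integral_sq_sub_le (hZ d) (hyL d) hβ
  have hms' : ∫ t, (condMeanAt κ (clip M) (V t) true + condMeanAt κ (clip M) (V t) false
      - (μ (V t) true + μ (V t) false)) ^ 2 ∂Q
      ≤ 2 * ∑ d, ∫ t, (condMeanAt κ (clip M) (V t) d - μ (V t) d) ^ 2 ∂Q := by
    rw [Fintype.sum_bool, ← integral_add (hm true).1.integrable_sq (hm false).1.integrable_sq,
      ← integral_const_mul]
    refine integral_mono (hms.sub hμs).integrable_sq
      (((hm true).1.integrable_sq.add (hm false).1.integrable_sq).const_mul 2) fun t => ?_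
    nlinarith [sq_nonneg ((condMeanAt κ (clip M) (V t) true - μ (V t) true)
      - (condMeanAt κ (clip M) (V t) false - μ (V t) false))]
  have hB := abs_integral_sq_sub_le hms hμs hβ
  have hqs : Integrable (fun t => condMeanAt κ (fun u => clip M u ^ 2) (V t) true
    + condMeanAt κ (fun u => clip M u ^ 2) (V t) false) Q := (hqi true).add (hqi false)
  rw [integral_sub hqs (hms.integrable_sq.const_mul _),
    integral_add (hqi true) (hqi false), integral_const_mul, hq, hq]
  have h5 : (1 + 2 / β) * (∫ t, (condMeanAt κ (clip M) (V t) true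
      + condMeanAt κ (clip M) (V t) false - (μ (V t) true + μ (V t) false)) ^ 2 ∂Q)
      ≤ (1 + 2 / β) * (2 * ∑ d, ∫ t, (y t d - clip M (y t d)) ^ 2 ∂Q) := by
    refine mul_le_mul_of_nonneg_left (hms'.trans ?_) (by positivity)
    exact mul_le_mul_of_nonneg_left (Finset.sum_le_sum fun d _ => (hm d).2) zero_le_two
  -- Together the estimates give `2 + 4 / β` times the truncation error, plus the `β` term;
  -- nonnegativity of the truncation errors covers the slack up to `3 + 6 / β`.
  have h6 : 0 ≤ (∑ d, ∫ t, (y t d - clip M (y t d)) ^ 2 ∂Q) / β :=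
    div_nonneg (Finset.sum_nonneg fun d _ => integral_nonneg fun _ => sq_nonneg _) hβ.le
  simp only [Fintype.sum_bool] at h5 h6 hB ⊢
  have h1 := abs_le.1 (hA true)
  have h2 := abs_le.1 (hA false)
  have h3 := abs_le.1 hB
  have h7 : 0 ≤ ∫ t, (y t true - clip M (y t true)) ^ 2 ∂Q := integral_nonneg fun _ => sq_nonneg _
  have h8 : 0 ≤ ∫ t, (y t false - clip M (y t false)) ^ 2 ∂Q := integral_nonneg fun _ => sq_nonneg _
  generalize ∫ t, (y t true - clip M (y t true)) ^ 2 ∂Q = r1 at *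
  generalize ∫ t, (y t false - clip M (y t false)) ^ 2 ∂Q = r0 at *
  simp only [div_eq_mul_inv 2 β, div_eq_mul_inv 6 β, div_eq_mul_inv _ β] at h1 h2 h3 h5 h6 ⊢
  rw [abs_le]
  constructor <;> linarith [h1.1, h1.2, h2.1, h2.2, h3.1, h3.2]

end Clipped

end PairVarLimit

/-! ### Consistency of the variance functional for outcomes close to i.i.d. outcomes -/

section Limit

variable {Ω : ℕ → Type*} [∀ G, MeasurableSpace (Ω G)] {P : ∀ G, Measure (Ω G)}
  {𝓧 E : Type*} [MeasurableSpace 𝓧] [MeasurableSpace E] {Q : Measure 𝓧} [IsProbabilityMeasure Q]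
  {x : ∀ G, Ω G → Fin (2 * G) → 𝓧} {s : ∀ G, Ω G → Fin G → Bool}

theorem TendstoInProb.abs {X : ∀ G, Ω G → ℝ} (hX : TendstoInProb P X 0) :
    TendstoInProb P (fun G ω => |X G ω|) 0 := by
  simpa using hX.map₂ hX (f := fun p => |p.1|) (by fun_prop)

theorem tendstoInProb_average (h : ∀ G, IsPairedSample (P G) Q (x G) (s G)) {f : 𝓧 → ℝ}
    (hfm : Measurable f) (hf : MemLp f 2 Q) :
    TendstoInProb P (fun G ω => 1 / (2 * (G : ℝ)) * ∑ g, f (x G ω g)) (∫ t, f t ∂Q) := by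
  refine tendstoInProb_of_sq (C := ∫ t, f t ^ 2 ∂Q) (fun G => ?_) ?_
  · exact ((Finset.measurable_fun_sum _ fun g _ =>
      hfm.comp ((h G).measurePreserving_apply g).measurable).const_mul _).aemeasurable
  · filter_upwards [eventually_gt_atTop 0] with G hG
    exact (h G).lintegral_sq_average_sub_le hG hf

/-- The passage from `yh` to `y` to truncated `y` leaves three errors with separate fates: the first
vanishes in probability, the second is small in mean for large `M`, the third for small `β`. The 8
is made of a factor 2 from `1 / G = 2 / (2G)`, one from passing from contrasts to outcomes and one
from the square of a sum; `12 β` is `3 β` times the first two. -/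
theorem abs_pairVar_sub_clip_le {G : ℕ} (hG : 0 < G) (yh y : Fin (2 * G) → Bool → ℝ)
    (σ : Equiv.Perm (Fin (2 * G))) (s : Fin G → Bool) {M β : ℝ} (hM : 0 ≤ M) (hβ : 0 < β) :
    |pairVar (pairContrast yh σ s) - pairVar (pairContrast (fun g d => clip M (y g d)) σ s)|
      ≤ 8 * (3 / 2 + 3 / β) * (1 / (2 * (G : ℝ)) * ∑ g, ∑ d, (yh g d - y g d) ^ 2)
        + 8 * (3 / 2 + 3 / β) * (1 / (2 * (G : ℝ)) * ∑ g, ∑ d, (y g d - clip M (y g d)) ^ 2)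
        + 12 * β * (1 / (2 * (G : ℝ)) * ∑ g, ∑ d, y g d ^ 2) := by
  set Z : Fin (2 * G) → Bool → ℝ := fun g d => clip M (y g d) with hZd
  have e1 := abs_pairVar_sub_le (pairContrast yh σ s) (pairContrast Z σ s) hβ
  rw [Finset.sum_add_distrib, ← Finset.mul_sum, ← Finset.mul_sum] at e1
  have e2 := sum_pairContrast_sub_sq_le yh Z σ s
  have e3 := sum_pairContrast_sq_le Z σ s
  have e4 : ∑ g, ∑ d, (yh g d - Z g d) ^ 2 ≤
      2 * ∑ g, ∑ d, (yh g d - y g d) ^ 2 + 2 * ∑ g, ∑ d, (y g d - clip M (y g d)) ^ 2 := by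
    simp only [Finset.mul_sum, ← Finset.sum_add_distrib]
    refine Finset.sum_le_sum fun g _ => Finset.sum_le_sum fun d _ => ?_
    simp only [hZd]
    nlinarith [sq_nonneg ((yh g d - y g d) - (y g d - clip M (y g d)))]
  have e5 : ∑ g, ∑ d, Z g d ^ 2 ≤ ∑ g, ∑ d, y g d ^ 2 :=
    Finset.sum_le_sum fun g _ => Finset.sum_le_sum fun d _ => sq_clip_le hM _
  refine e1.trans ?_
  have h1 : 1 / (G : ℝ) = 2 * (1 / (2 * (G : ℝ))) := by field_simp
  have h2 : 0 ≤ 1 / (2 * (G : ℝ)) := by positivity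
  rw [h1]
  generalize 1 / (2 * (G : ℝ)) = w at h2 ⊢
  have h3 : 0 ≤ 3 / 2 + 3 / β := by positivity
  have h4 := mul_le_mul_of_nonneg_left (e2.trans (mul_le_mul_of_nonneg_left e4 zero_le_two)) h3
  have h5 := mul_le_mul_of_nonneg_left (e3.trans (mul_le_mul_of_nonneg_left e5 zero_le_two))
    (by positivity : 0 ≤ 3 * β)
  refine (mul_le_mul_of_nonneg_left (add_le_add h4 h5) (by positivity : 0 ≤ 2 * w)).trans
    (le_of_eq ?_)
  ring

/-- Consistency of `pairVar` for outcomes that are close to i.i.d. outcomes `y`, when the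
conditional means of `y` are close within the pairs and the pairs of pairs. -/
theorem tendstoInProb_pairVar (h : ∀ G, IsPairedSample (P G) Q (x G) (s G))
    {V : 𝓧 → E} (hV : Measurable V) {p : ∀ G, (Fin (2 * G) → E) → Equiv.Perm (Fin (2 * G))}
    (hp : ∀ G σ, MeasurableSet (p G ⁻¹' {σ})) {y : 𝓧 → Bool → ℝ} (hy : Measurable y)
    (hyL : ∀ d, MemLp (fun t => y t d) 2 Q) {μ : E → Bool → ℝ}
    (hμ : ∀ d, Q[fun t => y t d | sigma V] =ᵐ[Q] fun t => μ (V t) d)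
    (hpair : TendstoInProb P (fun G ω => 1 / (G : ℝ) *
      pairGap (fun g => μ (V (x G ω g))) (p G fun g => V (x G ω g))) 0)
    (hquad : TendstoInProb P (fun G ω => 1 / (G : ℝ) *
      quadGap (fun g => μ (V (x G ω g))) (p G fun g => V (x G ω g))) 0)
    {yhat : ∀ G, Ω G → Fin (2 * G) → Bool → ℝ}
    (hyhat : TendstoInProb P (fun G ω => 1 / (2 * (G : ℝ)) *
      ∑ g, ∑ d, (yhat G ω g d - y (x G ω g) d) ^ 2) 0) :
    TendstoInProb P (fun G ω => pairVar (pairContrast (yhat G ω) (p G fun g => V (x G ω g)) (s G ω)))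
      ((∫ t, y t true ^ 2 ∂Q) + (∫ t, y t false ^ 2 ∂Q)
        - 1 / 2 * ∫ t, (μ (V t) true + μ (V t) false) ^ 2 ∂Q) := by
  refine tendstoInProb_of_approx fun η hη => ?_
  set κ := condDistrib y V Q with hκ
  set A := ∑ d, ∫ t, y t d ^ 2 ∂Q with hA
  set B := ∫ t, (μ (V t) true + μ (V t) false) ^ 2 ∂Q with hB
  have hA0 : 0 ≤ A := Finset.sum_nonneg fun d _ => integral_nonneg fun _ => sq_nonneg _
  have hB0 : 0 ≤ B := integral_nonneg fun _ => sq_nonneg _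
  -- Order of choices: `β` depends on `η` and the second moments, `K` on `β`, and the truncation
  -- level `M` on both. This `β` gives `12 β A ≤ η / 2`; then `M` makes every multiple of the
  -- truncation error `r` that occurs less than `η / 2`.
  set β := η / (24 * (A + B + 1)) with hβd
  have hβ : 0 < β := by positivity
  have hβA : β * (A + B) ≤ η / 24 := by
    rw [hβd, div_mul_eq_mul_div, div_le_div_iff₀ (by positivity) (by norm_num)]
    nlinarith
  set K := 8 * (3 / 2 + 3 / β) with hK
  have hK0 : 0 < K := by positivity
  have hr : Tendsto (fun n : ℕ => (K + 18 + (3 + 6 / β)) * ∑ d, ∫ t, (y t d - clip n (y t d)) ^ 2 ∂Q)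
      atTop (𝓝 0) := by
    have := (tendsto_finsetSum (Finset.univ : Finset Bool) fun d _ =>
      tendsto_integral_sq_sub_clip (hyL d)).const_mul (K + 18 + (3 + 6 / β))
    simpa using this
  obtain ⟨M, hMr⟩ := (hr.eventually (gt_mem_nhds (half_pos hη))).exists
  have hM : (0 : ℝ) ≤ M := M.cast_nonneg
  set r := ∑ d, ∫ t, (y t d - clip M (y t d)) ^ 2 ∂Q with hrdef
  have hr0 : 0 ≤ r := Finset.sum_nonneg fun d _ => integral_nonneg fun _ => sq_nonneg _
  have hyd : ∀ d, Measurable fun t => y t d := fun d => (measurable_pi_apply d).comp hy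
  set m : E → Bool → ℝ := fun v d => condMeanAt κ (clip M) v d with hm
  set q : E → Bool → ℝ := fun v d => condMeanAt κ (fun t => clip M t ^ 2) v d with hq
  have hmM : ∀ v d, |m v d| ≤ M := fun v d => abs_condMeanAt_le κ (abs_clip_le hM) v d
  have hqM : ∀ v d, |q v d| ≤ (M : ℝ) ^ 2 := fun v d =>
    abs_condMeanAt_le κ (f := fun t => clip M t ^ 2)
      (fun t => by rw [abs_pow]; exact pow_le_pow_left₀ (abs_nonneg _) (abs_clip_le hM t) 2) v d
  have hmm : ∀ d, Measurable fun v => m v d := fun d => measurable_condMeanAt κ (measurable_clip M) d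
  have hqm : ∀ d, Measurable fun v => q v d := fun d =>
    measurable_condMeanAt κ ((measurable_clip M).pow_const 2) d
  set ψ : 𝓧 → ℝ := fun t => q (V t) true + q (V t) false - 1 / 2 * (m (V t) true + m (V t) false) ^ 2
    with hψ
  have hψm : Measurable ψ := (((hqm true).comp hV).add ((hqm false).comp hV)).sub
    (((((hmm true).comp hV).add ((hmm false).comp hV)).pow_const 2).const_mul _)
  have hψb : ∀ t, |ψ t| ≤ 4 * (M : ℝ) ^ 2 := fun t => by
    have h1 := abs_le.1 (hqM (V t) true)
    have h2 := abs_le.1 (hqM (V t) false)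
    have h3 := abs_le.1 (hmM (V t) true)
    have h4 := abs_le.1 (hmM (V t) false)
    rw [abs_le]
    simp only [hψ]
    constructor <;> nlinarith [sq_nonneg (m (V t) true + m (V t) false)]
  have hlim := abs_integral_clip_sub_le hV hy hyL hμ hM hβ
  -- The function `ψ` of the matching variable is the idealized conditional mean per cluster, and it
  -- is bounded thanks to the truncation.
  have hX4 := tendstoInProb_average h hψm (memLp_two_of_abs_le hψm hψb)
  have hX2 : TendstoInProb P (fun G ω =>
      pairVar (pairContrast (fun g d => clip M (y (x G ω g) d)) (p G fun g => V (x G ω g)) (s G ω))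
      - meanPairVar (fun g d => m (V (x G ω g)) d) (fun g d => q (V (x G ω g)) d)
        (p G fun g => V (x G ω g))) 0 := by
    refine tendstoInProb_of_sq (C := 64 * (M : ℝ) ^ 4) (T := fun G ω => centeredPairVar κ M (p G)
      (fun g => (V (x G ω g), y (x G ω g)), s G ω)) (fun G => ?_) ?_
    · have h1 : Measurable fun ω => ((fun g => (V (x G ω g), y (x G ω g))), s G ω) :=
        (measurable_pi_lambda _ fun g => ((hV.prodMk hy).comp
          ((measurable_pi_apply g).comp (h G).measurable_x))).prodMk (h G).measurable_s
      exact ((measurable_centeredPairVar κ M (hp G)).comp h1).aemeasurable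
    · filter_upwards [eventually_gt_atTop 0] with G hG
      simpa only [sub_zero] using (h G).lintegral_sq_centeredPairVar_le hG hV (hp G) hy hM
  have hX4' : TendstoInProb P (fun G ω => |1 / (2 * (G : ℝ)) * ∑ g, ψ (x G ω g) - ∫ t, ψ t ∂Q|) 0 := by
    have := hX4.map₂ hX4 (f := fun z => |z.1 - ∫ t, ψ t ∂Q|) (by fun_prop)
    simpa using this
  -- Collects the errors that do not vanish as `G` grows. Its mean is at most `(K + 18) r + 12 β A ≤
  -- η`; the last summand is bounded in mean by `r` because conditional expectation contracts.
  set f : 𝓧 → ℝ := fun t => K * ∑ d, (y t d - clip M (y t d)) ^ 2 + 12 * β * ∑ d, y t d ^ 2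
    + 18 * ∑ d, (m (V t) d - μ (V t) d) ^ 2 with hf
  have hZ : ∀ d, MemLp (fun t => clip M (y t d)) 2 Q := fun d => memLp_clip (hyd d) hM
  have hmL := fun d => integral_sq_condMeanAt_sub_le hV hy (hyL d) (hμ d) hM
  have hi1 : ∀ d, Integrable (fun t => (y t d - clip M (y t d)) ^ 2) Q := fun d =>
    ((hyL d).sub (hZ d)).integrable_sq
  have hf1 : Integrable (fun t => ∑ d, (y t d - clip M (y t d)) ^ 2) Q :=
    integrable_finsetSum _ fun d _ => hi1 d
  have hf2 : Integrable (fun t => ∑ d, y t d ^ 2) Q :=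
    integrable_finsetSum _ fun d _ => (hyL d).integrable_sq
  have hf3 : Integrable (fun t => ∑ d, (m (V t) d - μ (V t) d) ^ 2) Q :=
    integrable_finsetSum _ fun d _ => (hmL d).1.integrable_sq
  have hf12 : Integrable (fun t => K * ∑ d, (y t d - clip M (y t d)) ^ 2
    + 12 * β * ∑ d, y t d ^ 2) Q := (hf1.const_mul _).add (hf2.const_mul _)
  have hfi : Integrable f Q := hf12.add (hf3.const_mul _)
  have hfη : ∫ t, f t ∂Q ≤ K * r + 12 * β * A + 18 * r := by
    simp only [hf]
    rw [integral_add hf12 (hf3.const_mul _), integral_add (hf1.const_mul _) (hf2.const_mul _),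
      integral_const_mul, integral_const_mul, integral_const_mul,
      integral_finsetSum _ fun d _ => hi1 d,
      integral_finsetSum _ fun d _ => (hyL d).integrable_sq,
      integral_finsetSum _ fun d _ => (hmL d).1.integrable_sq]
    have := Finset.sum_le_sum fun d (_ : d ∈ (Finset.univ : Finset Bool)) => (hmL d).2
    linarith
  refine ⟨fun G ω => K * (1 / (2 * (G : ℝ)) * ∑ g, ∑ d, (yhat G ω g d - y (x G ω g) d) ^ 2) +
      (|pairVar (pairContrast (fun g d => clip M (y (x G ω g) d)) (p G fun g => V (x G ω g)) (s G ω))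
      - meanPairVar (fun g d => m (V (x G ω g)) d) (fun g d => q (V (x G ω g)) d)
        (p G fun g => V (x G ω g))| +
      (6 * (1 / (G : ℝ) * pairGap (fun g => μ (V (x G ω g))) (p G fun g => V (x G ω g))) +
      (3 * (1 / (G : ℝ) * quadGap (fun g => μ (V (x G ω g))) (p G fun g => V (x G ω g))) +
      (2 * (M : ℝ) ^ 2 / G + |1 / (2 * (G : ℝ)) * ∑ g, ψ (x G ω g) - ∫ t, ψ t ∂Q|)))),
    fun G ω => 1 / (2 * (G : ℝ)) * ∑ g, f (x G ω g), ?_, ?_⟩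
  · exact (hyhat.const_mul K).add (hX2.abs.add ((hpair.const_mul 6).add ((hquad.const_mul 3).add
      ((tendstoInProb_const_div _).add hX4'))))
  filter_upwards [eventually_gt_atTop 0] with G hG
  have hG' : (0 : ℝ) < G := by exact_mod_cast hG
  have h6 : 6 / β * r = 6 * (r / β) := by ring
  refine ⟨(h G).integrable_average hfi, Eventually.of_forall fun ω => ?_, ?_,
    Eventually.of_forall fun ω => ?_⟩
  · simp only [Pi.zero_apply, hf]
    positivity
  · rw [(h G).integral_average hG hfi]
    have : 0 ≤ (3 + 6 / β) * r := by positivity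
    nlinarith [mul_nonneg hβ.le hB0]
  · set σ := p G fun g => V (x G ω g) with hσd
    set Z : Fin (2 * G) → Bool → ℝ := fun g d => clip M (y (x G ω g) d) with hZd
    have e6 := abs_meanPairVar_sub_le (fun g d => m (V (x G ω g)) d) (fun g d => q (V (x G ω g)) d)
      (fun g d => μ (V (x G ω g)) d) σ (fun g d => hmM _ _)
    have e7 := abs_pairVar_sub_clip_le hG (yhat G ω) (fun g d => y (x G ω g) d) σ (s G ω) hM hβ
    rw [← hK] at e7
    have e8 : 1 / (2 * (G : ℝ)) * ∑ g, f (x G ω g)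
        = K * (1 / (2 * (G : ℝ)) * ∑ g, ∑ d, (y (x G ω g) d - clip M (y (x G ω g) d)) ^ 2)
          + 12 * β * (1 / (2 * (G : ℝ)) * ∑ g, ∑ d, y (x G ω g) d ^ 2)
          + 18 * (1 / (2 * (G : ℝ)) * ∑ g, ∑ d, (m (V (x G ω g)) d - μ (V (x G ω g)) d) ^ 2) := by
      simp only [hf, Finset.sum_add_distrib, ← Finset.mul_sum]
      ring
    refine le_trans ?_ (add_le_add (add_le_add (le_abs_self _) le_rfl) le_rfl)
    have e9 : (3 + 6 / β) * r + β * (2 * A + B) ≤ η := by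
      have : 0 ≤ (K + 18) * r := by positivity
      nlinarith [mul_nonneg hβ.le hB0]
    have e10 := hlim.trans e9
    rw [e8]
    have t1 := abs_le.1 e7
    have t2 := abs_le.1 e6
    have t3 := abs_le.1 e10
    have t4 := abs_le.1 (le_refl |pairVar (pairContrast Z σ (s G ω))
      - meanPairVar (fun g d => m (V (x G ω g)) d) (fun g d => q (V (x G ω g)) d) σ|)
    have t5 := abs_le.1 (le_refl |1 / (2 * (G : ℝ)) * ∑ g, ψ (x G ω g) - ∫ t, ψ t ∂Q|)
    rw [abs_le]
    constructor <;> linarith [t1.1, t1.2, t2.1, t2.2, t3.1, t3.2, t4.1, t4.2, t5.1, t5.2]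

end Limit

/-! ### From the sampling and assignment assumptions to a paired sample -/

section DataLaw

theorem lintegral_pi_prod {ι α : Type*} [Fintype ι] [MeasurableSpace α] (χ : Measure α)
    [IsProbabilityMeasure χ] {h : ι → α → ENNReal} (hh : ∀ i, Measurable (h i)) :
    ∫⁻ v, ∏ i, h i (v i) ∂(Measure.pi fun _ : ι => χ) = ∏ i, ∫⁻ a, h i a ∂χ := by
  rw [lintegral_prod_eq_prod_lintegral_of_indepFun Finset.univ
    (fun i (v : ι → α) => h i (v i)) (iIndepFun_pi fun i => (hh i).aemeasurable)
    fun i => (hh i).comp (measurable_pi_apply i)]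
  refine Finset.prod_congr rfl fun i _ => ?_
  exact (measurePreserving_eval (fun _ : ι => χ) i).lintegral_comp (hh i)

/-- On a measurable box the product kernel factors into functions of single coordinates, whose
integral against the product measure factors again. -/
theorem map_compProd_pi {ι α β : Type*} [Fintype ι] [MeasurableSpace α] [MeasurableSpace β]
    (χ : Measure α) [IsProbabilityMeasure χ] (κ : Kernel α β) [IsMarkovKernel κ]
    (Κ : Kernel (ι → α) (ι → β)) [IsMarkovKernel Κ]
    (h : ∀ᵐ v ∂(Measure.pi fun _ : ι => χ), Κ v = Measure.pi fun i => κ (v i)) :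
    ((Measure.pi fun _ : ι => χ) ⊗ₘ Κ).map (fun p i => (p.1 i, p.2 i)) =
      Measure.pi fun _ : ι => χ ⊗ₘ κ := by
  symm
  refine Measure.pi_eq fun s hs => ?_
  have hm : Measurable fun p : (ι → α) × (ι → β) => fun i => (p.1 i, p.2 i) := by fun_prop
  rw [Measure.map_apply hm (.univ_pi hs), Measure.compProd_apply (hm (.univ_pi hs))]
  have h1 : ∀ᵐ v ∂(Measure.pi fun _ : ι => χ), Κ v (Prod.mk v ⁻¹'
      ((fun p : (ι → α) × (ι → β) => fun i => (p.1 i, p.2 i)) ⁻¹' Set.univ.pi s)) =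
      ∏ i, κ (v i) (Prod.mk (v i) ⁻¹' s i) := by
    filter_upwards [h] with v hv
    rw [hv, ← Measure.pi_pi]
    congr 1
  rw [lintegral_congr_ae h1, lintegral_pi_prod χ fun i => Kernel.measurable_kernel_prodMk_left (hs i)]
  exact Finset.prod_congr rfl fun i _ => (Measure.compProd_apply (hs i)).symm

/-- Independent characteristics together with outcomes that are conditionally a product make the
complete cluster data i.i.d., with the law of the generic cluster. -/
theorem map_condDistrib_pi {ι Ω Ω₀ α β : Type*} [Fintype ι] [MeasurableSpace Ω]
    [MeasurableSpace Ω₀] [MeasurableSpace α] [MeasurableSpace β] [StandardBorelSpace β]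
    [Nonempty β] [StandardBorelSpace (ι → β)] {P : Measure Ω} [IsProbabilityMeasure P]
    {P₀ : Measure Ω₀} [IsProbabilityMeasure P₀] {a : ι → Ω → α} {b : ι → Ω → β}
    (hb : ∀ i, Measurable (b i))
    {a₀ : Ω₀ → α} {b₀ : Ω₀ → β} (hb₀ : Measurable b₀) (hind : iIndepFun a P)
    (hid : ∀ i, IdentDistrib (a i) a₀ P P₀)
    (h : ∀ᵐ v ∂(P.map fun ω i => a i ω),
      condDistrib (fun ω i => b i ω) (fun ω i => a i ω) P v =
        Measure.pi fun i => condDistrib b₀ a₀ P₀ (v i)) :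
    P.map (fun ω i => (a i ω, b i ω)) = Measure.pi fun _ => P₀.map fun ω => (a₀ ω, b₀ ω) := by
  have hpi : P.map (fun ω i => a i ω) = Measure.pi fun _ => P₀.map a₀ := by
    rw [hind.map_fun_eq_pi_map fun i => (hid i).aemeasurable_fst]
    exact congrArg _ (funext fun i => (hid i).map_eq)
  have hbm : Measurable fun ω i => b i ω := measurable_pi_lambda _ hb
  have ham : AEMeasurable (fun ω i => a i ω) P :=
    aemeasurable_pi_lambda _ fun i => (hid i).aemeasurable_fst
  by_cases hι : Nonempty ι
  · obtain ⟨i₀⟩ := hι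
    have ha₀ : AEMeasurable a₀ P₀ := (hid i₀).aemeasurable_snd
    have : IsProbabilityMeasure (P₀.map a₀) := Measure.isProbabilityMeasure_map ha₀
    rw [hpi] at h
    have key := map_compProd_pi (P₀.map a₀) (condDistrib b₀ a₀ P₀)
      (condDistrib (fun ω i => b i ω) (fun ω i => a i ω) P) h
    rw [compProd_map_condDistrib hb₀.aemeasurable, ← hpi,
      compProd_map_condDistrib hbm.aemeasurable] at key
    rw [← key, AEMeasurable.map_map_of_aemeasurable (by fun_prop) (ham.prodMk hbm.aemeasurable)]
    rfl
  -- Without indices `hid` carries no information about `a₀`; both sides are the point mass at the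
  -- only function on the empty type.
  · have : IsEmpty ι := not_nonempty_iff.mp hι
    have hm : Measurable fun ω i => (a i ω, b i ω) := measurable_pi_lambda _ fun i => isEmptyElim i
    rw [Measure.pi_of_empty (x := fun i => isEmptyElim i)]
    have : (fun ω i => (a i ω, b i ω)) = fun _ : Ω => fun i : ι => isEmptyElim i :=
      funext fun _ => funext fun i => isEmptyElim i
    rw [this, Measure.map_const]
    simp

theorem integral_condExp_indicator {Ω : Type*} {m m₀ : MeasurableSpace Ω} {P : Measure Ω}
    [IsProbabilityMeasure P] (hm : m ≤ m₀) {s A : Set Ω} (hs : MeasurableSet[m] s)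
    (hA : MeasurableSet A) : ∫ ω in s, (P⟦A | m⟧) ω ∂P = P.real (A ∩ s) := by
  rw [setIntegral_condExp hm ((integrable_const _).indicator hA) hs, integral_indicator hA,
    setIntegral_const, smul_eq_mul, mul_one, measureReal_restrict_apply hA]

variable {G : ℕ} {Ω α E : Type*} [MeasurableSpace Ω] [MeasurableSpace α] [MeasurableSpace E]
  {P : Measure Ω} [IsProbabilityMeasure P] {f : Ω → α} {V : Ω → E}
  {D : Fin (2 * G) → Ω → Bool} {p : E → Equiv.Perm (Fin (2 * G))}

theorem measurable_treatedSnd (hV : Measurable V) (hD : ∀ g, Measurable (D g))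
    (hp : ∀ σ, MeasurableSet (p ⁻¹' {σ})) (q : Fin G → Fin (2 * G)) :
    Measurable fun ω j => D (p (V ω) (q j)) ω :=
  measurable_pi_lambda _ fun j =>
    measurable_of_perm (f := fun σ ω => D (σ (q j)) ω) (fun _ => hD _)
      (τ := fun ω => p (V ω)) fun _ => hV (hp _)

theorem measurableSet_treatmentPattern (hV : Measurable V) (hD : ∀ g, Measurable (D g))
    (hp : ∀ σ, MeasurableSet (p ⁻¹' {σ})) (e : Fin G → Bool × Bool) :
    MeasurableSet {ω | ∀ j, (D (p (V ω) (fstPos j)) ω, D (p (V ω) (sndPos j)) ω) = e j} := by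
  have h := ((measurable_treatedSnd hV hD hp fstPos).prodMk
    (measurable_treatedSnd hV hD hp sndPos)) (measurableSet_singleton
      ((fun j => (e j).1), fun j => (e j).2))
  convert h using 1
  ext ω
  simp [Prod.ext_iff, funext_iff, forall_and]

/-- A treatment pattern in which some pair is not split has conditional probability zero, and there
are only finitely many patterns. -/
theorem ae_fst_eq_not_snd (hV : Measurable V) (hD : ∀ g, Measurable (D g))
    (hp : ∀ σ, MeasurableSet (p ⁻¹' {σ}))
    (hu : UniformWithinPairs D (fun ω => p (V ω)) P V) :
    ∀ᵐ ω ∂P, ∀ j, D (p (V ω) (fstPos j)) ω = !D (p (V ω) (sndPos j)) ω := by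
  have h : ∀ᵐ ω ∂P, ∀ e : Fin G → Bool × Bool, (∃ j, (e j).1 ≠ !(e j).2) →
      ¬ ∀ j, (D (p (V ω) (fstPos j)) ω, D (p (V ω) (sndPos j)) ω) = e j := by
    rw [ae_all_iff]
    intro e
    by_cases he : ∃ j, (e j).1 ≠ !(e j).2
    · have h0 := integral_condExp_indicator (P := P) hV.comap_le MeasurableSet.univ
        (measurableSet_treatmentPattern hV hD hp e)
      rw [setIntegral_univ, integral_congr_ae (hu e), Set.inter_univ] at h0
      obtain ⟨j, hj⟩ := he
      rw [Finset.prod_eq_zero (Finset.mem_univ j)] at h0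
      · simp only [integral_zero] at h0
        have h1 := (measureReal_eq_zero_iff (by finiteness)).mp h0.symm
        filter_upwards [measure_eq_zero_iff_ae_notMem.mp h1] with ω hω _
        exact hω
      · rw [if_neg]
        rintro (h | h) <;> simp [h] at hj
    · exact Eventually.of_forall fun ω h => absurd h he
  filter_upwards [h] with ω hω j
  by_contra hne
  exact hω _ ⟨j, hne⟩ fun _ => rfl

/-- The assignment law is given along the random pairing, whereas conditional independence concerns
`D` indexed by cluster. On the event `p (V ω) = σ`, which is known given `V`, the two descriptions
of a pattern coincide, and so do their conditional probabilities. -/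
theorem condExp_treatmentPattern_restrict (hV : Measurable V) (hD : ∀ g, Measurable (D g))
    (hp : ∀ σ, MeasurableSet (p ⁻¹' {σ}))
    (hu : UniformWithinPairs D (fun ω => p (V ω)) P V) (e : Fin G → Bool)
    (σ : Equiv.Perm (Fin (2 * G))) :
    ∀ᵐ ω ∂P, p (V ω) = σ → (P⟦(fun ω g => D g ω) ⁻¹' {t | ∀ j, (t (σ (fstPos j)),
      t (σ (sndPos j))) = (!e j, e j)} | sigma V⟧) ω = (1 / 2) ^ G := by
  set S := {ω | ∀ j, (D (p (V ω) (fstPos j)) ω, D (p (V ω) (sndPos j)) ω) = (!e j, e j)} with hS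
  set T := (fun ω g => D g ω) ⁻¹' {t | ∀ j, (t (σ (fstPos j)), t (σ (sndPos j))) = (!e j, e j)}
    with hT
  have hSm : MeasurableSet S := measurableSet_treatmentPattern hV hD hp _
  have hTm : MeasurableSet T := measurable_pi_lambda _ hD (Set.toFinite _).measurableSet
  set B := V ⁻¹' (p ⁻¹' {σ}) with hB
  have hBm : MeasurableSet[sigma V] B := ⟨_, hp σ, rfl⟩
  have hBT : B.indicator (T.indicator fun _ => (1 : ℝ)) = B.indicator (S.indicator fun _ => 1) := by
    ext ω
    by_cases hω : ω ∈ B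
    · have hσ : p (V ω) = σ := hω
      rw [Set.indicator_of_mem hω, Set.indicator_of_mem hω]
      have : ω ∈ T ↔ ω ∈ S := by simp [hT, hS, hσ]
      simp only [Set.indicator, this]
    · rw [Set.indicator_of_notMem hω, Set.indicator_of_notMem hω]
  have h1 := condExp_indicator (μ := P) (m := sigma V)
    ((integrable_const (1 : ℝ)).indicator hTm) hBm
  have h2 := condExp_indicator (μ := P) (m := sigma V)
    ((integrable_const (1 : ℝ)).indicator hSm) hBm
  rw [hBT] at h1
  filter_upwards [h1, h2, hu fun j => (!e j, e j)] with ω h1 h2 hu hω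
  have hmem : ω ∈ B := hω
  rw [h1, Set.indicator_of_mem hmem, Set.indicator_of_mem hmem] at h2
  rw [h2, hu]
  have hone : ∀ j, (if (!e j, e j) = (false, true) ∨ (!e j, e j) = (true, false)
      then (1 / 2 : ℝ) else 0) = 1 / 2 := fun j => by cases e j <;> simp
  simp only [hone, Finset.prod_const, Finset.card_univ, Fintype.card_fin]

/-- Conditional independence is used on each event where the pairing is a fixed `σ`, and the results
are summed over `σ`. The conditional probability of a pattern is the constant `(1 / 2) ^ G`, free of
`V`, which upgrades conditional to unconditional independence. -/
theorem measureReal_inter_treatmentPattern (hf : Measurable f) (hV : Measurable V)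
    (hD : ∀ g, Measurable (D g)) (hp : ∀ σ, MeasurableSet (p ⁻¹' {σ}))
    (hci : CondIndepGiven P V f fun ω g => D g ω)
    (hu : UniformWithinPairs D (fun ω => p (V ω)) P V) (e : Fin G → Bool) {A : Set α}
    (hA : MeasurableSet A) {B : Set E} (hB : MeasurableSet B) :
    P.real ((f ⁻¹' A ∩ V ⁻¹' B) ∩
      {ω | ∀ j, (D (p (V ω) (fstPos j)) ω, D (p (V ω) (sndPos j)) ω) = (!e j, e j)}) =
      (1 / 2) ^ G * P.real (f ⁻¹' A ∩ V ⁻¹' B) := by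
  have hσ : ∀ σ, P.real (((f ⁻¹' A ∩ V ⁻¹' B) ∩
      {ω | ∀ j, (D (p (V ω) (fstPos j)) ω, D (p (V ω) (sndPos j)) ω) = (!e j, e j)}) ∩
        {ω | p (V ω) = σ}) =
      (1 / 2) ^ G * P.real ((f ⁻¹' A ∩ V ⁻¹' B) ∩ {ω | p (V ω) = σ}) := by
    intro σ
    set t : Set (Fin (2 * G) → Bool) :=
      {t | ∀ j, (t (σ (fstPos j)), t (σ (sndPos j))) = (!e j, e j)} with ht
    have htm : MeasurableSet t := (Set.toFinite _).measurableSet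
    have hTm : MeasurableSet ((fun ω g => D g ω) ⁻¹' t) := measurable_pi_lambda _ hD htm
    have hBm : MeasurableSet[sigma V] (V ⁻¹' (B ∩ p ⁻¹' {σ})) := ⟨_, hB.inter (hp σ), rfl⟩
    have e1 : ((f ⁻¹' A ∩ V ⁻¹' B) ∩
        {ω | ∀ j, (D (p (V ω) (fstPos j)) ω, D (p (V ω) (sndPos j)) ω) = (!e j, e j)}) ∩
        {ω | p (V ω) = σ} = (f ⁻¹' A ∩ (fun ω g => D g ω) ⁻¹' t) ∩ V ⁻¹' (B ∩ p ⁻¹' {σ}) := by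
      ext ω
      simp only [Set.mem_inter_iff, Set.mem_preimage, Set.mem_ofPred_eq, Set.mem_singleton_iff, ht]
      constructor
      · rintro ⟨⟨⟨h1, h2⟩, h3⟩, h4⟩
        rw [h4] at h3
        exact ⟨⟨h1, h3⟩, h2, h4⟩
      · rintro ⟨⟨h1, h3⟩, h2, h4⟩
        rw [h4]
        exact ⟨⟨⟨h1, h2⟩, h3⟩, rfl⟩
    have e2 : (f ⁻¹' A ∩ V ⁻¹' B) ∩ {ω | p (V ω) = σ} = f ⁻¹' A ∩ V ⁻¹' (B ∩ p ⁻¹' {σ}) := by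
      ext ω
      simp [and_assoc]
    rw [e1, e2, ← integral_condExp_indicator hV.comap_le hBm ((hf hA).inter hTm),
      ← integral_condExp_indicator hV.comap_le hBm (hf hA), ← integral_const_mul]
    refine setIntegral_congr_ae (hV.comap_le _ hBm) ?_
    filter_upwards [hci A t hA htm, condExp_treatmentPattern_restrict hV hD hp hu e σ]
      with ω h1 h2 hω
    rw [h1, Pi.mul_apply, h2 hω.2, mul_comm]
  have hsum : ∀ s : Set Ω, MeasurableSet s →
      P.real s = ∑ σ, P.real (s ∩ {ω | p (V ω) = σ}) := by
    intro s hs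
    rw [← measureReal_biUnion_finset]
    · congr 1
      ext ω
      simp
    · intro σ _ τ _ hne
      refine Set.disjoint_left.mpr fun ω h1 h2 => hne ?_
      exact h1.2.symm.trans h2.2
    · exact fun σ _ => hs.inter (hV (hp σ))
  have hm := (hf hA).inter (hV hB)
  rw [hsum _ (hm.inter (measurableSet_treatmentPattern hV hD hp _)), hsum _ hm, Finset.mul_sum]
  exact Finset.sum_congr rfl fun σ _ => hσ σ

theorem pi_coin_singleton (e : Fin G → Bool) :
    (Measure.pi fun _ : Fin G => coin) {e} = 2⁻¹ ^ G := by
  rw [Measure.pi_singleton]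
  simp

/-- The coin of a pair is the treatment of its second member; almost surely the first member has the
opposite treatment, so a coin sequence determines the whole pattern. It suffices to compare the
measures on boxes, and on single coin sequences. -/
theorem map_prod_coin (hf : Measurable f) (hV : Measurable V)
    (hD : ∀ g, Measurable (D g)) (hp : ∀ σ, MeasurableSet (p ⁻¹' {σ}))
    (hci : CondIndepGiven P V f fun ω g => D g ω)
    (hu : UniformWithinPairs D (fun ω => p (V ω)) P V) :
    P.map (fun ω => ((f ω, V ω), fun j => D (p (V ω) (sndPos j)) ω)) =
      (P.map fun ω => (f ω, V ω)).prod (Measure.pi fun _ : Fin G => coin) := by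
  have hs := measurable_treatedSnd hV hD hp sndPos
  have hfV := hf.prodMk hV
  have : IsProbabilityMeasure (P.map fun ω => (f ω, V ω)) :=
    Measure.isProbabilityMeasure_map hfV.aemeasurable
  have : IsProbabilityMeasure (P.map (fun ω => ((f ω, V ω), fun j => D (p (V ω) (sndPos j)) ω))) :=
    Measure.isProbabilityMeasure_map (hfV.prodMk hs).aemeasurable
  refine Measure.ext_prod₃' fun {A B T} hA hB hT => ?_
  rw [Measure.prod_prod, Measure.map_apply (hfV.prodMk hs) ((hA.prod hB).prod hT),
    Measure.map_apply hfV (hA.prod hB)]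
  have hm := (hf hA).inter (hV hB)
  have key : (P.restrict (f ⁻¹' A ∩ V ⁻¹' B)).map (fun ω j => D (p (V ω) (sndPos j)) ω) =
      P (f ⁻¹' A ∩ V ⁻¹' B) • (Measure.pi fun _ : Fin G => coin) := by
    refine Measure.ext_of_singleton fun e => ?_
    rw [Measure.map_apply hs (measurableSet_singleton e),
      Measure.restrict_apply (hs (measurableSet_singleton e)), Measure.smul_apply,
      pi_coin_singleton, smul_eq_mul]
    have h1 := measureReal_inter_treatmentPattern hf hV hD hp hci hu e hA hB
    have h2 : P ((fun ω j => D (p (V ω) (sndPos j)) ω) ⁻¹' {e} ∩ (f ⁻¹' A ∩ V ⁻¹' B)) =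
        P ((f ⁻¹' A ∩ V ⁻¹' B) ∩
      {ω | ∀ j, (D (p (V ω) (fstPos j)) ω, D (p (V ω) (sndPos j)) ω) = (!e j, e j)}) := by
      refine measure_congr ?_
      filter_upwards [ae_fst_eq_not_snd hV hD hp hu] with ω hω
      refine propext ?_
      change (_ ∧ _) ↔ (_ ∧ _)
      rw [and_comm]
      refine and_congr_right fun _ => ?_
      change (fun j => D (p (V ω) (sndPos j)) ω) = e ↔
        ∀ j, (D (p (V ω) (fstPos j)) ω, D (p (V ω) (sndPos j)) ω) = (!e j, e j)
      simp only [funext_iff, hω, Prod.mk.injEq]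
      exact forall_congr' fun j => ⟨fun h => ⟨by rw [h], h⟩, fun h => h.2⟩
    rw [h2, ← ENNReal.toReal_eq_toReal_iff' (by finiteness) (by finiteness)]
    refine Eq.trans h1 ?_
    rw [ENNReal.toReal_mul, mul_comm ((1 / 2 : ℝ) ^ G), measureReal_def]
    simp
  have h3 := congrArg (fun m => m T) key
  simp only [Measure.map_apply hs hT, Measure.restrict_apply (hs hT), Measure.smul_apply,
    smul_eq_mul] at h3
  have e1 : (fun ω => ((f ω, V ω), fun j => D (p (V ω) (sndPos j)) ω)) ⁻¹' (A ×ˢ B) ×ˢ T =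
      (fun ω j => D (p (V ω) (sndPos j)) ω) ⁻¹' T ∩ (f ⁻¹' A ∩ V ⁻¹' B) := by
    ext ω
    simp [and_comm]
  rw [e1, h3]
  rfl

theorem isPairedSample_of_map {𝓧 : Type*} [MeasurableSpace 𝓧] {Q : Measure 𝓧}
    [IsProbabilityMeasure Q] (hf : Measurable f) (hV : Measurable V)
    (hD : ∀ g, Measurable (D g)) (hp : ∀ σ, MeasurableSet (p ⁻¹' {σ}))
    (hci : CondIndepGiven P V f fun ω g => D g ω)
    (hu : UniformWithinPairs D (fun ω => p (V ω)) P V) {Φ : α × E → Fin (2 * G) → 𝓧}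
    (hΦ : Measurable Φ) {x : Ω → Fin (2 * G) → 𝓧} (hx : ∀ ω, x ω = Φ (f ω, V ω))
    (hlaw : P.map x = Measure.pi fun _ => Q) :
    IsPairedSample P Q x fun ω j => D (p (V ω) (sndPos j)) ω := by
  have hs := measurable_treatedSnd hV hD hp sndPos
  have hfV := hf.prodMk hV
  have hx' : x = fun ω => Φ (f ω, V ω) := funext hx
  have hxm : Measurable x := hx' ▸ hΦ.comp hfV
  refine ⟨hxm, hs, ?_⟩
  have h := congrArg (fun m => m.map (Prod.map Φ (id : (Fin G → Bool) → _)))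
    (map_prod_coin hf hV hD hp hci hu)
  have : IsProbabilityMeasure (P.map fun ω => (f ω, V ω)) :=
    Measure.isProbabilityMeasure_map hfV.aemeasurable
  rw [Measure.map_map (hΦ.prodMap measurable_id) (hfV.prodMk hs),
    ← Measure.map_prod_map _ _ hΦ measurable_id, Measure.map_map hΦ hfV, Measure.map_id] at h
  rw [← hlaw, hx']
  exact h

end DataLaw

/-! ### The full data of a cluster -/

section ClusterData

variable {k : ℕ} {Ω Ω₀ : Type*} [MeasurableSpace Ω] [MeasurableSpace Ω₀]

/-- Values of the full data `((S_g, X_g, N_g), Y_g)` of a cluster. -/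
abbrev ClusterData (k : ℕ) := (Finset ℕ × Cov k × ℕ) × (ℕ → Bool → ℝ)

namespace ClusterData

/-- The size. -/
def size (t : ClusterData k) : ℝ := (t.1.2.2 : ℝ)

/-- The covariates. -/
def cov (t : ClusterData k) : Cov k := t.1.2.1

/-- Size and covariates. -/
noncomputable def covSize (t : ClusterData k) : CovSize k := WithLp.toLp 2 (t.size, t.cov)

/-- The mean of the potential outcomes of the sampled units. -/
noncomputable def mean (t : ClusterData k) (d : Bool) : ℝ :=
  (1 / (t.1.1.card : ℝ)) * ∑ i ∈ t.1.1, t.2 i d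

theorem measurable_size : Measurable (size (k := k)) :=
  (measurable_of_countable (fun n : ℕ => (n : ℝ))).comp
    (measurable_snd.comp (measurable_snd.comp measurable_fst))

theorem measurable_cov : Measurable (cov (k := k)) :=
  measurable_fst.comp (measurable_snd.comp measurable_fst)

theorem measurable_covSize : Measurable (covSize (k := k)) :=
  (WithLp.measurable_toLp 2 _).comp (measurable_size.prodMk measurable_cov)

theorem measurable_mean (d : Bool) : Measurable fun t : ClusterData k => t.mean d := by
  have hi : ∀ i : ℕ, Measurable fun y : ℕ → Bool → ℝ => y i d := fun i =>
    (measurable_pi_apply d).comp (measurable_pi_apply i)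
  have hs : ∀ s : Finset ℕ, Measurable fun y : ℕ → Bool → ℝ =>
      (1 / (s.card : ℝ)) * ∑ i ∈ s, y i d := fun s =>
    (Finset.measurable_fun_sum s fun i _ => hi i).const_mul _
  have h : Measurable (Function.uncurry fun (s : Finset ℕ) (y : ℕ → Bool → ℝ) =>
      (1 / (s.card : ℝ)) * ∑ i ∈ s, y i d) :=
    measurable_from_prod_countable_right hs
  have hp : Measurable fun t : ClusterData k => (t.1.1, t.2) :=
    (measurable_fst.comp measurable_fst).prodMk measurable_snd
  have e : (fun t : ClusterData k => t.mean d) =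
      (Function.uncurry fun (s : Finset ℕ) (y : ℕ → Bool → ℝ) =>
      (1 / (s.card : ℝ)) * ∑ i ∈ s, y i d) ∘ fun t => (t.1.1, t.2) := by
    funext t
    simp [mean]
  rw [e]
  exact h.comp hp

end ClusterData

/-- The full data of a cluster. -/
def Cluster.data (c : Cluster k Ω) (ω : Ω) : ClusterData k := (c.char ω, c.Y ω)

theorem Cluster.measurable_char (c : Cluster k Ω) : Measurable c.char :=
  c.measurable_S.prodMk (c.measurable_X.prodMk c.measurable_N)

theorem Cluster.measurable_data (c : Cluster k Ω) : Measurable c.data :=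
  c.measurable_char.prodMk c.measurable_Y

variable {Ω : ℕ → Type*} [∀ G, MeasurableSpace (Ω G)] {P₀ : Measure Ω₀} [IsProbabilityMeasure P₀]
  {c : Cluster k Ω₀} {P : ∀ G, Measure (Ω G)} [∀ G, IsProbabilityMeasure (P G)]
  {C : ∀ G, Fin (2 * G) → Cluster k (Ω G)} {D : ∀ G, Fin (2 * G) → Ω G → Bool}

theorem SamplingAssumption.map_data (hQ : SamplingAssumption P₀ c P C) (G : ℕ) :
    (P G).map (fun ω g => (C G g).data ω) = Measure.pi fun _ => P₀.map c.data :=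
  map_condDistrib_pi (fun g => (C G g).measurable_Y) c.measurable_Y (hQ.indep_char G)
    (hQ.ident_char G) (hQ.cond_law G)

instance isProbabilityMeasure_map_data : IsProbabilityMeasure (P₀.map c.data) :=
  Measure.isProbabilityMeasure_map c.measurable_data.aemeasurable

theorem Cluster.measurable_W (c : Cluster k Ω₀) : Measurable c.W :=
  ClusterData.measurable_covSize.comp c.measurable_data

theorem isPairedSample_onX (hQ : SamplingAssumption P₀ c P C) (hD : ∀ G g, Measurable (D G g))
    (π : MatchingRule (Cov k)) (hA : AssignmentX P C D (π.onX C)) (G : ℕ) :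
    IsPairedSample (P G) (P₀.map c.data) (fun ω g => (C G g).data ω)
      fun ω j => D G (π.onX C G ω (sndPos j)) ω := by
  refine isPairedSample_of_map (V := fun ω g => (C G g).X ω)
    (measurable_pi_lambda _ fun g =>
      (C G g).measurable_Y.prodMk ((C G g).measurable_N.prodMk (C G g).measurable_S))
    (measurable_pi_lambda _ fun g => (C G g).measurable_X) (hD G) (π.measurable_perm G)
    (hA.cond_indep G) (hA.uniform G)
    (Φ := fun q g => (((q.1 g).2.2, q.2 g, (q.1 g).2.1), (q.1 g).1)) ?_ (fun ω => rfl)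
    (hQ.map_data G)
  fun_prop

theorem isPairedSample_onW (hQ : SamplingAssumption P₀ c P C) (hD : ∀ G g, Measurable (D G g))
    (π : MatchingRule (CovSize k)) (hA : AssignmentW P C D (π.onW C)) (G : ℕ) :
    IsPairedSample (P G) (P₀.map c.data) (fun ω g => (C G g).data ω)
      fun ω j => D G (π.onW C G ω (sndPos j)) ω := by
  refine isPairedSample_of_map (V := fun ω g => (C G g).W ω)
    (measurable_pi_lambda _ fun g => (C G g).measurable_Y.prodMk (C G g).measurable_S)
    (measurable_pi_lambda _ fun g => (C G g).measurable_W) (hD G) (π.measurable_perm G)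
    (hA.cond_indep G) (hA.uniform G)
    -- Here the size is part of the conditioning variable; it is recovered as the natural-number
    -- floor of the first coordinate of `W`.
    (Φ := fun q g => (((q.1 g).2, (q.2 g).snd, ⌊(q.2 g).fst⌋₊), (q.1 g).1)) ?_ (fun ω => ?_)
    (hQ.map_data G)
  · refine measurable_pi_lambda _ fun g => ?_
    have h1 : Measurable fun q : (Fin (2 * G) → (ℕ → Bool → ℝ) × Finset ℕ) ×
        (Fin (2 * G) → CovSize k) => WithLp.ofLp (q.2 g) :=
      (WithLp.measurable_ofLp 2 _).comp (by fun_prop)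
    exact (Measurable.prodMk (by fun_prop) ((measurable_snd.comp h1).prodMk
      (Nat.measurable_floor.comp (measurable_fst.comp h1)))).prodMk (by fun_prop)
  · funext g
    simp [Cluster.data, Cluster.char, Cluster.W]

end ClusterData

/-! ### Moment bounds under conditional independence -/

section CondIndep

theorem condExp_indicator_nonneg_le_one {m m₀ : MeasurableSpace Ω} {P : Measure Ω}
    [IsProbabilityMeasure P] (hm : m ≤ m₀) {A : Set Ω} (hA : MeasurableSet A) :
    ∀ᵐ ω ∂P, 0 ≤ (P⟦A | m⟧) ω ∧ (P⟦A | m⟧) ω ≤ 1 := by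
  have h1 : ∀ᵐ ω ∂P, (0 : ℝ) ≤ (P⟦A | m⟧) ω :=
    condExp_nonneg (Eventually.of_forall fun ω => Set.indicator_nonneg (fun _ _ => zero_le_one) ω)
  have h2 : P⟦A | m⟧ ≤ᵐ[P] P[fun _ => (1 : ℝ) | m] :=
    condExp_mono ((integrable_const _).indicator hA) (integrable_const _)
      (Eventually.of_forall fun ω => Set.indicator_le_self' (fun _ _ => zero_le_one) ω)
  rw [condExp_const hm] at h2
  filter_upwards [h1, h2] with ω h1 h2 using ⟨h1, h2⟩

variable {Ω E α β : Type*} [MeasurableSpace Ω] [MeasurableSpace E] [MeasurableSpace α]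
    [MeasurableSpace β] {P : Measure Ω} [IsProbabilityMeasure P] {V : Ω → E} {f : Ω → α}
    {h : Ω → β}

theorem setIntegral_condExp_mul (hV : Measurable V) {A : Set Ω} (hA : MeasurableSet A)
    {g : Ω → ℝ} (hg : Integrable g P) {B : Set E} (hB : MeasurableSet B) :
    Integrable (fun ω => (P⟦A | sigma V⟧) ω * g ω) P ∧
    ∫ ω in V ⁻¹' B, (P⟦A | sigma V⟧) ω * g ω ∂P =
      ∫ ω in V ⁻¹' B, (P⟦A | sigma V⟧) ω * (P[g | sigma V]) ω ∂P := by
  have hint : Integrable (fun ω => (P⟦A | sigma V⟧) ω * g ω) P := by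
    refine hg.bdd_mul (c := 1) integrable_condExp.aestronglyMeasurable ?_
    filter_upwards [condExp_indicator_nonneg_le_one (P := P) hV.comap_le hA] with ω hω
    rw [Real.norm_of_nonneg hω.1]
    exact hω.2
  refine ⟨hint, ?_⟩
  have hBm : MeasurableSet[sigma V] (V ⁻¹' B) := ⟨_, hB, rfl⟩
  rw [← setIntegral_condExp hV.comap_le hint hBm]
  refine setIntegral_congr_ae (hV.comap_le _ hBm) ?_
  filter_upwards [condExp_mul_of_stronglyMeasurable_left (μ := P) (m := sigma V)
    stronglyMeasurable_condExp hint hg] with ω hω _ using hω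

/-- Restricting to `f ⁻¹' A` has the same effect on the law of `h`, over `V`-events, as weighting by
the conditional probability of that event: tested on a set `t`, both sides are the integral of the
product of the two conditional probabilities. In this form conditional independence applies to
arbitrary nonnegative functions of `h`. -/
theorem map_restrict_eq_of_condIndep (hf : Measurable f) (hV : Measurable V) (hh : Measurable h)
    (hci : CondIndepGiven P V f h) {A : Set α} (hA : MeasurableSet A) {B : Set E}
    (hB : MeasurableSet B) :
    (P.restrict (f ⁻¹' A ∩ V ⁻¹' B)).map h = ((P.restrict (V ⁻¹' B)).withDensity
      fun ω => ENNReal.ofReal ((P⟦f ⁻¹' A | sigma V⟧) ω)).map h := by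
  ext t ht
  have hT := hh ht
  have hBm : MeasurableSet[sigma V] (V ⁻¹' B) := ⟨_, hB, rfl⟩
  have hqi : Integrable (fun ω => (P⟦f ⁻¹' A | sigma V⟧) ω) P := integrable_condExp
  have hq := condExp_indicator_nonneg_le_one (P := P) hV.comap_le (hf hA)
  rw [Measure.map_apply hh ht, Measure.map_apply hh ht, Measure.restrict_apply hT,
    withDensity_apply _ hT, Measure.restrict_restrict hT,
    ← ofReal_integral_eq_lintegral_ofReal hqi.integrableOn
      (ae_restrict_of_ae (hq.mono fun ω h => h.1)),
    ← ofReal_measureReal (by finiteness)]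
  congr 1
  have h1 := (setIntegral_condExp_mul (P := P) hV (hf hA)
    ((integrable_const (1 : ℝ)).indicator hT) hB).2
  have h2 : ∫ ω in h ⁻¹' t ∩ V ⁻¹' B, (P⟦f ⁻¹' A | sigma V⟧) ω ∂P =
      ∫ ω in V ⁻¹' B, (P⟦f ⁻¹' A | sigma V⟧) ω * (h ⁻¹' t).indicator (fun _ => (1 : ℝ)) ω ∂P := by
    rw [← Measure.restrict_restrict hT, ← integral_indicator hT]
    refine integral_congr_ae (Eventually.of_forall fun ω => ?_)
    by_cases hω : ω ∈ h ⁻¹' t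
    · simp only [Set.indicator_of_mem hω, mul_one]
    · simp only [Set.indicator_of_notMem hω, mul_zero]
  rw [h2, h1]
  have h3 := integral_condExp_indicator (P := P) hV.comap_le hBm ((hf hA).inter hT)
  rw [Set.inter_comm, Set.inter_assoc, Set.inter_comm (V ⁻¹' B), ← Set.inter_assoc, ← h3]
  exact setIntegral_congr_ae (hV.comap_le _ hBm) ((hci A t hA ht).mono fun ω hω _ => hω)

/-- By conditional independence, the conditional mean of `φ (h ω)` on `f ⁻¹' A` is the conditional
probability of this event times the conditional mean of `φ (h ω)`, so a bound given `V` survives the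
restriction. -/
theorem lintegral_le_of_condIndep (hf : Measurable f) (hV : Measurable V) (hh : Measurable h)
    (hci : CondIndepGiven P V f h) {φ : β → ℝ} (hφ : Measurable φ) (hφ0 : ∀ b, 0 ≤ φ b)
    (hint : Integrable (fun ω => φ (h ω)) P) {K : ℝ} (hK0 : 0 ≤ K) {A : Set α}
    (hA : MeasurableSet A) {B : Set E} (hB : MeasurableSet B)
    (hK : ∀ᵐ ω ∂P, V ω ∈ B → (P[fun ω => φ (h ω) | sigma V]) ω ≤ K) :
    ∫⁻ ω in f ⁻¹' A ∩ V ⁻¹' B, ENNReal.ofReal (φ (h ω)) ∂P ≤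
      ENNReal.ofReal K * P (f ⁻¹' A ∩ V ⁻¹' B) := by
  have hBm : MeasurableSet[sigma V] (V ⁻¹' B) := ⟨_, hB, rfl⟩
  have hqi : Integrable (fun ω => (P⟦f ⁻¹' A | sigma V⟧) ω) P := integrable_condExp
  have hq := condExp_indicator_nonneg_le_one (P := P) hV.comap_le (hf hA)
  have hqm : Measurable fun ω => (P⟦f ⁻¹' A | sigma V⟧) ω :=
    (stronglyMeasurable_condExp.mono hV.comap_le).measurable
  obtain ⟨hi, heq⟩ := setIntegral_condExp_mul (P := P) hV (hf hA) hint hB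
  have hq' : ∀ᵐ ω ∂P.restrict (V ⁻¹' B), 0 ≤ (P⟦f ⁻¹' A | sigma V⟧) ω :=
    ae_restrict_of_ae (hq.mono fun ω h => h.1)
  calc ∫⁻ ω in f ⁻¹' A ∩ V ⁻¹' B, ENNReal.ofReal (φ (h ω)) ∂P
      = ∫⁻ b, ENNReal.ofReal (φ b) ∂((P.restrict (f ⁻¹' A ∩ V ⁻¹' B)).map h) :=
        (lintegral_map hφ.ennreal_ofReal hh).symm
    _ = ∫⁻ ω in V ⁻¹' B, ENNReal.ofReal ((P⟦f ⁻¹' A | sigma V⟧) ω * φ (h ω)) ∂P := by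
        rw [map_restrict_eq_of_condIndep hf hV hh hci hA hB, lintegral_map hφ.ennreal_ofReal hh,
          lintegral_withDensity_eq_lintegral_mul _ hqm.ennreal_ofReal
            (g := fun ω => ENNReal.ofReal (φ (h ω))) (hφ.ennreal_ofReal.comp hh)]
        refine lintegral_congr_ae (hq'.mono fun ω hω => ?_)
        exact (ENNReal.ofReal_mul hω).symm
    _ = ENNReal.ofReal (∫ ω in V ⁻¹' B, (P⟦f ⁻¹' A | sigma V⟧) ω * φ (h ω) ∂P) :=
        (ofReal_integral_eq_lintegral_ofReal hi.integrableOn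
          (hq'.mono fun ω hω => mul_nonneg hω (hφ0 _))).symm
    _ ≤ ENNReal.ofReal (K * P.real (f ⁻¹' A ∩ V ⁻¹' B)) := by
        refine ENNReal.ofReal_le_ofReal ?_
        rw [heq, ← integral_condExp_indicator (P := P) hV.comap_le hBm (hf hA),
          ← integral_const_mul]
        refine setIntegral_mono_ae_restrict ?_ (hqi.const_mul K).integrableOn ?_
        · refine Integrable.integrableOn ?_
          refine (integrable_condExp (m := sigma V) (f := fun ω => φ (h ω))).bdd_mul (c := 1)
            hqi.aestronglyMeasurable ?_
          filter_upwards [hq] with ω hω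
          rw [Real.norm_of_nonneg hω.1]
          exact hω.2
        · filter_upwards [hq', ae_restrict_of_ae hK,
            ae_restrict_mem (hV.comap_le _ hBm)] with ω h1 h2 h3
          rw [mul_comm K]
          exact mul_le_mul_of_nonneg_left (h2 h3) h1
    _ = ENNReal.ofReal K * P (f ⁻¹' A ∩ V ⁻¹' B) := by
        rw [ENNReal.ofReal_mul hK0, ofReal_measureReal (by finiteness)]

end CondIndep

/-! ### Moments of cluster means -/

section Moments

variable {k : ℕ} {Ω₀ : Type*} [MeasurableSpace Ω₀] {P₀ : Measure Ω₀} [IsProbabilityMeasure P₀]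
  {c : Cluster k Ω₀} {Ω : ℕ → Type*} [∀ G, MeasurableSpace (Ω G)] {P : ∀ G, Measure (Ω G)}
  [∀ G, IsProbabilityMeasure (P G)] {C : ∀ G, Fin (2 * G) → Cluster k (Ω G)}

theorem Cluster.Ybar_eq (c : Cluster k Ω₀) (d : Bool) :
    c.Ybar d = fun ω => (c.data ω).mean d := by
  funext ω
  simp only [Cluster.Ybar, ClusterData.mean, Cluster.data, Cluster.char]

theorem Cluster.measurable_Ybar (c : Cluster k Ω₀) (d : Bool) : Measurable (c.Ybar d) := by
  rw [c.Ybar_eq]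
  exact (ClusterData.measurable_mean d).comp c.measurable_data

theorem Cluster.measurable_natCast_N (c : Cluster k Ω₀) : Measurable fun ω => (c.N ω : ℝ) :=
  ClusterData.measurable_size.comp c.measurable_data

theorem sq_mean_le {ι : Type*} (s : Finset ι) (y : ι → ℝ) :
    ((1 / (s.card : ℝ)) * ∑ i ∈ s, y i) ^ 2 ≤ (1 / (s.card : ℝ)) * ∑ i ∈ s, y i ^ 2 := by
  rcases s.eq_empty_or_nonempty with rfl | hs
  · simp
  have h : (0 : ℝ) < s.card := by exact_mod_cast hs.card_pos
  have h1 := sq_sum_le_card_mul_sum_sq (s := s) (f := y)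
  rw [mul_pow, one_div, inv_pow, inv_mul_le_iff₀ (by positivity)]
  calc _ ≤ _ := h1
    _ = _ := by field_simp

/-- The sampled set has countably many values. On `S = s`, Jensen bounds the squared mean by the
average of the squared outcomes over `s`, and conditional independence of `S` and the outcomes lets
the moment bound given `W` be used for each unit of the now fixed set. -/
theorem SamplingAssumption.exists_lintegral_sq_le (hQ : SamplingAssumption P₀ c P C) :
    ∃ K : ℝ, 0 ≤ K ∧ ∀ d, ∀ B : Set (CovSize k), MeasurableSet B →
      ∫⁻ ω in c.W ⁻¹' B, ENNReal.ofReal (c.Ybar d ω ^ 2) ∂P₀ ≤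
        ENNReal.ofReal K * P₀ (c.W ⁻¹' B) := by
  obtain ⟨K, hK⟩ := hQ.bounded_moment
  refine ⟨max K 0, le_max_right _ _, fun d B hB => ?_⟩
  have hWm : Measurable c.W := c.measurable_W
  have hcover : c.W ⁻¹' B = ⋃ s : Finset ℕ, c.S ⁻¹' {s} ∩ c.W ⁻¹' B := by
    ext ω
    simp
  have hms : ∀ s : Finset ℕ, MeasurableSet (c.S ⁻¹' {s} ∩ c.W ⁻¹' B) := fun s =>
    (c.measurable_S (measurableSet_singleton s)).inter (hWm hB)
  have hdisj : Pairwise (Function.onFun Disjoint fun s => c.S ⁻¹' {s} ∩ c.W ⁻¹' B) := by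
    intro s t hst
    exact Set.disjoint_left.mpr fun ω h1 h2 => hst (h1.1.symm.trans h2.1)
  rw [hcover, lintegral_iUnion hms hdisj, measure_iUnion hdisj hms, ← ENNReal.tsum_mul_left]
  refine ENNReal.tsum_le_tsum fun s => ?_
  have hs0 : 0 ≤ 1 / (s.card : ℝ) := one_div_nonneg.mpr (Nat.cast_nonneg _)
  have hYm : ∀ i, Measurable fun y : ℕ → Bool → ℝ => y i d ^ 2 := fun i =>
    ((measurable_pi_apply d).comp (measurable_pi_apply i)).pow_const 2
  have hi : ∀ i ∈ s, ∫⁻ ω in c.S ⁻¹' {s} ∩ c.W ⁻¹' B, ENNReal.ofReal (c.Y ω i d ^ 2) ∂P₀ ≤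
      ENNReal.ofReal (max K 0) * P₀ (c.S ⁻¹' {s} ∩ c.W ⁻¹' B) := by
    intro i his
    -- The moment bound is only available for units `i ≤ N`. Intersecting with this `W`-event loses
    -- nothing, since `i ∈ s` and `S = s` force it.
    set B' : Set (CovSize k) := B ∩ {w | i ∈ Finset.Icc 1 ⌊w.fst⌋₊} with hB'
    have hB'm : MeasurableSet B' := by
      refine hB.inter ?_
      have h1 : Measurable fun w : CovSize k => ⌊w.fst⌋₊ :=
        Nat.measurable_floor.comp (measurable_fst.comp (WithLp.measurable_ofLp 2 _))
      exact h1 (show MeasurableSet {n : ℕ | i ∈ Finset.Icc 1 n} from trivial)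
    have hfst : ∀ ω, ⌊(c.W ω).fst⌋₊ = c.N ω := fun ω => by simp [Cluster.W]
    have hset : c.S ⁻¹' {s} ∩ c.W ⁻¹' B = c.S ⁻¹' {s} ∩ c.W ⁻¹' B' := by
      ext ω
      simp only [Set.mem_inter_iff, Set.mem_preimage, Set.mem_singleton_iff, hB',
        Set.mem_ofPred_eq, hfst]
      constructor
      · rintro ⟨h1, h2⟩
        exact ⟨h1, h2, c.S_subset ω (h1 ▸ his)⟩
      · rintro ⟨h1, h2, _⟩
        exact ⟨h1, h2⟩
    rw [hset]
    refine lintegral_le_of_condIndep c.measurable_S hWm c.measurable_Y hQ.cond_indep (hYm i)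
      (fun _ => sq_nonneg _) (hQ.integrable_outcome i d) (le_max_right _ _)
      (measurableSet_singleton s) hB'm ?_
    filter_upwards [hK d] with ω hω hmem
    refine (hω i ?_).trans (le_max_left _ _)
    have := hmem.2
    simpa only [Set.mem_ofPred_eq, hfst] using this
  have hpt : ∀ ω ∈ c.S ⁻¹' {s} ∩ c.W ⁻¹' B, ENNReal.ofReal (c.Ybar d ω ^ 2) ≤
      ENNReal.ofReal (1 / (s.card : ℝ)) * ∑ i ∈ s, ENNReal.ofReal (c.Y ω i d ^ 2) := by
    intro ω hω
    have hS : c.S ω = s := hω.1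
    rw [← ENNReal.ofReal_sum_of_nonneg (fun _ _ => sq_nonneg _),
      ← ENNReal.ofReal_mul hs0]
    refine ENNReal.ofReal_le_ofReal ?_
    have := sq_mean_le s fun i => c.Y ω i d
    unfold Cluster.Ybar
    rwa [hS]
  have hYω : ∀ i, Measurable fun ω => ENNReal.ofReal (c.Y ω i d ^ 2) := fun i =>
    ((hYm i).comp c.measurable_Y).ennreal_ofReal
  calc ∫⁻ ω in c.S ⁻¹' {s} ∩ c.W ⁻¹' B, ENNReal.ofReal (c.Ybar d ω ^ 2) ∂P₀
      ≤ ∫⁻ ω in c.S ⁻¹' {s} ∩ c.W ⁻¹' B,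
        ENNReal.ofReal (1 / (s.card : ℝ)) * ∑ i ∈ s, ENNReal.ofReal (c.Y ω i d ^ 2) ∂P₀ :=
        setLIntegral_mono' (hms s) hpt
    _ = ENNReal.ofReal (1 / (s.card : ℝ)) *
        ∑ i ∈ s, ∫⁻ ω in c.S ⁻¹' {s} ∩ c.W ⁻¹' B, ENNReal.ofReal (c.Y ω i d ^ 2) ∂P₀ := by
        rw [lintegral_const_mul _ (Finset.measurable_fun_sum _ fun i _ => hYω i),
          lintegral_finsetSum _ fun i _ => hYω i]
    _ ≤ ENNReal.ofReal (1 / (s.card : ℝ)) *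
        ∑ _i ∈ s, ENNReal.ofReal (max K 0) * P₀ (c.S ⁻¹' {s} ∩ c.W ⁻¹' B) := by
        exact mul_le_mul_right (Finset.sum_le_sum hi) _
    _ ≤ _ := by
        rw [Finset.sum_const, nsmul_eq_mul, ← mul_assoc]
        -- The weights `1 / card` add up to one, or to zero for the empty set, where `1 / 0 = 0`.
        refine mul_le_of_le_one_left' ?_
        rw [← ENNReal.ofReal_natCast, ← ENNReal.ofReal_mul hs0,
          ← ENNReal.ofReal_one]
        refine ENNReal.ofReal_le_ofReal ?_
        rcases Nat.eq_zero_or_pos s.card with h | h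
        · simp [h]
        · have : (s.card : ℝ) ≠ 0 := by exact_mod_cast h.ne'
          field_simp
          exact le_refl _

/-- The bound on events is an inequality between two measures on the values of `W`, so it extends to
all nonnegative weights. The weights `1` and `N²` give the second moments of `Ȳ` and of `N Ȳ`. -/
theorem SamplingAssumption.exists_lintegral_mul_sq_le (hQ : SamplingAssumption P₀ c P C) :
    ∃ K : ℝ, 0 ≤ K ∧ ∀ d, ∀ φ : CovSize k → ENNReal, Measurable φ →
      ∫⁻ ω, φ (c.W ω) * ENNReal.ofReal (c.Ybar d ω ^ 2) ∂P₀ ≤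
        ENNReal.ofReal K * ∫⁻ ω, φ (c.W ω) ∂P₀ := by
  obtain ⟨K, hK0, hK⟩ := hQ.exists_lintegral_sq_le
  refine ⟨K, hK0, fun d φ hφ => ?_⟩
  have hWm : Measurable c.W := c.measurable_W
  have hYm : Measurable fun ω => ENNReal.ofReal (c.Ybar d ω ^ 2) :=
    ((c.measurable_Ybar d).pow_const 2).ennreal_ofReal
  have hle : (P₀.withDensity fun ω => ENNReal.ofReal (c.Ybar d ω ^ 2)).map c.W ≤
      ENNReal.ofReal K • P₀.map c.W := by
    refine Measure.le_iff.mpr fun B hB => ?_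
    rw [Measure.map_apply hWm hB, withDensity_apply _ (hWm hB), Measure.smul_apply,
      Measure.map_apply hWm hB, smul_eq_mul]
    exact hK d B hB
  have h := lintegral_mono' hle (le_refl φ)
  rw [lintegral_map hφ hWm, lintegral_smul_measure, lintegral_map hφ hWm,
    lintegral_withDensity_eq_lintegral_mul _ hYm (g := fun ω => φ (c.W ω)) (hφ.comp hWm)] at h
  simpa only [Pi.mul_apply, Function.comp_apply, mul_comm, smul_eq_mul] using h

theorem SamplingAssumption.ae_one_le_N (hQ : SamplingAssumption P₀ c P C) :
    ∀ᵐ ω ∂P₀, 1 ≤ (c.N ω : ℝ) := by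
  filter_upwards [hQ.one_le_card] with ω hω
  have := (Finset.card_le_card (c.S_subset ω))
  rw [Nat.card_Icc, Nat.add_sub_cancel] at this
  exact_mod_cast hω.trans this

theorem SamplingAssumption.memLp_N (hQ : SamplingAssumption P₀ c P C) :
    MemLp (fun ω => (c.N ω : ℝ)) 2 P₀ :=
  (memLp_two_iff_integrable_sq c.measurable_natCast_N.aestronglyMeasurable).mpr hQ.integrable_sq

theorem SamplingAssumption.memLp_Ybar (hQ : SamplingAssumption P₀ c P C) (d : Bool) :
    MemLp (c.Ybar d) 2 P₀ := by
  obtain ⟨K, hK0, hK⟩ := hQ.exists_lintegral_mul_sq_le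
  refine (memLp_two_iff_integrable_sq (c.measurable_Ybar d).aestronglyMeasurable).mpr ?_
  refine ⟨((c.measurable_Ybar d).pow_const 2).aestronglyMeasurable, ?_⟩
  rw [hasFiniteIntegral_iff_ofReal (Eventually.of_forall fun _ => sq_nonneg _)]
  have h := hK d (fun _ => 1) measurable_const
  rw [lintegral_const, measure_univ, mul_one, mul_one] at h
  simp only [one_mul] at h
  exact h.trans_lt ENNReal.ofReal_lt_top

theorem SamplingAssumption.memLp_N_mul_Ybar (hQ : SamplingAssumption P₀ c P C) (d : Bool) :
    MemLp (fun ω => (c.N ω : ℝ) * c.Ybar d ω) 2 P₀ := by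
  obtain ⟨K, hK0, hK⟩ := hQ.exists_lintegral_mul_sq_le
  have hm : Measurable fun ω => (c.N ω : ℝ) * c.Ybar d ω :=
    c.measurable_natCast_N.mul (c.measurable_Ybar d)
  refine (memLp_two_iff_integrable_sq hm.aestronglyMeasurable).mpr ?_
  refine ⟨(hm.pow_const 2).aestronglyMeasurable, ?_⟩
  rw [hasFiniteIntegral_iff_ofReal (Eventually.of_forall fun _ => sq_nonneg _)]
  have h := hK d (fun w => ENNReal.ofReal (w.fst ^ 2))
    ((measurable_fst.comp (WithLp.measurable_ofLp 2 _)).pow_const 2).ennreal_ofReal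
  have hN := (hasFiniteIntegral_iff_ofReal (Eventually.of_forall fun ω => sq_nonneg (c.N ω : ℝ))).mp
    hQ.integrable_sq.2
  have e : ∀ ω, ENNReal.ofReal (((c.N ω : ℝ) * c.Ybar d ω) ^ 2) =
      ENNReal.ofReal ((c.W ω).fst ^ 2) * ENNReal.ofReal (c.Ybar d ω ^ 2) := fun ω => by
    rw [mul_pow, ENNReal.ofReal_mul (sq_nonneg _)]
    rfl
  refine (lintegral_congr e).trans_lt
    (h.trans_lt (ENNReal.mul_lt_top ENNReal.ofReal_lt_top hN))

theorem SamplingAssumption.one_le_meanN (hQ : SamplingAssumption P₀ c P C) :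
    1 ≤ c.meanN P₀ := by
  have h := integral_mono_ae (integrable_const (1 : ℝ)) (hQ.memLp_N.integrable one_le_two)
    hQ.ae_one_le_N
  simpa [Cluster.meanN] using h

/-- `|E[Ȳ(d) | W]|` is bounded. -/
theorem SamplingAssumption.exists_abs_condExp_le (hQ : SamplingAssumption P₀ c P C) :
    ∃ M : ℝ, ∀ d, ∀ f : CovSize k → ℝ, Measurable f →
      (P₀[c.Ybar d | sigma c.W] =ᵐ[P₀] fun ω => f (c.W ω)) → ∀ᵐ ω ∂P₀, |f (c.W ω)| ≤ M := by
  obtain ⟨K, hK0, hK⟩ := hQ.exists_lintegral_sq_le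
  -- On the event `1 + K < |f|` also `f² ≥ 1 + K`, while the integral of `f²` there is at most `K`
  -- times its probability; so the event is null.
  refine ⟨1 + K, fun d f hf hfe => ?_⟩
  have hWm : Measurable c.W := c.measurable_W
  set B : Set (CovSize k) := {w | 1 + K < |f w|} with hB
  have hBm : MeasurableSet B := measurableSet_lt measurable_const hf.abs
  have hBs : MeasurableSet[sigma c.W] (c.W ⁻¹' B) := ⟨_, hBm, rfl⟩
  have hYL := hQ.memLp_Ybar d
  have hsq := hYL.integrable_sq
  have h1 : ∫ ω in c.W ⁻¹' B, c.Ybar d ω ^ 2 ∂P₀ ≤ K * P₀.real (c.W ⁻¹' B) := by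
    have h := hK d B hBm
    rw [← ofReal_integral_eq_lintegral_ofReal hsq.integrableOn
      (Eventually.of_forall fun _ => sq_nonneg _), ← ofReal_measureReal (by finiteness),
      ← ENNReal.ofReal_mul hK0] at h
    exact (ENNReal.ofReal_le_ofReal_iff (by positivity)).mp h
  have h2 : ∫ ω in c.W ⁻¹' B, f (c.W ω) ^ 2 ∂P₀ ≤ ∫ ω in c.W ⁻¹' B, c.Ybar d ω ^ 2 ∂P₀ := by
    rw [← setIntegral_condExp hWm.comap_le hsq hBs]
    have hle := sq_condExp_ae_le (P := P₀) hWm.comap_le hYL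
    refine integral_mono_of_nonneg (Eventually.of_forall fun _ => sq_nonneg _)
      integrable_condExp.integrableOn (ae_restrict_of_ae ?_)
    filter_upwards [hle, hfe] with ω h1 h2
    rw [← h2]
    exact h1
  have hfi : Integrable (fun ω => f (c.W ω) ^ 2) P₀ := by
    have := (hYL.condExp (m := sigma c.W) one_le_two).integrable_sq
    refine this.congr ?_
    filter_upwards [hfe] with ω hω
    rw [hω]
  have h3 : (1 + K) * P₀.real (c.W ⁻¹' B) ≤ ∫ ω in c.W ⁻¹' B, f (c.W ω) ^ 2 ∂P₀ := by
    have h : ∫ _ω in c.W ⁻¹' B, (1 + K) ∂P₀ ≤ ∫ ω in c.W ⁻¹' B, f (c.W ω) ^ 2 ∂P₀ := by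
      refine setIntegral_mono_on (integrable_const _).integrableOn hfi.integrableOn (hWm hBm)
        fun ω hω => ?_
      have hω' : 1 + K < |f (c.W ω)| := hω
      rw [← sq_abs]
      nlinarith
    rw [setIntegral_const, smul_eq_mul, mul_comm] at h
    exact h
  have h4 : P₀.real (c.W ⁻¹' B) = 0 := by
    have := measureReal_nonneg (μ := P₀) (s := c.W ⁻¹' B)
    nlinarith
  rw [measureReal_eq_zero_iff (by finiteness)] at h4
  filter_upwards [measure_eq_zero_iff_ae_notMem.mp h4] with ω hω
  exact not_lt.mp hω

end Moments

/-! ### Replacing the feasible outcome by its population version -/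

section FeasibleOutcome

theorem TendstoInProb.congr_ae {Ω : ℕ → Type*} [∀ G, MeasurableSpace (Ω G)]
    {P : ∀ G, Measure (Ω G)} {T S : ∀ G, Ω G → ℝ} {c : ℝ} (hT : TendstoInProb P T c)
    (h : ∀ᶠ G in atTop, ∀ᵐ ω ∂P G, S G ω = T G ω) : TendstoInProb P S c := by
  have h0 : TendstoInProb P (fun G ω => T G ω - c) 0 := by
    intro ε hε
    simpa using hT ε hε
  refine h0.squeeze ?_
  filter_upwards [h] with G hG
  filter_upwards [hG] with ω hω
  rw [hω]

variable {G : ℕ}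

/-- Each pair has exactly one member in arm `d`: its value is the half-sum of the pair plus or minus
the half-difference, with the sign given by the coin and the arm. -/
theorem sum_mul_arm_eq (f : Fin (2 * G) → ℝ) (σ : Equiv.Perm (Fin (2 * G))) {s : Fin G → Bool}
    {D : Fin (2 * G) → Bool} (hD : ∀ j, D (σ (fstPos j)) = (!s j) ∧ D (σ (sndPos j)) = s j)
    (d : Bool) :
    ∑ g, f g * (if D g = d then 1 else 0) = 1 / 2 * ∑ g, f g
      + sgn d * (1 / 2 * ∑ j, sgn (s j) * (f (σ (sndPos j)) - f (σ (fstPos j)))) := by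
  rw [← sum_pos_eq_sum (fun g => f g * (if D g = d then 1 else 0)) σ, ← sum_pos_eq_sum f σ,
    Finset.mul_sum, Finset.mul_sum, Finset.mul_sum, ← Finset.sum_add_distrib]
  refine Finset.sum_congr rfl fun j _ => ?_
  rw [(hD j).1, (hD j).2]
  cases s j <;> cases d <;> simp [sgn] <;> ring

/-- The weighted mean outcome of the clusters with treatment status `d`. -/
noncomputable def armMean (N : Fin (2 * G) → ℝ) (y : Fin (2 * G) → Bool → ℝ)
    (D : Fin (2 * G) → Bool) (d : Bool) : ℝ :=
  ((1 / (G : ℝ)) * ∑ j, y j d * (if D j = d then 1 else 0) * N j) /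
    ((1 / (G : ℝ)) * ∑ j, (if D j = d then 1 else 0) * N j)

/-- The feasible transformed potential outcome. -/
noncomputable def feasibleOutcome (N : Fin (2 * G) → ℝ) (y : Fin (2 * G) → Bool → ℝ)
    (D : Fin (2 * G) → Bool) (g : Fin (2 * G)) (d : Bool) : ℝ :=
  N g / ((1 / (2 * (G : ℝ))) * ∑ j, N j) * (y g d - armMean N y D d)

theorem sq_feasibleOutcome_sub_le (N y a α b β : ℝ) :
    (N * a * (y - b) - N * α * (y - β)) ^ 2 ≤
      2 * (a - α) ^ 2 * (N * y) ^ 2 + 2 * (a * b - α * β) ^ 2 * N ^ 2 := by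
  nlinarith [sq_nonneg ((a - α) * (N * y) + (a * b - α * β) * N)]

variable {𝓧 E : Type*} [MeasurableSpace 𝓧] [MeasurableSpace E]
  {Ω : ℕ → Type*} [∀ G, MeasurableSpace (Ω G)] {P : ∀ G, Measure (Ω G)}
  {Q : Measure 𝓧} [IsProbabilityMeasure Q]
  {x : ∀ G, Ω G → Fin (2 * G) → 𝓧} {s : ∀ G, Ω G → Fin G → Bool}
  {V : 𝓧 → E} {p : ∀ G, (Fin (2 * G) → E) → Equiv.Perm (Fin (2 * G))}
  {D : ∀ G, Ω G → Fin (2 * G) → Bool}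

/-- The half-sums are averaged by the law of large numbers; the signed half-differences vanish in
mean square because the coins are independent of the clusters. -/
theorem tendstoInProb_arm_average (h : ∀ G, IsPairedSample (P G) Q (x G) (s G))
    (hV : Measurable V) (hp : ∀ G σ, MeasurableSet (p G ⁻¹' {σ}))
    (hD : ∀ G, ∀ᵐ ω ∂P G, ∀ j, D G ω (p G (fun g => V (x G ω g)) (fstPos j)) = (!s G ω j) ∧
      D G ω (p G (fun g => V (x G ω g)) (sndPos j)) = s G ω j)
    {f : 𝓧 → ℝ} (hfm : Measurable f) (hf : MemLp f 2 Q) (d : Bool) :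
    TendstoInProb P (fun G ω => 1 / (G : ℝ) * ∑ g, f (x G ω g) * (if D G ω g = d then 1 else 0))
      (∫ t, f t ∂Q) := by
  have h1 := tendstoInProb_average h hfm hf
  have h2 : TendstoInProb P (fun G ω => 1 / (2 * (G : ℝ)) * ∑ j, sgn (s G ω j) *
      (f (x G ω (p G (fun g => V (x G ω g)) (sndPos j)))
        - f (x G ω (p G (fun g => V (x G ω g)) (fstPos j))))) 0 := by
    refine tendstoInProb_of_sq (C := ∫ t, f t ^ 2 ∂Q) (fun G => ?_) ?_
    · rcases Nat.eq_zero_or_pos G with rfl | hG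
      · simp only [Nat.cast_zero, mul_zero, div_zero, zero_mul]
        exact aemeasurable_const
      · exact ((h G).lintegral_sq_sgn_average_le hG hV (hp G) hfm hf).1.aemeasurable
    · filter_upwards [eventually_gt_atTop 0] with G hG
      exact ((h G).lintegral_sq_sgn_average_le hG hV (hp G) hfm hf).2
  have h3 := h1.map₂ h2 (f := fun q => q.1 + sgn d * q.2) (by fun_prop)
  simp only [mul_zero, add_zero] at h3
  refine h3.congr_ae ?_
  filter_upwards [eventually_gt_atTop 0] with G hG
  filter_upwards [hD G] with ω hω
  have hG' : (G : ℝ) ≠ 0 := by positivity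
  rw [sum_mul_arm_eq (fun g => f (x G ω g)) _ hω d]
  field_simp

/-- The error of a single cluster is `(a - α) N y - (a b - α β) N`, where `a` is the inverse mean
size, `b` the arm mean, and `α`, `β` their limits. The coefficients are common to all clusters and
tend to zero, while the averages of `(N y)²` and `N²` are bounded in mean. -/
theorem tendstoInProb_feasibleOutcome (h : ∀ G, IsPairedSample (P G) Q (x G) (s G))
    (hV : Measurable V) (hp : ∀ G σ, MeasurableSet (p G ⁻¹' {σ}))
    (hD : ∀ G, ∀ᵐ ω ∂P G, ∀ j, D G ω (p G (fun g => V (x G ω g)) (fstPos j)) = (!s G ω j) ∧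
      D G ω (p G (fun g => V (x G ω g)) (sndPos j)) = s G ω j)
    {N : 𝓧 → ℝ} (hNm : Measurable N) (hN : MemLp N 2 Q) (hN0 : ∫ t, N t ∂Q ≠ 0)
    {y : 𝓧 → Bool → ℝ} (hym : ∀ d, Measurable fun t => y t d)
    (hy : ∀ d, MemLp (fun t => N t * y t d) 2 Q) :
    TendstoInProb P (fun G ω => 1 / (2 * (G : ℝ)) * ∑ g, ∑ d,
      (feasibleOutcome (fun g => N (x G ω g)) (fun g => y (x G ω g)) (D G ω) g d
        - N (x G ω g) / (∫ t, N t ∂Q) *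
          (y (x G ω g) d - (∫ t, y t d * N t ∂Q) / ∫ t, N t ∂Q)) ^ 2) 0 := by
  set ν := ∫ t, N t ∂Q with hν
  have hNavg := tendstoInProb_average h hNm hN
  have hinv : TendstoInProb P (fun G ω => (1 / (2 * (G : ℝ)) * ∑ g, N (x G ω g))⁻¹) ν⁻¹ :=
    hNavg.map₂ hNavg (f := fun q => q.1⁻¹) (continuousAt_fst.inv₀ hN0)
  have harm : ∀ d, TendstoInProb P
      (fun G ω => armMean (fun g => N (x G ω g)) (fun g => y (x G ω g)) (D G ω) d)
      ((∫ t, y t d * N t ∂Q) / ν) := by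
    intro d
    have h1 := tendstoInProb_arm_average h hV hp hD (hNm.mul (hym d)) (hy d) d
    have h2 := tendstoInProb_arm_average h hV hp hD hNm hN d
    have h3 := h1.map₂ h2 (f := fun q => q.1 / q.2) (continuousAt_fst.div continuousAt_snd hN0)
    have e : ∫ t, (N * fun t => y t d) t ∂Q = ∫ t, y t d * N t ∂Q :=
      integral_congr_ae (Eventually.of_forall fun t => mul_comm _ _)
    simp only [e] at h3
    refine h3.congr_ae (Eventually.of_forall fun G => Eventually.of_forall fun ω => ?_)
    simp only [armMean]
    congr 2
    · refine Finset.sum_congr rfl fun j _ => ?_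
      simp only [Pi.mul_apply]
      ring
    · exact Finset.sum_congr rfl fun j _ => mul_comm _ _
  have hd : ∀ d, TendstoInProb P (fun G ω => 1 / (2 * (G : ℝ)) * ∑ g,
      (feasibleOutcome (fun g => N (x G ω g)) (fun g => y (x G ω g)) (D G ω) g d
        - N (x G ω g) / ν * (y (x G ω g) d - (∫ t, y t d * N t ∂Q) / ν)) ^ 2) 0 := by
    intro d
    set θ := (∫ t, y t d * N t ∂Q) / ν with hθ
    have hX1 : TendstoInProb P (fun G ω =>
        2 * ((1 / (2 * (G : ℝ)) * ∑ g, N (x G ω g))⁻¹ - ν⁻¹) ^ 2) 0 := by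
      have := hinv.map₂ hinv (f := fun q => 2 * (q.1 - ν⁻¹) ^ 2) (by fun_prop)
      simpa using this
    have hX2 : TendstoInProb P (fun G ω => 2 * ((1 / (2 * (G : ℝ)) * ∑ g, N (x G ω g))⁻¹ *
        armMean (fun g => N (x G ω g)) (fun g => y (x G ω g)) (D G ω) d - ν⁻¹ * θ) ^ 2) 0 := by
      have := hinv.map₂ (harm d) (f := fun q => 2 * (q.1 * q.2 - ν⁻¹ * θ) ^ 2) (by fun_prop)
      simpa [hθ] using this
    have hS : ∀ f : 𝓧 → ℝ, MemLp f 2 Q → ∀ᶠ G : ℕ in atTop,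
        Integrable (fun ω => 1 / (2 * (G : ℝ)) * ∑ g, f (x G ω g) ^ 2) (P G) ∧
        0 ≤ᵐ[P G] (fun ω => 1 / (2 * (G : ℝ)) * ∑ g, f (x G ω g) ^ 2) ∧
        ∫ ω, 1 / (2 * (G : ℝ)) * ∑ g, f (x G ω g) ^ 2 ∂P G ≤ ∫ t, f t ^ 2 ∂Q := by
      intro f hf
      filter_upwards [eventually_gt_atTop 0] with G hG
      have hi : Integrable (fun t => f t ^ 2) Q := hf.integrable_sq
      refine ⟨(h G).integrable_average hi, Eventually.of_forall fun ω => ?_,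
        ((h G).integral_average hG hi).le⟩
      exact mul_nonneg (by positivity) (Finset.sum_nonneg fun _ _ => sq_nonneg _)
    have hb := (hX1.mul_of_integral_le (hS _ (hy d))).add (hX2.mul_of_integral_le (hS _ hN))
    refine hb.squeeze (Eventually.of_forall fun G => Eventually.of_forall fun ω => ?_)
    rw [sub_zero, abs_of_nonneg
      (mul_nonneg (by positivity) (Finset.sum_nonneg fun _ _ => sq_nonneg _))]
    refine le_trans ?_ (le_abs_self _)
    rw [mul_left_comm, mul_left_comm (2 * (_ : ℝ) ^ 2), ← mul_add]
    refine mul_le_mul_of_nonneg_left ?_ (by positivity)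
    simp only [feasibleOutcome, div_eq_mul_inv (N _)]
    generalize (1 / (2 * (G : ℝ)) * ∑ g, N (x G ω g))⁻¹ = a
    rw [Finset.mul_sum, Finset.mul_sum, ← Finset.sum_add_distrib]
    refine Finset.sum_le_sum fun g _ => ?_
    exact sq_feasibleOutcome_sub_le _ _ _ _ _ _
  refine ((hd true).add (hd false)).congr_ae
    (Eventually.of_forall fun G => Eventually.of_forall fun ω => ?_)
  simp only [Fintype.sum_bool, Finset.sum_add_distrib, mul_add]

end FeasibleOutcome

/-! ### The estimator in terms of contrasts, and its limit -/

section Estimator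

/-- A regression function depends only on the joint law, so it can be carried from the space of the
generic cluster to the law of its data. -/
theorem condExp_map_ae_eq {Ω₀ 𝓧 E : Type*} [MeasurableSpace Ω₀] [MeasurableSpace 𝓧]
    [MeasurableSpace E] {P₀ : Measure Ω₀} [IsProbabilityMeasure P₀] {T : Ω₀ → 𝓧}
    (hT : Measurable T) {V : 𝓧 → E} (hV : Measurable V) {y : 𝓧 → ℝ} (hym : Measurable y)
    (hy : Integrable (fun ω => y (T ω)) P₀) {f : E → ℝ} (hf : Measurable f)
    (h : P₀[fun ω => y (T ω) | sigma fun ω => V (T ω)] =ᵐ[P₀] fun ω => f (V (T ω))) :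
    (P₀.map T)[y | sigma V] =ᵐ[P₀.map T] fun t => f (V t) := by
  have : IsProbabilityMeasure (P₀.map T) := Measure.isProbabilityMeasure_map hT.aemeasurable
  have hVT : Measurable fun ω => V (T ω) := hV.comp hT
  have hyi : Integrable y (P₀.map T) :=
    (integrable_map_measure hym.aestronglyMeasurable hT.aemeasurable).mpr hy
  have hfV : Measurable fun t => f (V t) := hf.comp hV
  have hfi : Integrable (fun t => f (V t)) (P₀.map T) :=
    (integrable_map_measure hfV.aestronglyMeasurable hT.aemeasurable).mpr
      (integrable_condExp.congr h)
  refine (ae_eq_condExp_of_forall_setIntegral_eq hV.comap_le hyi (fun _ _ _ => hfi.integrableOn)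
    ?_ ?_).symm
  · rintro _ ⟨B, hB, rfl⟩ _
    rw [setIntegral_map (hV hB) hfV.aestronglyMeasurable hT.aemeasurable,
      setIntegral_map (hV hB) hym.aestronglyMeasurable hT.aemeasurable]
    have hB' : MeasurableSet[sigma fun ω => V (T ω)] (T ⁻¹' (V ⁻¹' B)) := ⟨B, hB, rfl⟩
    rw [← setIntegral_condExp hVT.comap_le hy hB']
    exact setIntegral_congr_ae (hT (hV hB)) (h.mono fun ω hω _ => hω.symm)
  · exact (hf.comp (comap_measurable V)).aestronglyMeasurable

variable {k : ℕ}

theorem YbarObs_eq {G : ℕ} {Ω : Type*} [MeasurableSpace Ω] (C : Fin (2 * G) → Cluster k Ω)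
    (D : Fin (2 * G) → Ω → Bool) (g : Fin (2 * G)) (ω : Ω) :
    YbarObs C D g ω = ((C g).data ω).mean (D g ω) := by
  simp only [YbarObs, ClusterData.mean, Cluster.data, Cluster.char, Yobs, treat]
  congr 1
  refine Finset.sum_congr rfl fun i _ => ?_
  cases D g ω <;> simp

theorem Yhat_eq {G : ℕ} {Ω : Type*} [MeasurableSpace Ω] (C : Fin (2 * G) → Cluster k Ω)
    (D : Fin (2 * G) → Ω → Bool) (g : Fin (2 * G)) (ω : Ω) :
    Yhat C D g ω = feasibleOutcome (fun g => ((C g).data ω).size) (fun g => ((C g).data ω).mean)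
      (fun g => D g ω) g (D g ω) := by
  have h : ∀ j, YbarObs C D j ω * (if D j ω = D g ω then 1 else 0) * ((C j).N ω : ℝ) =
      ((C j).data ω).mean (D g ω) * (if D j ω = D g ω then 1 else 0) * ((C j).data ω).size := by
    -- The indicator keeps only clusters with the same treatment as `g`, for which the observed mean
    -- is the potential mean at `D g ω`.
    intro j
    rw [YbarObs_eq]
    by_cases hj : D j ω = D g ω
    · rw [hj]
      rfl
    · simp [hj]
  simp only [Yhat, feasibleOutcome, armMean, h]
  rw [YbarObs_eq]
  rfl

theorem quadPos_zero {G : ℕ} (i : Fin (G / 2)) : quadPos i 0 = fstPos (fstPair i) := by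
  simp only [quadPos, fstPos, fstPair, Fin.ext_iff, Fin.val_zero]
  omega

theorem quadPos_one {G : ℕ} (i : Fin (G / 2)) : quadPos i 1 = sndPos (fstPair i) := by
  simp only [quadPos, sndPos, fstPair, Fin.ext_iff, Fin.val_one]
  omega

theorem quadPos_two {G : ℕ} (i : Fin (G / 2)) : quadPos i 2 = fstPos (sndPair i) := by
  simp only [quadPos, fstPos, sndPair, Fin.ext_iff, Fin.val_two]
  omega

theorem quadPos_three {G : ℕ} (i : Fin (G / 2)) : quadPos i 3 = sndPos (sndPair i) := by
  simp only [quadPos, sndPos, sndPair, Fin.ext_iff]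
  change 4 * (i : ℕ) + 3 = _
  omega

/-- Multiplying an outcome difference by the matching treatment difference always gives treated
minus control, and squares ignore the sign. The factors `1 / 2` and `2 / G` combine to `1 / G`. -/
theorem vSqHat_eq_pairVar {G : ℕ} {Ω : Type*} [MeasurableSpace Ω] (C : Fin (2 * G) → Cluster k Ω)
    (D : Fin (2 * G) → Ω → Bool) (σ : Ω → Equiv.Perm (Fin (2 * G))) {ω : Ω}
    (hD : ∀ j, D (σ ω (fstPos j)) ω = !D (σ ω (sndPos j)) ω) :
    vSqHat C D σ ω = pairVar (pairContrast (feasibleOutcome (fun g => ((C g).data ω).size)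
      (fun g => ((C g).data ω).mean) fun g => D g ω) (σ ω) fun j => D (σ ω (sndPos j)) ω) := by
  set δ := pairContrast (feasibleOutcome (fun g => ((C g).data ω).size)
      (fun g => ((C g).data ω).mean) fun g => D g ω) (σ ω) fun j => D (σ ω (sndPos j)) ω with hδ
  have h1 : ∀ j, (Yhat C D (σ ω (sndPos j)) ω - Yhat C D (σ ω (fstPos j)) ω) ^ 2 = δ j ^ 2 := by
    intro j
    rw [hδ, Yhat_eq, Yhat_eq, hD j, pairContrast]
    cases D (σ ω (sndPos j)) ω
    · simp only [Bool.not_false, Bool.false_eq_true, if_false]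
      ring
    · simp
  have h2 : ∀ j, (Yhat C D (σ ω (fstPos j)) ω - Yhat C D (σ ω (sndPos j)) ω) *
      (treat D (σ ω (fstPos j)) ω - treat D (σ ω (sndPos j)) ω) = δ j := by
    intro j
    rw [hδ, Yhat_eq, Yhat_eq, treat, treat, hD j, pairContrast]
    cases D (σ ω (sndPos j)) ω <;> simp
  simp only [vSqHat, tauSqHat, lambdaSqHat, pairVar, h1, quadPos_zero, quadPos_one,
    quadPos_two, quadPos_three]
  have h3 : ∀ i : Fin (G / 2), (Yhat C D (σ ω (fstPos (fstPair i))) ω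
      - Yhat C D (σ ω (sndPos (fstPair i))) ω) *
      (Yhat C D (σ ω (fstPos (sndPair i))) ω - Yhat C D (σ ω (sndPos (sndPair i))) ω) *
      (treat D (σ ω (fstPos (fstPair i))) ω - treat D (σ ω (sndPos (fstPair i))) ω) *
      (treat D (σ ω (fstPos (sndPair i))) ω - treat D (σ ω (sndPos (sndPair i))) ω) =
      δ (fstPair i) * δ (sndPair i) := fun i => by
    rw [← h2, ← h2]
    ring
  simp only [h3]
  ring

variable {Ω₀ E : Type*} [MeasurableSpace Ω₀] [MeasurableSpace E] {P₀ : Measure Ω₀}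
  [IsProbabilityMeasure P₀] {c : Cluster k Ω₀} {Ω : ℕ → Type*} [∀ G, MeasurableSpace (Ω G)]
  {P : ∀ G, Measure (Ω G)}

theorem tendstoInProb_pairGap {μ : ∀ G, Ω G → Fin (2 * G) → Bool → ℝ}
    {σ : ∀ G, Ω G → Equiv.Perm (Fin (2 * G))} {Z : ∀ G, Ω G → Fin (2 * G) → Fin (2 * G) → ℝ} {L : ℝ}
    (hZ : ∀ G, ∀ᵐ ω ∂P G, ∀ g g' d, (μ G ω g d - μ G ω g' d) ^ 2 ≤ L * Z G ω g g')
    (hpair : TendstoInProb P (fun G ω => (1 / (G : ℝ)) * ∑ j : Fin G,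
      Z G ω (σ G ω (sndPos j)) (σ G ω (fstPos j))) 0) :
    TendstoInProb P (fun G ω => 1 / (G : ℝ) * pairGap (μ G ω) (σ G ω)) 0 := by
  refine (hpair.const_mul (2 * L)).squeeze (Eventually.of_forall fun G => ?_)
  filter_upwards [hZ G] with ω hω
  have h0 : 0 ≤ pairGap (μ G ω) (σ G ω) :=
    Finset.sum_nonneg fun _ _ => Finset.sum_nonneg fun _ _ => sq_nonneg _
  rw [sub_zero, abs_of_nonneg (by positivity)]
  refine le_trans ?_ (le_abs_self _)
  rw [mul_left_comm]
  refine mul_le_mul_of_nonneg_left ?_ (by positivity)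
  rw [Finset.mul_sum]
  refine Finset.sum_le_sum fun j _ => ?_
  rw [Fintype.sum_bool]
  linarith [hω (σ G ω (sndPos j)) (σ G ω (fstPos j)) true,
    hω (σ G ω (sndPos j)) (σ G ω (fstPos j)) false]

theorem tendstoInProb_quadGap {μ : ∀ G, Ω G → Fin (2 * G) → Bool → ℝ}
    {σ : ∀ G, Ω G → Equiv.Perm (Fin (2 * G))} {Z : ∀ G, Ω G → Fin (2 * G) → Fin (2 * G) → ℝ} {L : ℝ}
    (hZ : ∀ G, ∀ᵐ ω ∂P G, ∀ g g' d, (μ G ω g d - μ G ω g' d) ^ 2 ≤ L * Z G ω g g')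
    (hquad : ∀ a ∈ ({0, 1} : Finset (Fin 4)), ∀ b ∈ ({2, 3} : Finset (Fin 4)),
      TendstoInProb P (fun G ω => (1 / (G : ℝ)) * ∑ j : Fin (G / 2),
        Z G ω (σ G ω (quadPos j a)) (σ G ω (quadPos j b))) 0) :
    TendstoInProb P (fun G ω => 1 / (G : ℝ) * quadGap (μ G ω) (σ G ω)) 0 := by
  -- `quadGap` compares first members with first members and second with second, that is, positions
  -- 0 with 2 and 1 with 3.
  have h02 := hquad 0 (by simp) 2 (by simp)
  have h13 := hquad 1 (by simp) 3 (by simp)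
  refine ((h02.add h13).const_mul (2 * L)).squeeze (Eventually.of_forall fun G => ?_)
  filter_upwards [hZ G] with ω hω
  have h0 : 0 ≤ quadGap (μ G ω) (σ G ω) :=
    Finset.sum_nonneg fun _ _ => Finset.sum_nonneg fun _ _ => by positivity
  rw [sub_zero, abs_of_nonneg (by positivity)]
  refine le_trans ?_ (le_abs_self _)
  rw [← mul_add, mul_left_comm]
  refine mul_le_mul_of_nonneg_left ?_ (by positivity)
  rw [← Finset.sum_add_distrib, Finset.mul_sum]
  refine Finset.sum_le_sum fun i _ => ?_
  rw [quadPos_zero, quadPos_one, quadPos_two, quadPos_three, Fintype.sum_bool]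
  linarith [hω (σ G ω (fstPos (fstPair i))) (σ G ω (fstPos (sndPair i))) true,
    hω (σ G ω (fstPos (fstPair i))) (σ G ω (fstPos (sndPair i))) false,
    hω (σ G ω (sndPos (fstPair i))) (σ G ω (sndPos (sndPair i))) true,
    hω (σ G ω (sndPos (fstPair i))) (σ G ω (sndPos (sndPair i))) false]

variable [∀ G, IsProbabilityMeasure (P G)] {C : ∀ G, Fin (2 * G) → Cluster k (Ω G)}
  {D : ∀ G, Fin (2 * G) → Ω G → Bool}

theorem Cluster.Ytilde_eq_sub (c : Cluster k Ω₀) (P₀ : Measure Ω₀) (d : Bool) (ω : Ω₀) :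
    c.Ytilde P₀ d ω = (c.meanN P₀)⁻¹ * ((c.N ω : ℝ) * c.Ybar d ω)
      - (c.meanN P₀)⁻¹ * ((∫ ω', c.Ybar d ω' * (c.N ω' : ℝ) ∂P₀) / c.meanN P₀) * (c.N ω : ℝ) := by
  rw [Cluster.Ytilde]
  ring

theorem SamplingAssumption.memLp_Ytilde (hQ : SamplingAssumption P₀ c P C) (d : Bool) :
    MemLp (c.Ytilde P₀ d) 2 P₀ := by
  have h : MemLp (fun ω => (c.meanN P₀)⁻¹ * ((c.N ω : ℝ) * c.Ybar d ω)
      - (c.meanN P₀)⁻¹ * ((∫ ω', c.Ybar d ω' * (c.N ω' : ℝ) ∂P₀) / c.meanN P₀) * (c.N ω : ℝ)) 2 P₀ :=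
    ((hQ.memLp_N_mul_Ybar d).const_mul _).sub (hQ.memLp_N.const_mul _)
  exact h.ae_eq (Eventually.of_forall fun ω => (c.Ytilde_eq_sub P₀ d ω).symm)

/-- Consistency of `v̂²` when the conditional means of `Ỹ(d)` are close within pairs and within
pairs of pairs. -/
theorem tendstoInProb_vSqHat (hQ : SamplingAssumption P₀ c P C) {V : ClusterData k → E}
    (hV : Measurable V) {p : ∀ G, (Fin (2 * G) → E) → Equiv.Perm (Fin (2 * G))}
    (hp : ∀ G τ, MeasurableSet (p G ⁻¹' {τ})) {σ : ∀ G, Ω G → Equiv.Perm (Fin (2 * G))}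
    (hσ : ∀ G ω, σ G ω = p G fun g => V ((C G g).data ω))
    (hs : ∀ G, IsPairedSample (P G) (P₀.map c.data) (fun ω g => (C G g).data ω)
      fun ω j => D G (σ G ω (sndPos j)) ω)
    (hD : ∀ G, ∀ᵐ ω ∂P G, ∀ j, D G (σ G ω (fstPos j)) ω = !D G (σ G ω (sndPos j)) ω)
    {μ : E → Bool → ℝ} (hμm : ∀ d, Measurable fun v => μ v d)
    (hμ : ∀ d, P₀[c.Ytilde P₀ d | sigma fun ω => V (c.data ω)]
      =ᵐ[P₀] fun ω => μ (V (c.data ω)) d)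
    {Z : ∀ G, Ω G → Fin (2 * G) → Fin (2 * G) → ℝ} {L : ℝ}
    (hZ : ∀ G, ∀ᵐ ω ∂P G, ∀ g g' d,
      (μ (V ((C G g).data ω)) d - μ (V ((C G g').data ω)) d) ^ 2 ≤ L * Z G ω g g')
    (hpair : TendstoInProb P (fun G ω => (1 / (G : ℝ)) * ∑ j : Fin G,
      Z G ω (σ G ω (sndPos j)) (σ G ω (fstPos j))) 0)
    (hquad : ∀ a ∈ ({0, 1} : Finset (Fin 4)), ∀ b ∈ ({2, 3} : Finset (Fin 4)),
      TendstoInProb P (fun G ω => (1 / (G : ℝ)) * ∑ j : Fin (G / 2),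
        Z G ω (σ G ω (quadPos j a)) (σ G ω (quadPos j b))) 0) :
    TendstoInProb P (fun G => vSqHat (C G) (D G) (σ G))
      (c.asympVar P₀ fun ω => V (c.data ω)) := by
  have hT := c.measurable_data
  have hVT : Measurable fun ω => V (c.data ω) := hV.comp hT
  set θ : Bool → ℝ := fun d => (∫ ω, c.Ybar d ω * (c.N ω : ℝ) ∂P₀) / c.meanN P₀ with hθ
  set y : ClusterData k → Bool → ℝ := fun t d => t.size / c.meanN P₀ * (t.mean d - θ d) with hy
  have hyt : ∀ d, (fun ω => y (c.data ω) d) = c.Ytilde P₀ d := by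
    intro d
    funext ω
    simp only [hy, hθ, Cluster.Ytilde, c.Ybar_eq]
    rfl
  have hym : ∀ d, Measurable fun t => y t d := fun d =>
    (ClusterData.measurable_size.div_const _).mul ((ClusterData.measurable_mean d).sub_const _)
  have hyL : ∀ d, MemLp (fun t => y t d) 2 (P₀.map c.data) := fun d => by
    rw [memLp_map_measure_iff (hym d).aestronglyMeasurable hT.aemeasurable]
    change MemLp (fun ω => y (c.data ω) d) 2 P₀
    rw [hyt]
    exact hQ.memLp_Ytilde d
  have hsize : ∫ t, t.size ∂(P₀.map c.data) = c.meanN P₀ :=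
    integral_map hT.aemeasurable ClusterData.measurable_size.aestronglyMeasurable
  have hmean : ∀ d, ∫ t, t.mean d * t.size ∂(P₀.map c.data) =
      ∫ ω, c.Ybar d ω * (c.N ω : ℝ) ∂P₀ := fun d => by
    have hm : Measurable fun t : ClusterData k => t.mean d * t.size :=
      (ClusterData.measurable_mean d).mul ClusterData.measurable_size
    rw [integral_map hT.aemeasurable hm.aestronglyMeasurable, c.Ybar_eq]
    rfl
  have hN0 : c.meanN P₀ ≠ 0 := by linarith [hQ.one_le_meanN]
  have hDs : ∀ G, ∀ᵐ ω ∂P G, ∀ j,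
      D G (p G (fun g => V ((C G g).data ω)) (fstPos j)) ω = (!D G (σ G ω (sndPos j)) ω) ∧
      D G (p G (fun g => V ((C G g).data ω)) (sndPos j)) ω = D G (σ G ω (sndPos j)) ω := fun G => by
    filter_upwards [hD G] with ω hω j
    rw [← hσ]
    exact ⟨hω j, rfl⟩
  have hyhat := tendstoInProb_feasibleOutcome (D := fun G ω g => D G g ω) hs hV hp hDs
    ClusterData.measurable_size
    ((memLp_map_measure_iff ClusterData.measurable_size.aestronglyMeasurable hT.aemeasurable).mpr
      hQ.memLp_N) (by rwa [hsize]) (y := fun t => t.mean) ClusterData.measurable_mean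
    (fun d => (memLp_map_measure_iff (ClusterData.measurable_size.mul
      (ClusterData.measurable_mean d)).aestronglyMeasurable hT.aemeasurable).mpr (by
        have := hQ.memLp_N_mul_Ybar d
        rw [c.Ybar_eq] at this
        exact this))
  rw [hsize] at hyhat
  simp only [hmean] at hyhat
  have hpair' := tendstoInProb_pairGap (μ := fun G ω g => μ (V ((C G g).data ω))) (σ := σ) hZ hpair
  have hquad' := tendstoInProb_quadGap (μ := fun G ω g => μ (V ((C G g).data ω))) (σ := σ) hZ hquad
  simp only [hσ] at hpair' hquad'
  have main := tendstoInProb_pairVar hs hV hp (y := y)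
    (measurable_pi_lambda _ hym) hyL
    (fun d => condExp_map_ae_eq hT hV (hym d)
      (by rw [hyt]; exact (hQ.memLp_Ytilde d).integrable one_le_two) (hμm d)
      (by rw [hyt]; exact hμ d)) hpair' hquad' hyhat
  have hlim : (∫ t, y t true ^ 2 ∂(P₀.map c.data)) + (∫ t, y t false ^ 2 ∂(P₀.map c.data))
      - 1 / 2 * ∫ t, (μ (V t) true + μ (V t) false) ^ 2 ∂(P₀.map c.data) =
      c.asympVar P₀ fun ω => V (c.data ω) := by
    have hsq : ∀ d, ∫ t, y t d ^ 2 ∂(P₀.map c.data) = ∫ ω, c.Ytilde P₀ d ω ^ 2 ∂P₀ := fun d => by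
      rw [integral_map hT.aemeasurable ((hym d).pow_const 2).aestronglyMeasurable, ← hyt]
    have hm : Measurable fun t => (μ (V t) true + μ (V t) false) ^ 2 :=
      (((hμm true).comp hV).add ((hμm false).comp hV)).pow_const 2
    rw [hsq, hsq, Cluster.asympVar, integral_map hT.aemeasurable hm.aestronglyMeasurable]
    congr 2
    refine integral_congr_ae ?_
    filter_upwards [hμ true, hμ false, condExp_add (m := sigma fun ω => V (c.data ω))
      ((hQ.memLp_Ytilde true).integrable one_le_two)
      ((hQ.memLp_Ytilde false).integrable one_le_two)] with ω h1 h2 h3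
    rw [← h1, ← h2]
    exact congrArg (· ^ 2) h3.symm
  rw [hlim] at main
  refine main.congr_ae (Eventually.of_forall fun G => ?_)
  filter_upwards [hD G] with ω hω
  rw [vSqHat_eq_pairVar _ _ _ hω, hσ]

end Estimator

/-! ### The two matching designs -/

section Cases

variable {k : ℕ} {Ω₀ : Type*} [MeasurableSpace Ω₀] {P₀ : Measure Ω₀} [IsProbabilityMeasure P₀]
  {c : Cluster k Ω₀} {Ω : ℕ → Type*} [∀ G, MeasurableSpace (Ω G)] {P : ∀ G, Measure (Ω G)}
  [∀ G, IsProbabilityMeasure (P G)] {C : ∀ G, Fin (2 * G) → Cluster k (Ω G)}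
  {D : ∀ G, Fin (2 * G) → Ω G → Bool}

theorem abs_sub_le_of_lipschitz {E : Type*} [SeminormedAddCommGroup E] {f : E → ℝ} {K : NNReal}
    (hf : LipschitzWith K f) (u v : E) : |f u - f v| ≤ K * ‖u - v‖ := by
  rw [← Real.dist_eq, ← dist_eq_norm]
  exact hf.dist_le_mul u v

/-- `Ỹ(d)` is a linear combination of `N Ȳ(d)` and `N`, whose conditional means given `X` are
Lipschitz. Hence squared increments of the conditional mean of `Ỹ(d)` are at most a constant times
`‖u - v‖²`. -/
theorem tendstoInProb_vSqHat_onX (hQ : SamplingAssumption P₀ c P C)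
    (hD : ∀ G g, Measurable (D G g)) (π : MatchingRule (Cov k))
    (hA : AssignmentX P C D (π.onX C)) (hpair : ClosePairsX P C (π.onX C)) (hS : SmoothX P₀ c)
    (hquad : ClosePairsOfPairsX P C (π.onX C)) :
    TendstoInProb P (fun G => vSqHat (C G) (D G) (π.onX C G)) (c.omegaSq P₀) := by
  set θ : Bool → ℝ := fun d => (∫ ω, c.Ybar d ω * (c.N ω : ℝ) ∂P₀) / c.meanN P₀ with hθ
  set α := (c.meanN P₀)⁻¹ with hα
  choose f K hf hfe using fun d => hS.lipschitz d 1 one_le_two 1 one_le_two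
  choose e J he hee using fun d => hS.lipschitz d 0 zero_le_two 1 one_le_two
  have hm : ∀ d, Measurable fun v => α * f d v - α * θ d * e d v := fun d =>
    ((hf d).continuous.measurable.const_mul _).sub ((he d).continuous.measurable.const_mul _)
  have hμ : ∀ d, P₀[c.Ytilde P₀ d | sigma fun ω => (c.data ω).cov]
      =ᵐ[P₀] fun ω => α * f d (c.data ω).cov - α * θ d * e d (c.data ω).cov := by
    intro d
    have hYN := (hQ.memLp_N_mul_Ybar d).integrable one_le_two
    have hN := hQ.memLp_N.integrable one_le_two
    have h1 : (fun ω => c.Ybar d ω ^ 1 * (c.N ω : ℝ) ^ 1) = fun ω => (c.N ω : ℝ) * c.Ybar d ω := by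
      funext ω
      ring
    have h2 : (fun ω => c.Ybar d ω ^ 0 * (c.N ω : ℝ) ^ 1) = fun ω => (c.N ω : ℝ) := by
      funext ω
      ring
    have hf' := hfe d
    have he' := hee d
    rw [h1] at hf'
    rw [h2] at he'
    have hsplit : c.Ytilde P₀ d = (α • fun ω => (c.N ω : ℝ) * c.Ybar d ω)
        - ((α * θ d) • fun ω => (c.N ω : ℝ)) := by
      funext ω
      rw [Cluster.Ytilde_eq_sub]
      rfl
    rw [hsplit]
    filter_upwards [condExp_sub (m := sigma c.X) (hYN.smul α) (hN.smul (α * θ d)),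
      condExp_smul (μ := P₀) α (fun ω => (c.N ω : ℝ) * c.Ybar d ω) (sigma c.X),
      condExp_smul (μ := P₀) (α * θ d) (fun ω => (c.N ω : ℝ)) (sigma c.X), hf', he']
      with ω h1 h2 h3 h4 h5
    refine h1.trans ?_
    rw [Pi.sub_apply, h2, h3, Pi.smul_apply, Pi.smul_apply, h4, h5]
    rfl
  set B : Bool → ℝ := fun d => |α| * K d + |α * θ d| * J d with hB
  have hbound : ∀ d u v, ((α * f d u - α * θ d * e d u) - (α * f d v - α * θ d * e d v)) ^ 2 ≤
      (∑ d, B d ^ 2) * ‖u - v‖ ^ 2 := by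
    intro d u v
    have h1 : |(α * f d u - α * θ d * e d u) - (α * f d v - α * θ d * e d v)| ≤
        B d * ‖u - v‖ := by
      have e1 : (α * f d u - α * θ d * e d u) - (α * f d v - α * θ d * e d v) =
          α * (f d u - f d v) - α * θ d * (e d u - e d v) := by ring
      rw [e1]
      refine (abs_sub _ _).trans ?_
      rw [abs_mul, abs_mul (α * θ d), hB, add_mul, mul_assoc, mul_assoc]
      exact add_le_add (mul_le_mul_of_nonneg_left (abs_sub_le_of_lipschitz (hf d) u v) (abs_nonneg _))
        (mul_le_mul_of_nonneg_left (abs_sub_le_of_lipschitz (he d) u v) (abs_nonneg _))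
    rw [← sq_abs]
    calc _ ≤ (B d * ‖u - v‖) ^ 2 := by gcongr
      _ = B d ^ 2 * ‖u - v‖ ^ 2 := mul_pow _ _ _
      _ ≤ _ := by
        gcongr
        exact Finset.single_le_sum (f := fun d => B d ^ 2) (fun _ _ => sq_nonneg _)
          (Finset.mem_univ d)
  exact tendstoInProb_vSqHat hQ (V := ClusterData.cov) ClusterData.measurable_cov
    (p := π.perm) π.measurable_perm (σ := π.onX C) (fun G ω => rfl)
    (isPairedSample_onX hQ hD π hA)
    (fun G => ae_fst_eq_not_snd (V := fun ω g => (C G g).X ω)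
      (measurable_pi_lambda _ fun g => (C G g).measurable_X) (hD G) (π.measurable_perm G)
      (hA.uniform G))
    (μ := fun v d => α * f d v - α * θ d * e d v) hm hμ
    (Z := fun G ω g g' => ‖(C G g).X ω - (C G g').X ω‖ ^ 2) (L := ∑ d, B d ^ 2)
    (fun G => Eventually.of_forall fun ω g g' d => hbound d _ _)
    (hpair 2 (by simp)) hquad

/-- Given `W` the size is known, so the conditional mean of `Ỹ(d)` is `α N (f(W) - θ)` with `f`
Lipschitz. Such a product need not be Lipschitz, but its increment splits into `u.fst * (f u - f v)`
and `(u.fst - v.fst) * (f v - θ)`. Since `f` is bounded on the values of `W` and `u.fst ≥ 1`, both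
are at most a constant times `u.fst * ‖u - v‖`. -/
theorem tendstoInProb_vSqHat_onW (hQ : SamplingAssumption P₀ c P C)
    (hD : ∀ G g, Measurable (D G g)) (π : MatchingRule (CovSize k))
    (hA : AssignmentW P C D (π.onW C)) (hpair : ClosePairsW P C (π.onW C)) (hS : SmoothW P₀ c)
    (hquad : ClosePairsOfPairsW P C (π.onW C)) :
    TendstoInProb P (fun G => vSqHat (C G) (D G) (π.onW C G)) (c.nuSq P₀) := by
  set θ : Bool → ℝ := fun d => (∫ ω, c.Ybar d ω * (c.N ω : ℝ) ∂P₀) / c.meanN P₀ with hθ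
  set α := (c.meanN P₀)⁻¹ with hα
  choose f K hf hfe using fun d => hS d 1 (by simp)
  simp only [pow_one] at hfe
  obtain ⟨M, hM⟩ := hQ.exists_abs_condExp_le
  have hfst : Measurable fun w : CovSize k => w.fst :=
    measurable_fst.comp (WithLp.measurable_ofLp 2 _)
  have hm : ∀ d, Measurable fun w : CovSize k => α * w.fst * (f d w - θ d) := fun d =>
    (hfst.const_mul _).mul ((hf d).continuous.measurable.sub_const _)
  have hμ : ∀ d, P₀[c.Ytilde P₀ d | sigma fun ω => (c.data ω).covSize]
      =ᵐ[P₀] fun ω => α * (c.data ω).covSize.fst * (f d (c.data ω).covSize - θ d) := by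
    intro d
    have hY := (hQ.memLp_Ybar d).integrable one_le_two
    have hsplit : c.Ytilde P₀ d = (fun ω => α * (c.W ω).fst) * (c.Ybar d - fun _ => θ d) := by
      funext ω
      simp only [Cluster.Ytilde, Pi.mul_apply, Pi.sub_apply, div_eq_mul_inv (c.N ω : ℝ),
        mul_comm (c.N ω : ℝ)]
      rfl
    have hint := (hQ.memLp_Ytilde d).integrable one_le_two
    have hNm : StronglyMeasurable[sigma c.W] fun ω => α * (c.W ω).fst :=
      ((hfst.const_mul α).comp (comap_measurable c.W)).stronglyMeasurable
    rw [hsplit] at hint ⊢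
    filter_upwards [condExp_mul_of_stronglyMeasurable_left hNm hint (hY.sub (integrable_const _)),
      condExp_sub (m := sigma c.W) hY (integrable_const (θ d)), hfe d] with ω h1 h2 h3
    refine h1.trans ?_
    rw [Pi.mul_apply, h2, Pi.sub_apply, h3, condExp_const c.measurable_W.comap_le]
    rfl
  set B : Bool → ℝ := fun d => |α| * (K d + M + |θ d|) with hB
  -- The bounds hold almost surely for the generic cluster; each sampled cluster has the same law,
  -- and there are finitely many of them.
  have hgood : ∀ G, ∀ᵐ ω ∂P G, ∀ g, (1 ≤ ((C G g).W ω).fst ∧ ∀ d, |f d ((C G g).W ω)| ≤ M) := by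
    intro G
    rw [ae_all_iff]
    intro g
    have h0 : ∀ᵐ t ∂(P₀.map c.data), 1 ≤ t.covSize.fst ∧ ∀ d, |f d t.covSize| ≤ M := by
      have hset : MeasurableSet {t : ClusterData k | 1 ≤ t.covSize.fst ∧
          ∀ d, |f d t.covSize| ≤ M} := by
        refine (measurableSet_le measurable_const
          (hfst.comp ClusterData.measurable_covSize)).inter ?_
        have : {t : ClusterData k | ∀ d, |f d t.covSize| ≤ M} =
            ⋂ d, {t : ClusterData k | |f d t.covSize| ≤ M} := by
          ext t
          simp
        change MeasurableSet {t : ClusterData k | ∀ d, |f d t.covSize| ≤ M}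
        rw [this]
        exact MeasurableSet.iInter fun d => measurableSet_le
          ((hf d).continuous.measurable.comp ClusterData.measurable_covSize).abs measurable_const
      rw [ae_map_iff c.measurable_data.aemeasurable hset]
      filter_upwards [hQ.ae_one_le_N, ae_all_iff.mpr fun d =>
        hM d (f d) (hf d).continuous.measurable (hfe d)] with ω h1 h2 using ⟨h1, h2⟩
    exact ((isPairedSample_onW hQ hD π hA G).measurePreserving_apply g).quasiMeasurePreserving.ae h0
  have hbound : ∀ d (u v : CovSize k), 1 ≤ u.fst → |f d v| ≤ M →
      (α * u.fst * (f d u - θ d) - α * v.fst * (f d v - θ d)) ^ 2 ≤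
      (∑ d, B d ^ 2) * (u.fst ^ 2 * ‖u - v‖ ^ 2) := by
    intro d u v hu hv
    have hM0 : 0 ≤ M := (abs_nonneg _).trans hv
    have h1 : |α * u.fst * (f d u - θ d) - α * v.fst * (f d v - θ d)| ≤
        B d * (u.fst * ‖u - v‖) := by
      have e1 : α * u.fst * (f d u - θ d) - α * v.fst * (f d v - θ d) =
          α * (u.fst * (f d u - f d v) + (u.fst - v.fst) * (f d v - θ d)) := by ring
      have hn : |u.fst - v.fst| ≤ ‖u - v‖ := WithLp.norm_fst_le _ (u - v)
      have hl := abs_sub_le_of_lipschitz (hf d) u v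
      have ht : |f d v - θ d| ≤ M + |θ d| := (abs_sub _ _).trans (by linarith)
      have h2 : |u.fst * (f d u - f d v)| ≤ K d * (u.fst * ‖u - v‖) := by
        rw [abs_mul, abs_of_nonneg (by linarith : 0 ≤ u.fst)]
        calc u.fst * |f d u - f d v| ≤ u.fst * (K d * ‖u - v‖) := by gcongr
          _ = _ := by ring
      have h3 : |(u.fst - v.fst) * (f d v - θ d)| ≤ (M + |θ d|) * (u.fst * ‖u - v‖) := by
        rw [abs_mul, mul_comm]
        have h4 : |u.fst - v.fst| ≤ u.fst * ‖u - v‖ := by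
          nlinarith [norm_nonneg (u - v)]
        exact mul_le_mul ht h4 (abs_nonneg _) (by positivity)
      rw [e1, abs_mul, hB]
      have h5 := (abs_add_le (u.fst * (f d u - f d v)) ((u.fst - v.fst) * (f d v - θ d))).trans
        (add_le_add h2 h3)
      calc _ ≤ |α| * (K d * (u.fst * ‖u - v‖) + (M + |θ d|) * (u.fst * ‖u - v‖)) :=
            mul_le_mul_of_nonneg_left h5 (abs_nonneg _)
        _ = _ := by ring
    rw [← sq_abs]
    calc _ ≤ (B d * (u.fst * ‖u - v‖)) ^ 2 := by gcongr
      _ = B d ^ 2 * (u.fst ^ 2 * ‖u - v‖ ^ 2) := by ring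
      _ ≤ _ := by
        gcongr
        exact Finset.single_le_sum (f := fun d => B d ^ 2) (fun _ _ => sq_nonneg _)
          (Finset.mem_univ d)
  refine tendstoInProb_vSqHat hQ (V := ClusterData.covSize) ClusterData.measurable_covSize
    (p := π.perm) π.measurable_perm (σ := π.onW C) (fun G ω => rfl)
    (isPairedSample_onW hQ hD π hA)
    (fun G => ae_fst_eq_not_snd (V := fun ω g => (C G g).W ω)
      (measurable_pi_lambda _ fun g => (C G g).measurable_W) (hD G) (π.measurable_perm G)
      (hA.uniform G))
    (μ := fun w d => α * w.fst * (f d w - θ d)) hm hμ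
    (Z := fun G ω g g' => ((C G g).N ω : ℝ) ^ 2 * ‖(C G g).W ω - (C G g').W ω‖ ^ 2)
    (L := ∑ d, B d ^ 2) (fun G => ?_) (hpair 2 (by simp) 2 (by simp)) hquad
  filter_upwards [hgood G] with ω hω g g' d
  exact hbound d _ _ (hω g).1 ((hω g').2 d)

end Cases

end ClusterTrial

theorem mainTheorem3 {k : ℕ}
    {Ω₀ : Type*} [MeasurableSpace Ω₀] (P₀ : Measure Ω₀) [IsProbabilityMeasure P₀]
    (c : Cluster k Ω₀)
    {Ω : ℕ → Type*} [∀ G, MeasurableSpace (Ω G)]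
    (P : ∀ G, Measure (Ω G)) [∀ G, IsProbabilityMeasure (P G)]
    (C : ∀ G, Fin (2 * G) → Cluster k (Ω G))
    (D : ∀ G, Fin (2 * G) → Ω G → Bool) (hD : ∀ G g, Measurable (D G g))
    (hQ : SamplingAssumption P₀ c P C) :
    (∀ π : MatchingRule (Cov k),
      AssignmentX P C D (π.onX C) → ClosePairsX P C (π.onX C) → SmoothX P₀ c →
      ClosePairsOfPairsX P C (π.onX C) →
      TendstoInProb P (fun G => vSqHat (C G) (D G) (π.onX C G)) (c.omegaSq P₀)) ∧
    (∀ π : MatchingRule (CovSize k),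
      AssignmentW P C D (π.onW C) → ClosePairsW P C (π.onW C) → SmoothW P₀ c →
      ClosePairsOfPairsW P C (π.onW C) →
      TendstoInProb P (fun G => vSqHat (C G) (D G) (π.onW C G)) (c.nuSq P₀)) :=
  ⟨fun π hA hpair hS hquad => tendstoInProb_vSqHat_onX hQ hD π hA hpair hS hquad,
    fun π hA hpair hS hquad => tendstoInProb_vSqHat_onW hQ hD π hA hpair hS hquad⟩
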